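/- **Setting.** Let $\mathcal F=\mathcal F_1\otimes\dots\otimes\mathcal F_N$ be a tensor product of single-mode Fock spaces with orthonormal occupation number basis $|n_1,\dots,n_N\rangle$, $n_i\in\mathbb N$, and let $H_{free}$ be the free Hamiltonian with $H_{free}|n_1,\dots,n_N\rangle=\big(\sum_i\mu_in_i\big)|n_1,\dots,n_N\rangle$, where $\mu_1,\dots,\mu_N>0$. Let $\mathcal H_E$ be its eigenspace of energy $E$. Fix an energy $\Delta$ with $d_\Delta=\dim\mathcal H_\Delta\ge 1$, let $P^\Delta$ be the projector onto $\mathcal H_\Delta$, and for a cutoff $\Lambda>0$ let $P^\Lambda$ be the projector onto $\bigoplus_{E<\Lambda}\mathcal H_E$. Let $S\subseteq\{1,\dots,N\}$ be a set of modes, $\bar S$ its complement, and let $d_S^\Lambda$ be the number of distinct tuples $(n_i)_{i\in S}$ that occur among the $(n_1,\dots,n_N)$ with $\sum_i\mu_in_i<\Lambda$. Let $H$ be an arbitrary self-adjoint (interacting) Hamiltonian on $\mathcal F$ with an orthonormal basis of eigenvectors $|k\rangle$, $H|k\rangle=E_k|k\rangle$, and non-degenerate gaps: $E_k-E_l=E_m-E_n$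 only if ($k=l$ and $m=n$) or ($k=m$ and $l=n$); in particular the levels are non-degenerate. For a unit vector $\psi_0\in\mathcal H_\Delta$ let $\psi(t)$ be the density operator of $e^{-iHt}\psi_0$. Write $\langle f\rangle_t=\lim_{T\to\infty}\frac1T\int_0^Tf(t)\,dt$, and put $$\omega=\langle\psi(t)\rangle_t,\quad d_{eff}(\omega)=\frac1{\operatorname{tr}(\omega^2)},\quad \rho_S(t)=\operatorname{tr}_{\bar S}\psi(t),\quad \omega_S=\operatorname{tr}_{\bar S}\omega,$$ $$\rho_S^\Lambda(t)=\operatorname{tr}_{\bar S}(P^\Lambda\psi(t)P^\Lambda),\qquad \omega_S^\Lambda=\operatorname{tr}_{\bar S}(P^\Lambda\omega P^\Lambda).$$ Let $\|X\|_1=\operatorname{tr}\sqrt{X^\dagger X}$ be the trace norm, let $\mathrm{Prob}$ and $\langle\cdot\rangle_{\psi_0}$ refer to the uniform distribution of $\psi_0$ on the unit sphere of $\mathcal H_\Delta$, and let $$\delta^\Lambda=\sum_k\langle k|\tfrac{P^\Delta}{d_\Delta}|k\rangle\,\operatorname{tr}\!\big[\big(\operatorname{tr}_{\bar S}(P^\Lambda|k\rangle\langle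 k|P^\Lambda)\big)^2\big].$$ **Theorem.** For every unit vector $\psi_0\in\mathcal H_\Delta$ the time average $\omega$ exists, the time averages in (i) and (ii) exist, and (i) (Fluctuations) $\displaystyle\big\langle\|\rho_S^\Lambda(t)-\omega_S^\Lambda\|_1\big\rangle_t\le\sqrt{\frac{(d_S^\Lambda)^2}{d_{eff}(\omega)}}$; (ii) (Truncation error) $\displaystyle\big\langle\|(\rho_S(t)-\omega_S)-(\rho_S^\Lambda(t)-\omega_S^\Lambda)\|_1\big\rangle_t\le 6\sqrt{\frac{\operatorname{tr}(\omega H_{free})}{\Lambda}}$, where $\operatorname{tr}(\omega H_{free})\in[0,\infty]$. Moreover, for random $\psi_0$: (iii) (Typicality) $\displaystyle\mathrm{Prob}\Big(d_{eff}(\omega)<\frac{d_\Delta}4\Big)\le 2e^{-c\sqrt{d_\Delta}}$ with $c=\frac{(\ln2)^2}{72\pi^3}$; (iv) (Universality) for every $\varepsilon>0$, with $c'=\frac{2}{9\pi^3}$, $$\mathrm{Prob}\Big(\tfrac12\big\|\omega_S^\Lambda(\psi_0)-\langle\omega_S^\Lambda\rangle_{\psi_0}\big\|_1>\tfrac12\sqrt{\frac{d_S^\Lambda\,\delta^\Lambda}{d_\Delta}}+\varepsilon\Big)\le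 2e^{-c'\varepsilon^2d_\Delta}.$$ -/

import Mathlib

open MeasureTheory Filter Topology
open scoped ENNReal

namespace Equilibration

noncomputable section

/-! ### Operators on Hilbert space -/

/-- The absolute value `|T| = √(T† T)` of a bounded operator on a Hilbert space. -/
def opAbs {H : Type*} [NormedAddCommGroup H] [InnerProductSpace ℂ H] [CompleteSpace H]
    (T : H →L[ℂ] H) : H →L[ℂ] H :=
  CFC.abs T

/-- The Hilbert space `ℓ²(I)` with its distinguished orthonormal basis `ket`. -/
abbrev Ltwo (I : Type*) : Type _ := lp (fun _ : I => ℂ) 2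

/-- The basis vector `|i⟩`. -/
def ket {I : Type*} [DecidableEq I] (i : I) : Ltwo I := lp.single 2 i (1 : ℂ)

/-- `|x⟩⟨y|`. -/
def ketbra {I : Type*} (x y : Ltwo I) : Ltwo I →L[ℂ] Ltwo I := InnerProductSpace.rankOne ℂ x y

/-- The trace of a (trace class) operator. -/
def trace {I : Type*} [DecidableEq I] (T : Ltwo I →L[ℂ] Ltwo I) : ℂ :=
  ∑' i, inner ℂ (ket i) (T (ket i))

/-- The trace norm `‖T‖₁ = tr √(T† T)`, with value `∞` if `T` is not trace class. -/
def traceNorm {I : Type*} [DecidableEq I] (T : Ltwo I →L[ℂ] Ltwo I) : ℝ≥0∞ :=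
  ∑' i, ENNReal.ofReal (inner ℂ (ket i) (opAbs T (ket i))).re

/-- The orthogonal projector onto the span of the basis vectors in a finite set. -/
def proj {I : Type*} [DecidableEq I] (A : Finset I) : Ltwo I →L[ℂ] Ltwo I :=
  ∑ i ∈ A, ketbra (ket i) (ket i)

/-! ### Time averages -/

/-- `a = lim_{T → ∞} T⁻¹ ∫₀ᵀ f(t) dt`, for vector-valued `f`. -/
def HasTimeAverage {E : Type*} [NormedAddCommGroup E] [NormedSpace ℝ E] (f : ℝ → E) (a : E) :
    Prop :=
  Tendsto (fun T : ℝ => T⁻¹ • ∫ t in (0 : ℝ)..T, f t) atTop (𝓝 a)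

/-- The infinite-time average of a vector-valued function. -/
def timeAverage {E : Type*} [NormedAddCommGroup E] [NormedSpace ℝ E] (f : ℝ → E) : E :=
  limUnder atTop (fun T : ℝ => T⁻¹ • ∫ t in (0 : ℝ)..T, f t)

/-- `m = lim_{T → ∞} T⁻¹ ∫₀ᵀ f(t) dt`, for `f` with values in `[0, ∞]`. -/
def HasTimeMean (f : ℝ → ℝ≥0∞) (m : ℝ≥0∞) : Prop :=
  Tendsto (fun T : ℝ => (∫⁻ t in Set.Ioc 0 T, f t) / ENNReal.ofReal T) atTop (𝓝 m)

/-! ### Fock space and subsystems -/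

/-- The tensor product of `N` single-mode Fock spaces, with its orthonormal occupation number basis
`|n₁, …, n_N⟩ = ket n`. -/
abbrev Fock (N : ℕ) : Type := Ltwo (Fin N → ℕ)

/-- The Fock space of the modes in `S`. -/
abbrev SubFock {N : ℕ} (S : Finset (Fin N)) : Type := Ltwo ({i // i ∈ S} → ℕ)

/-- The occupation numbers of all modes, from those in `S` and those outside `S`. -/
def glue {N : ℕ} (S : Finset (Fin N)) (a : {i // i ∈ S} → ℕ) (b : {i // i ∉ S} → ℕ) : Fin N → ℕ :=
  (Equiv.piEquivPiSubtypeProd (fun i => i ∈ S) (fun _ => ℕ)).symm (a, b)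

theorem glue_injective {N : ℕ} (S : Finset (Fin N)) (b : {i // i ∉ S} → ℕ) :
    Function.Injective (fun a => glue S a b) := by
  intro a a' h
  have h' := (Equiv.piEquivPiSubtypeProd (fun i => i ∈ S) (fun _ => ℕ)).symm.injective h
  exact (Prod.mk.inj h').1

theorem slice_summable {N : ℕ} (S : Finset (Fin N)) (b : {i // i ∉ S} → ℕ) (ψ : Fock N) :
    Summable (fun a => ‖ψ (glue S a b)‖ ^ (2 : ℝ≥0∞).toReal) :=
  ((lp.memℓp ψ).summable (by norm_num)).comp_injective (glue_injective S b)

/-- The partial inner product `ψ ↦ ⟨b|ψ⟩` with a basis vector `|b⟩` of the modes outside `S`, as an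
operator from the full Fock space to the Fock space of `S`. -/
def slice {N : ℕ} (S : Finset (Fin N)) (b : {i // i ∉ S} → ℕ) : Fock N →L[ℂ] SubFock S :=
  LinearMap.mkContinuous
    { toFun := fun ψ => ⟨fun a => ψ (glue S a b), memℓp_gen (slice_summable S b ψ)⟩
      map_add' := fun _ _ => rfl
      map_smul' := fun _ _ => rfl } 1 (by
    intro ψ
    rw [one_mul]
    refine lp.norm_le_of_tsum_le (by norm_num) (norm_nonneg _) ?_
    rw [lp.norm_rpow_eq_tsum (by norm_num) ψ]
    exact tsum_comp_le_tsum_of_inj ((lp.memℓp ψ).summable (by norm_num))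
      (fun _ => by positivity) (glue_injective S b))

/-- The partial trace over the modes outside `S`: `tr_{S̄} T = ∑_b ⟨b| T |b⟩`. -/
def partialTrace {N : ℕ} (S : Finset (Fin N)) (T : Fock N →L[ℂ] Fock N) :
    SubFock S →L[ℂ] SubFock S :=
  ∑' b, slice S b ∘L T ∘L ContinuousLinearMap.adjoint (slice S b)

/-! ### The free theory -/

/-- The one-quantum energies `μ₁, …, μ_N > 0` of the free Hamiltonian `∑ i, μ i * n i`. -/
structure FreeTheory (N : ℕ) where
  μ : Fin N → ℝ
  μ_pos : ∀ i, 0 < μ i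

namespace FreeTheory

variable {N : ℕ}

/-- The free energy of `|n₁, …, n_N⟩`. -/
def energy (F : FreeTheory N) (n : Fin N → ℕ) : ℝ := ∑ i, F.μ i * n i

theorem finite_energy_le (F : FreeTheory N) (x : ℝ) : {n | F.energy n ≤ x}.Finite := by
  refine (Set.finite_Iic (fun i => ⌊x / F.μ i⌋₊)).subset ?_
  intro n hn i
  refine Nat.le_floor ?_
  rw [le_div_iff₀ (F.μ_pos i), mul_comm]
  refine le_trans ?_ hn
  exact Finset.single_le_sum (f := fun j => F.μ j * (n j : ℝ))
    (fun j _ => mul_nonneg (F.μ_pos j).le (Nat.cast_nonneg _)) (Finset.mem_univ i)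

/-- The occupation numbers of free energy exactly `Δ`; they index a basis of `H_Δ`. -/
def shell (F : FreeTheory N) (Δ : ℝ) : Finset (Fin N → ℕ) :=
  ((F.finite_energy_le Δ).subset (fun _ h => le_of_eq h) : {n | F.energy n = Δ}.Finite).toFinset

/-- The occupation numbers of free energy below `Λ`; they index a basis of `⊕_{E < Λ} H_E`. -/
def below (F : FreeTheory N) (Λ : ℝ) : Finset (Fin N → ℕ) :=
  ((F.finite_energy_le Λ).subset (fun _ h => le_of_lt (Set.mem_ofPred_eq ▸ h)) : {n | F.energy n < Λ}.Finite).toFinset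

/-- `d_Δ`, the dimension of `H_Δ`. -/
def dShell (F : FreeTheory N) (Δ : ℝ) : ℕ := (F.shell Δ).card

/-- `d_S^Λ`: the number of distinct occupation numbers of the modes in `S` that occur in basis
vectors of free energy below `Λ`. -/
def dSub (F : FreeTheory N) (S : Finset (Fin N)) (Λ : ℝ) : ℕ :=
  ((F.below Λ).image (fun n (i : {i // i ∈ S}) => n i)).card

/-- The projector `P^Δ` onto `H_Δ`. -/
def shellProj (F : FreeTheory N) (Δ : ℝ) : Fock N →L[ℂ] Fock N := proj (F.shell Δ)

/-- The free-energy cutoff projector `P^Λ` onto `⊕_{E < Λ} H_E`. -/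
def cutoffProj (F : FreeTheory N) (Λ : ℝ) : Fock N →L[ℂ] Fock N := proj (F.below Λ)

/-- `tr_{S̄} (P^Λ T P^Λ)`, the truncated reduced operator on `S`. -/
def truncReduced (F : FreeTheory N) (S : Finset (Fin N)) (Λ : ℝ) (T : Fock N →L[ℂ] Fock N) :
    SubFock S →L[ℂ] SubFock S :=
  partialTrace S (F.cutoffProj Λ ∘L T ∘L F.cutoffProj Λ)

/-- `tr (ω H_free) ∈ [0, ∞]` for a positive operator `ω`, in the eigenbasis of `H_free`. -/
def meanEnergy (F : FreeTheory N) (ω : Fock N →L[ℂ] Fock N) : ℝ≥0∞ :=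
  ∑' n, ENNReal.ofReal (F.energy n * (inner ℂ (ket n) (ω (ket n))).re)

/-- Unit vectors of `H_Δ`, in coordinates with respect to its occupation number basis. -/
abbrev ShellSphere (F : FreeTheory N) (Δ : ℝ) : Type :=
  Metric.sphere (0 : EuclideanSpace ℂ {n // n ∈ F.shell Δ}) 1

/-- The vector of Fock space with the given coordinates. -/
def shellState (F : FreeTheory N) (Δ : ℝ) (c : F.ShellSphere Δ) : Fock N :=
  ∑ n : {n // n ∈ F.shell Δ}, c.1 n • ket n.1

/-- The uniform probability measure on the unit sphere of `H_Δ`. -/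
def uniform (F : FreeTheory N) (Δ : ℝ) : Measure (F.ShellSphere Δ) :=
  ((volume : Measure (EuclideanSpace ℂ {n // n ∈ F.shell Δ})).toSphere Set.univ)⁻¹ •
    (volume : Measure (EuclideanSpace ℂ {n // n ∈ F.shell Δ})).toSphere

end FreeTheory

/-! ### The interacting dynamics -/

/-- The orthonormal basis `b` consists of eigenvectors of the (possibly unbounded) operator `H`,
with eigenvalues `E`. -/
def IsEigenbasis {N : ℕ} {κ : Type*} (H : Fock N →ₗ.[ℂ] Fock N) (b : HilbertBasis κ ℂ (Fock N))
    (E : κ → ℝ) : Prop :=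
  ∀ k, ∃ hk : b k ∈ H.domain, H ⟨b k, hk⟩ = (E k : ℂ) • b k

/-- Non-degenerate gaps: `E k - E l = E m - E n` only in the trivial cases. (The case `m = n` says
that the levels themselves are non-degenerate.) -/
def NondegenerateGaps {κ : Type*} (E : κ → ℝ) : Prop :=
  ∀ k l m n, E k - E l = E m - E n → (k = l ∧ m = n) ∨ (k = m ∧ l = n)

variable {N : ℕ} {κ : Type*}

/-- `e^{-iHt} ψ₀ = ∑_k e^{-i E_k t} ⟨k|ψ₀⟩ |k⟩`. -/
def evolve (b : HilbertBasis κ ℂ (Fock N)) (E : κ → ℝ) (ψ₀ : Fock N) (t : ℝ) : Fock N :=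
  ∑' k, (Complex.exp (-(Complex.I * E k * t)) * inner ℂ (b k) ψ₀) • b k

/-- The density operator `ψ(t)` of the evolved pure state. -/
def state (b : HilbertBasis κ ℂ (Fock N)) (E : κ → ℝ) (ψ₀ : Fock N) (t : ℝ) :
    Fock N →L[ℂ] Fock N :=
  ketbra (evolve b E ψ₀ t) (evolve b E ψ₀ t)

/-- The equilibrium state `ω = ⟨ψ(t)⟩_t`. -/
def equilibrium (b : HilbertBasis κ ℂ (Fock N)) (E : κ → ℝ) (ψ₀ : Fock N) : Fock N →L[ℂ] Fock N :=
  timeAverage (state b E ψ₀)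

/-- The effective dimension `1 / tr (ω²)`. -/
def dEff (ω : Fock N →L[ℂ] Fock N) : ℝ := 1 / (trace (ω ∘L ω)).re

/-- `δ^Λ = ∑_k ⟨k| P^Δ / d_Δ |k⟩ tr [(tr_{S̄} (P^Λ |k⟩⟨k| P^Λ))²]`. -/
def purity (F : FreeTheory N) (b : HilbertBasis κ ℂ (Fock N)) (S : Finset (Fin N)) (Δ Λ : ℝ) : ℝ :=
  ∑' k, (inner ℂ (b k) (F.shellProj Δ (b k))).re / F.dShell Δ *
    (trace (F.truncReduced S Λ (ketbra (b k) (b k)) ∘L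
      F.truncReduced S Λ (ketbra (b k) (b k)))).re

/-- The average of `ω_S^Λ(ψ₀)` over the unit sphere of `H_Δ`. -/
def meanEquilibrium (F : FreeTheory N) (b : HilbertBasis κ ℂ (Fock N)) (E : κ → ℝ)
    (S : Finset (Fin N)) (Δ Λ : ℝ) : SubFock S →L[ℂ] SubFock S :=
  ∫ c, F.truncReduced S Λ (equilibrium b E (F.shellState Δ c)) ∂(F.uniform Δ)

end

end Equilibration

namespace Equilibration

section

/-! In the eigenbasis of the Hamiltonian the evolution only multiplies coefficients by phases.
Averaging over time therefore deletes the off-diagonal part: as the levels are distinct, ω = ∑_k p_k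
|k⟩⟨k| with p_k = |⟨k|ψ₀⟩|² (`dephased`), and 1/d_eff = ∑_k p_k². The orbit is a linear flow on the
torus of all phases, and the state depends continuously on the point of the torus. By
Stone–Weierstrass every continuous real function of the state has a time average
(`exists_hasTimeAverage_torus`), which is how the means in (i) and (ii) are known to exist.

(i) A truncated reduction is a d_S × d_S matrix, so its trace norm is at most √d_S times its
Hilbert–Schmidt norm. Non-degenerate gaps make the frequencies of the off-diagonal terms pairwise
distinct, so the mean squared Hilbert–Schmidt norm is the sum over k ≠ l of p_k p_l
‖tr_S̄(P|k⟩⟨l|P)‖₂². From p_k p_l ≤ (p_k² + p_l²)/2 and Bessel's inequality applied to each matrix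
entry (`sum_norm_sq_reducedMatrix_ketbra_le`), this is at most d_S ∑ p_k².

(ii) Truncating x changes |x⟩⟨x| by at most 2‖x‖‖x - Px‖ in trace norm, also after a partial trace.
The mean of ‖(1 - P)ψ(t)‖² is tr(ω(1 - P)), which Markov's inequality bounds by tr(ω H_free)/Λ.

(iii) and (iv) are concentration statements for 1-Lipschitz functions on a sphere of real dimension
parameter 2 d_Δ. Lévy's lemma (`uniformSphere_deviation_le`) is derived from Gaussian concentration
by homogeneous extension. In (iii) the function is the ℓ⁴ norm of the coefficients, whose inverse
fourth power is d_eff; in (iv) it is half the trace distance to the mean. The expectations are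
controlled by the second and fourth moments of the sphere, which unitary invariance determines.

Two devices recur. The trace norm is handled by duality with contractions on finite sections
(`sum_re_inner_le_traceNorm`, `traceNorm_le_of_forall`). Infinite sums over levels are cut to finite
ones with an error uniform in time or in the initial state. -/

theorem ofReal_integral_le_lintegral {α : Type*} [MeasurableSpace α] {μ : Measure α} {f : α → ℝ}
    (hf : Integrable f μ) :
    ENNReal.ofReal (∫ x, f x ∂μ) ≤ ∫⁻ x, ENNReal.ofReal (f x) ∂μ := by
  rw [integral_eq_lintegral_pos_part_sub_lintegral_neg_part hf]
  exact (ENNReal.ofReal_le_ofReal (sub_le_self _ ENNReal.toReal_nonneg)).trans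
    ENNReal.ofReal_toReal_le

/-! ### Gaussian concentration for Lipschitz functions -/

section GaussianConcentration

open ProbabilityTheory Real

variable {V : Type*} [NormedAddCommGroup V] [InnerProductSpace ℝ V] [FiniteDimensional ℝ V]
  [MeasurableSpace V] [BorelSpace V]

theorem lintegral_exp_dual_stdGaussian (L : StrongDual ℝ V) :
    ∫⁻ y, ENNReal.ofReal (exp (L y)) ∂(stdGaussian V) = ENNReal.ofReal (exp (‖L‖ ^ 2 / 2)) := by
  have h1 := mgf_gaussianReal (IsGaussian.map_eq_gaussianReal (μ := stdGaussian V) L) 1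
  rw [integral_strongDual_stdGaussian, variance_dual_stdGaussian, mgf] at h1
  simp only [one_mul, zero_add, one_pow, mul_one,
    Real.coe_toNNReal _ (sq_nonneg ‖L‖)] at h1
  rw [← h1, ofReal_integral_eq_lintegral_ofReal]
  -- A non-integrable function has integral 0 by convention, while the formula gives a positive
  -- value; integrability is thus automatic.
  · by_contra h
    rw [integral_undef h] at h1
    exact (exp_pos _).ne h1
  · exact Eventually.of_forall fun y => (exp_pos _).le

/-- Jensen's inequality for the uniform probability on (0, π/2]; the factor π/2 inside turns the
average into the plain integral. -/
theorem exp_average_le_lintegral {h : ℝ → ℝ} (hc : Continuous h) :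
    ENNReal.ofReal (exp (∫ θ in (0 : ℝ)..(π / 2), h θ)) ≤
      ENNReal.ofReal (2 / π) *
        ∫⁻ θ in Set.Ioc 0 (π / 2), ENNReal.ofReal (exp (π / 2 * h θ)) := by
  have hπ := pi_pos
  have hJ := convexOn_exp.map_set_average_le (μ := volume) (t := Set.Ioc 0 (π / 2))
    (f := fun θ => π / 2 * h θ) continuous_exp.continuousOn isClosed_univ
    (by simp [hπ]) (by simp) (by simp)
    ((by fun_prop : Continuous fun θ => π / 2 * h θ).integrableOn_Ioc)
    ((by fun_prop : Continuous (exp ∘ fun θ => π / 2 * h θ)).integrableOn_Ioc)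
  have hv : (volume : Measure ℝ).real (Set.Ioc 0 (π / 2)) = π / 2 := by
    rw [Real.volume_real_Ioc_of_le (by positivity), sub_zero]
  rw [setAverage_eq, setAverage_eq, hv, integral_const_mul, smul_eq_mul, smul_eq_mul,
    ← intervalIntegral.integral_of_le (by positivity), ← mul_assoc,
    inv_mul_cancel₀ (by positivity), one_mul] at hJ
  rw [← ofReal_integral_eq_lintegral_ofReal
    ((by fun_prop : Continuous fun θ => exp (π / 2 * h θ)).integrableOn_Ioc)
    (Eventually.of_forall fun y => (exp_pos _).le), ← ENNReal.ofReal_mul (by positivity)]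
  refine ENNReal.ofReal_le_ofReal (hJ.trans (le_of_eq ?_))
  rw [inv_div]

/-- The Maurey–Pisier argument. The difference f y - f x is the integral of the derivative along the
quarter circle cos θ x + sin θ y. Jensen moves the exponential inside, and by rotation invariance
position and velocity are again independent standard Gaussians. For a fixed position the derivative
is linear in the velocity, so the Gaussian moment generating function gives the exponent (π/2)² l²
K² / 2. -/
theorem lintegral_exp_sub_le_of_contDiff {f : V → ℝ} {K : ℝ} (hf : ContDiff ℝ 1 f)
    (hK : ∀ x, ‖fderiv ℝ f x‖ ≤ K) (l : ℝ) :
    ∫⁻ p, ENNReal.ofReal (exp (l * (f p.2 - f p.1))) ∂((stdGaussian V).prod (stdGaussian V)) ≤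
      ENNReal.ofReal (exp (l ^ 2 * π ^ 2 * K ^ 2 / 8)) := by
  have hπ := pi_pos
  set γ := stdGaussian V
  have hfc : Continuous (fderiv ℝ f) := hf.continuous_fderiv one_ne_zero
  let rot : ℝ → V × V →L[ℝ] V × V := fun θ => ContinuousLinearMap.rotation θ
  have hrot : ∀ θ p, rot θ p =
      (cos θ • p.1 + sin θ • p.2, - sin θ • p.1 + cos θ • p.2) := fun θ p => rfl
  let D : V × V → ℝ := fun q => l * fderiv ℝ f q.1 q.2
  have hD : Continuous D := by
    refine continuous_const.mul ?_
    exact (hfc.comp continuous_fst).clm_apply continuous_snd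
  have hjoint : Continuous fun q : (V × V) × ℝ => rot q.2 q.1 := by
    simp only [hrot]; fun_prop
  have key : ∀ p : V × V, ENNReal.ofReal (exp (l * (f p.2 - f p.1))) ≤
      ENNReal.ofReal (2 / π) *
        ∫⁻ θ in Set.Ioc 0 (π / 2), ENNReal.ofReal (exp (π / 2 * D (rot θ p))) := by
    intro p
    have hr : Continuous fun θ => rot θ p := by
      simp only [hrot]; fun_prop
    have hc : Continuous fun θ => D (rot θ p) := hD.comp hr
    have hint : ∫ θ in (0 : ℝ)..(π / 2), D (rot θ p) = l * (f p.2 - f p.1) := by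
      have hd : ∀ θ ∈ Set.uIcc 0 (π / 2),
          HasDerivAt (fun θ => l * f (cos θ • p.1 + sin θ • p.2)) (D (rot θ p)) θ := by
        intro θ _
        have hx : HasDerivAt (fun θ => cos θ • p.1 + sin θ • p.2)
            (- sin θ • p.1 + cos θ • p.2) θ :=
          ((hasDerivAt_cos θ).smul_const p.1).add ((hasDerivAt_sin θ).smul_const p.2)
        exact (((hf.differentiable one_ne_zero _).hasFDerivAt.comp_hasDerivAt θ hx)).const_mul l
      rw [intervalIntegral.integral_eq_sub_of_hasDerivAt hd (hc.intervalIntegrable _ _)]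
      simp [mul_sub]
    rw [← hint]
    exact exp_average_le_lintegral hc
  have hmeas : Measurable fun q : V × V => ENNReal.ofReal (exp (π / 2 * D q)) :=
    ((continuous_exp.comp (hD.const_smul (π / 2))).measurable).ennreal_ofReal
  have hjm : Measurable fun q : (V × V) × ℝ => ENNReal.ofReal (exp (π / 2 * D (rot q.2 q.1))) :=
    hmeas.comp hjoint.measurable
  have hstep : ∀ θ, ∫⁻ p, ENNReal.ofReal (exp (π / 2 * D (rot θ p))) ∂(γ.prod γ) ≤
      ENNReal.ofReal (exp (l ^ 2 * π ^ 2 * K ^ 2 / 8)) := by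
    intro θ
    -- Rotation invariance removes the angle: the same bound holds for every θ.
    have hmap : (γ.prod γ).map (rot θ) = γ.prod γ :=
      IsGaussian.map_rotation_eq_self_of_forall_strongDual_eq_zero
        integral_strongDual_stdGaussian θ
    rw [← lintegral_map (f := fun q => ENNReal.ofReal (exp (π / 2 * D q))) hmeas
      (rot θ).continuous.measurable, hmap, lintegral_prod _ hmeas.aemeasurable]
    calc ∫⁻ x, ∫⁻ y, ENNReal.ofReal (exp (π / 2 * D (x, y))) ∂γ ∂γ
        ≤ ∫⁻ _, ENNReal.ofReal (exp (l ^ 2 * π ^ 2 * K ^ 2 / 8)) ∂γ := by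
          refine lintegral_mono fun x => ?_
          have := lintegral_exp_dual_stdGaussian ((π / 2 * l) • fderiv ℝ f x)
          simp only [FunLike.coe_smul, Pi.smul_apply, smul_eq_mul, mul_assoc] at this
          simp only [D]
          rw [this]
          refine ENNReal.ofReal_le_ofReal (exp_le_exp.2 ?_)
          rw [norm_smul, mul_pow, norm_eq_abs, sq_abs]
          have := pow_le_pow_left₀ (norm_nonneg _) (hK x) 2
          nlinarith [mul_le_mul_of_nonneg_left this (sq_nonneg (π / 2 * l))]
      _ = _ := by simp
  calc _ ≤ ∫⁻ p, (ENNReal.ofReal (2 / π) *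
        ∫⁻ θ in Set.Ioc 0 (π / 2), ENNReal.ofReal (exp (π / 2 * D (rot θ p)))) ∂(γ.prod γ) :=
        lintegral_mono key
    _ = ENNReal.ofReal (2 / π) * ∫⁻ θ in Set.Ioc 0 (π / 2),
        ∫⁻ p, ENNReal.ofReal (exp (π / 2 * D (rot θ p))) ∂(γ.prod γ) := by
        rw [lintegral_const_mul' _ _ ENNReal.ofReal_ne_top,
          lintegral_lintegral_swap hjm.aemeasurable]
    _ ≤ ENNReal.ofReal (2 / π) * ∫⁻ _ in Set.Ioc 0 (π / 2),
        ENNReal.ofReal (exp (l ^ 2 * π ^ 2 * K ^ 2 / 8)) := by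
        gcongr with θ
        exact hstep θ
    _ = ENNReal.ofReal (exp (l ^ 2 * π ^ 2 * K ^ 2 / 8)) := by
        rw [lintegral_const, Measure.restrict_apply_univ, Real.volume_Ioc, sub_zero, mul_comm,
          mul_assoc, ← ENNReal.ofReal_mul (by positivity)]
        rw [div_mul_div_cancel₀ two_ne_zero, div_self hπ.ne', ENNReal.ofReal_one, mul_one]

/-- Convolution with a normalized bump of radius δ averages translates of f, so it keeps the
Lipschitz constant and moves values by at most K δ. -/
theorem exists_contDiff_near_of_lipschitz {f : V → ℝ} {K : NNReal} (hf : LipschitzWith K f)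
    {δ : ℝ} (hδ : 0 < δ) :
    ∃ g : V → ℝ, ContDiff ℝ 1 g ∧ (∀ x, ‖fderiv ℝ g x‖ ≤ K) ∧ ∀ x, |g x - f x| ≤ K * δ := by
  let φ : ContDiffBump (0 : V) := ⟨δ / 2, δ, by positivity, by linarith⟩
  let g : V → ℝ := convolution (φ.normed volume) f (ContinuousLinearMap.lsmul ℝ ℝ) volume
  have hcd : ContDiff ℝ 1 g :=
    φ.hasCompactSupport_normed.contDiff_convolution_left _ φ.contDiff_normed
      hf.continuous.locallyIntegrable
  have hint : ∀ x, Integrable fun t => φ.normed volume t • f (x - t) := fun x =>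
    (φ.continuous_normed.smul (hf.continuous.comp (continuous_const.sub continuous_id))
      ).integrable_of_hasCompactSupport φ.hasCompactSupport_normed.smul_right
  have hlip : LipschitzWith K g := by
    refine LipschitzWith.of_dist_le_mul fun x y => ?_
    have : g x - g y = ∫ t, φ.normed volume t • (f (x - t) - f (y - t)) := by
      simp only [smul_sub]
      rw [integral_sub (hint x) (hint y)]
      rfl
    rw [dist_eq_norm, this]
    calc _ ≤ ∫ t, φ.normed volume t * (K * dist x y) := by
          refine norm_integral_le_of_norm_le ?_ (Eventually.of_forall fun t => ?_)
          · exact φ.integrable_normed.mul_const _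
          · rw [norm_smul, norm_of_nonneg (φ.nonneg_normed t)]
            refine mul_le_mul_of_nonneg_left ?_ (φ.nonneg_normed t)
            have := hf.dist_le_mul (x - t) (y - t)
            rwa [dist_sub_right, dist_eq_norm] at this
      _ = K * dist x y := by rw [integral_mul_const, φ.integral_normed, one_mul]
  refine ⟨g, hcd, fun x => norm_fderiv_le_of_lipschitz ℝ hlip, fun x => ?_⟩
  refine φ.dist_normed_convolution_le hf.continuous.aestronglyMeasurable fun y hy => ?_
  exact (hf.dist_le_mul y x).trans (mul_le_mul_of_nonneg_left (le_of_lt hy) K.2)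

theorem lintegral_exp_sub_le_of_lipschitz {f : V → ℝ} {K : NNReal} (hf : LipschitzWith K f)
    (l : ℝ) :
    ∫⁻ p, ENNReal.ofReal (exp (l * (f p.2 - f p.1))) ∂((stdGaussian V).prod (stdGaussian V)) ≤
      ENNReal.ofReal (exp (l ^ 2 * π ^ 2 * K ^ 2 / 8)) := by
  have h : ∀ δ : ℝ, 0 < δ → ∫⁻ p, ENNReal.ofReal (exp (l * (f p.2 - f p.1)))
      ∂((stdGaussian V).prod (stdGaussian V)) ≤
      ENNReal.ofReal (exp (|l| * (2 * (K * δ))) * exp (l ^ 2 * π ^ 2 * K ^ 2 / 8)) := by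
    intro δ hδ
    obtain ⟨g, hg, hgK, hgf⟩ := exists_contDiff_near_of_lipschitz hf hδ
    rw [ENNReal.ofReal_mul (exp_pos _).le]
    refine le_trans ?_ (mul_le_mul_right (lintegral_exp_sub_le_of_contDiff hg hgK l) _)
    rw [← lintegral_const_mul' _ _ ENNReal.ofReal_ne_top]
    refine lintegral_mono fun p => ?_
    rw [← ENNReal.ofReal_mul (exp_pos _).le, ← exp_add]
    refine ENNReal.ofReal_le_ofReal (exp_le_exp.2 ?_)
    have h1 := hgf p.1
    have h2 := hgf p.2
    have h3 : l * ((f p.2 - f p.1) - (g p.2 - g p.1)) ≤ |l| * (2 * (K * δ)) := by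
      refine (le_abs_self _).trans ?_
      rw [abs_mul]
      refine mul_le_mul_of_nonneg_left ?_ (abs_nonneg l)
      rw [abs_le] at *
      constructor <;> linarith [h1.1, h1.2, h2.1, h2.2]
    linarith
  have hlim : Tendsto (fun δ : ℝ => ENNReal.ofReal
      (exp (|l| * (2 * (K * δ))) * exp (l ^ 2 * π ^ 2 * K ^ 2 / 8))) (𝓝[>] 0)
      (𝓝 (ENNReal.ofReal (exp (l ^ 2 * π ^ 2 * K ^ 2 / 8)))) := by
    have hc : Continuous fun δ : ℝ => ENNReal.ofReal
      (exp (|l| * (2 * (K * δ))) * exp (l ^ 2 * π ^ 2 * K ^ 2 / 8)) :=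
      ENNReal.continuous_ofReal.comp (by fun_prop)
    have := (hc.tendsto 0).mono_left (nhdsWithin_le_nhds (s := Set.Ioi 0))
    simpa using this
  exact ge_of_tendsto hlim (by filter_upwards [self_mem_nhdsWithin] with δ hδ using h δ hδ)

theorem integrable_stdGaussian_of_lipschitz {f : V → ℝ} {K : NNReal} (hf : LipschitzWith K f) :
    Integrable f (stdGaussian V) := by
  have h : Integrable (fun x : V => ‖f 0‖ + K * ‖x‖) (stdGaussian V) :=
    (integrable_const _).add ((IsGaussian.integrable_id (μ := stdGaussian V)).norm.const_mul _)
  refine h.mono' hf.continuous.aestronglyMeasurable (Eventually.of_forall fun x => ?_)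
  have := hf.norm_sub_le x 0
  rw [sub_zero] at this
  linarith [norm_sub_norm_le (f x) (f 0)]

/-- Gaussian concentration for Lipschitz functions. -/
theorem stdGaussian_deviation_le {f : V → ℝ} {K : NNReal} (hf : LipschitzWith K f) (hK : 0 < K)
    {s : ℝ} (hs : 0 < s) :
    stdGaussian V {x | ∫ y, f y ∂(stdGaussian V) + s ≤ f x} ≤
      ENNReal.ofReal (exp (-(2 * s ^ 2 / (π ^ 2 * K ^ 2)))) := by
  set γ := stdGaussian V
  set m := ∫ y, f y ∂γ
  have hπ := pi_pos
  have hK' : (0 : ℝ) < K := hK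
  -- The minimizer of -l s + l² π² K² / 8, with minimum -2 s² / (π² K²).
  set l : ℝ := 4 * s / (π ^ 2 * K ^ 2)
  have hl : 0 < l := by positivity
  have hfi : Integrable f γ := integrable_stdGaussian_of_lipschitz hf
  have hli : Integrable (fun x => l * (f x - m)) γ := (hfi.sub (integrable_const m)).const_mul l
  have hfc := hf.continuous
  have hmeas : Measurable fun p : V × V => ENNReal.ofReal (exp (l * (f p.2 - f p.1))) :=
    (by fun_prop : Continuous fun p : V × V => exp (l * (f p.2 - f p.1))).measurable.ennreal_ofReal
  have h1 : ∫⁻ y, ENNReal.ofReal (exp (l * (f y - m))) ∂γ ≤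
      ENNReal.ofReal (exp (l ^ 2 * π ^ 2 * K ^ 2 / 8)) := by
    refine le_trans ?_ (lintegral_exp_sub_le_of_lipschitz hf l)
    rw [lintegral_prod_symm _ hmeas.aemeasurable]
    refine lintegral_mono fun y => ?_
    -- The tangent-line bound exp u ≥ 1 + u replaces the independent copy f x by its mean m: the
    -- linear term integrates to zero, and integrability of exp (-l f x) is not needed.
    have hi : Integrable (fun x => exp (l * (f y - m)) * (1 - l * (f x - m))) γ :=
      ((integrable_const 1).sub hli).const_mul _
    have he : ∫ x, exp (l * (f y - m)) * (1 - l * (f x - m)) ∂γ = exp (l * (f y - m)) := by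
      have h0 : ∫ x, (f x - m) ∂γ = 0 := by
        rw [integral_sub hfi (integrable_const m)]
        simp [m, γ]
      have h4 : ∫ x, (1 - l * (f x - m)) ∂γ = 1 := by
        rw [integral_sub (integrable_const 1) hli, integral_const_mul, h0]
        simp [γ]
      rw [integral_const_mul, h4, mul_one]
    calc ENNReal.ofReal (exp (l * (f y - m)))
        = ENNReal.ofReal (∫ x, exp (l * (f y - m)) * (1 - l * (f x - m)) ∂γ) := by rw [he]
      _ ≤ ∫⁻ x, ENNReal.ofReal (exp (l * (f y - m)) * (1 - l * (f x - m))) ∂γ :=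
        ofReal_integral_le_lintegral hi
      _ ≤ ∫⁻ x, ENNReal.ofReal (exp (l * (f y - f x))) ∂γ := by
        refine lintegral_mono fun x => ENNReal.ofReal_le_ofReal ?_
        have : l * (f y - f x) = l * (f y - m) + -(l * (f x - m)) := by ring
        rw [this, exp_add]
        refine mul_le_mul_of_nonneg_left ?_ (exp_pos _).le
        linarith [add_one_le_exp (-(l * (f x - m)))]
  have h2 : ENNReal.ofReal (exp (l * s)) * γ {x | m + s ≤ f x} ≤
      ENNReal.ofReal (exp (l ^ 2 * π ^ 2 * K ^ 2 / 8)) := by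
    refine le_trans ?_ h1
    refine le_trans ?_ (mul_meas_ge_le_lintegral₀ (ε := ENNReal.ofReal (exp (l * s)))
      (by fun_prop))
    gcongr with x hx
    intro hx
    refine ENNReal.ofReal_le_ofReal (exp_le_exp.2 (mul_le_mul_of_nonneg_left ?_ hl.le))
    linarith
  have h3 : γ {x | m + s ≤ f x} ≤
      ENNReal.ofReal (exp (-(l * s)) * exp (l ^ 2 * π ^ 2 * K ^ 2 / 8)) := by
    rw [ENNReal.ofReal_mul (exp_pos _).le]
    refine le_trans (le_of_eq ?_) (mul_le_mul_right h2 (ENNReal.ofReal (exp (-(l * s)))))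
    rw [← mul_assoc, ← ENNReal.ofReal_mul (exp_pos _).le, ← exp_add, neg_add_cancel, exp_zero,
      ENNReal.ofReal_one, one_mul]
  refine h3.trans (le_of_eq ?_)
  rw [← exp_add]
  congr 2
  simp only [l]
  field_simp
  ring

end GaussianConcentration

end

section

/-! ### Lévy's lemma on the sphere -/

section Levy

open ProbabilityTheory Real

variable {V : Type*} [NormedAddCommGroup V] [InnerProductSpace ℝ V]

/-- The nearest-point projection onto the ball of radius ‖y‖ is nonexpansive; it fixes y and sends x
to ‖y‖ x / ‖x‖. -/
theorem norm_mul_norm_normalize_sub_le {x y : V} (hx : x ≠ 0) (hy : y ≠ 0) (hyx : ‖y‖ ≤ ‖x‖) :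
    ‖y‖ * ‖‖x‖⁻¹ • x - ‖y‖⁻¹ • y‖ ≤ ‖x - y‖ := by
  have hx' := norm_pos_iff.2 hx
  have hy' := norm_pos_iff.2 hy
  refine abs_le_of_sq_le_sq' ?_ (norm_nonneg _) |>.2
  rw [mul_pow, norm_sub_sq_real, norm_sub_sq_real, norm_smul, norm_smul, norm_inv, norm_inv,
    norm_norm, norm_norm, inv_mul_cancel₀ hx'.ne', inv_mul_cancel₀ hy'.ne', real_inner_smul_left,
    real_inner_smul_right]
  have hi := real_inner_le_norm x y
  set c := inner ℝ x y
  have h : ‖y‖ ^ 2 * (1 ^ 2 - 2 * (‖x‖⁻¹ * (‖y‖⁻¹ * c)) + 1 ^ 2) =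
      2 * ‖y‖ ^ 2 - 2 * ‖y‖ * (c / ‖x‖) := by
    field_simp; ring
  rw [h]
  have hc : c / ‖x‖ ≤ ‖y‖ := by rw [div_le_iff₀ hx']; linarith
  have hc' : c = ‖x‖ * (c / ‖x‖) := by field_simp
  nlinarith [mul_nonneg (sub_nonneg.2 hyx) (sub_nonneg.2 hyx),
    mul_nonneg (sub_nonneg.2 hyx) (sub_nonneg.2 hc)]

variable (V) in
/-- The density of the standard Gaussian measure as a function of the radius. -/
noncomputable def gaussianRadialDensity (r : ℝ) : ℝ :=
  ((2 * π) ^ (Module.finrank ℝ V / 2 : ℝ))⁻¹ * exp (-(1 / 2) * r ^ 2)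

theorem gaussianRadialDensity_pos (r : ℝ) : 0 < gaussianRadialDensity V r := by
  unfold gaussianRadialDensity; positivity

theorem continuous_gaussianRadialDensity : Continuous (gaussianRadialDensity V) := by
  unfold gaussianRadialDensity; fun_prop

open Classical in
/-- The positively homogeneous extension of a function on the unit sphere. -/
noncomputable def homogeneousExtension (g : Metric.sphere (0 : V) 1 → ℝ) (x : V) : ℝ :=
  if h : x = 0 then 0 else ‖x‖ * g (homeomorphUnitSphereProd V ⟨x, h⟩).1

theorem homogeneousExtension_of_ne (g : Metric.sphere (0 : V) 1 → ℝ) {x : V} (h : x ≠ 0) :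
    homogeneousExtension g x = ‖x‖ * g (homeomorphUnitSphereProd V ⟨x, h⟩).1 := dif_neg h

/-- The constant is 3 = 2 + 1: moving radially costs the bound 2 on |g|, moving along a sphere costs
the Lipschitz constant 1 of g. -/
theorem lipschitzWith_homogeneousExtension {g : Metric.sphere (0 : V) 1 → ℝ}
    (hg : LipschitzWith 1 g) (hb : ∀ u, |g u| ≤ 2) :
    LipschitzWith 3 (homogeneousExtension g) := by
  have h0 : homogeneousExtension g 0 = 0 := dif_pos rfl
  have habs : ∀ x, |homogeneousExtension g x| ≤ 2 * ‖x‖ := by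
    intro x
    by_cases hx : x = 0
    · simp [hx, h0]
    · rw [homogeneousExtension_of_ne g hx, abs_mul, abs_norm, mul_comm]
      exact mul_le_mul_of_nonneg_right (hb _) (norm_nonneg _)
  have key : ∀ x y : V, ‖y‖ ≤ ‖x‖ →
      |homogeneousExtension g x - homogeneousExtension g y| ≤ 3 * ‖x - y‖ := by
    intro x y hyx
    by_cases hy : y = 0
    · rw [hy, h0, sub_zero, sub_zero]
      linarith [habs x, norm_nonneg x]
    have hx : x ≠ 0 := norm_pos_iff.1 ((norm_pos_iff.2 hy).trans_le hyx)
    rw [homogeneousExtension_of_ne g hx, homogeneousExtension_of_ne g hy]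
    set u := (homeomorphUnitSphereProd V ⟨x, hx⟩).1 with hu
    set v := (homeomorphUnitSphereProd V ⟨y, hy⟩).1 with hv
    have huv : |g u - g v| ≤ ‖‖x‖⁻¹ • x - ‖y‖⁻¹ • y‖ := by
      have := hg.dist_le_mul u v
      rwa [NNReal.coe_one, one_mul, Subtype.dist_eq, dist_eq_norm, dist_eq_norm, hu, hv,
        homeomorphUnitSphereProd_apply_fst_coe, homeomorphUnitSphereProd_apply_fst_coe,
        norm_eq_abs] at this
    have e : ‖x‖ * g u - ‖y‖ * g v = (‖x‖ - ‖y‖) * g u + ‖y‖ * (g u - g v) := by ring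
    rw [e]
    refine (abs_add_le _ _).trans ?_
    rw [abs_mul, abs_mul, abs_norm]
    have h1 : |‖x‖ - ‖y‖| * |g u| ≤ ‖x - y‖ * 2 :=
      mul_le_mul (abs_norm_sub_norm_le x y) (hb u) (abs_nonneg _) (norm_nonneg _)
    have h2 : ‖y‖ * |g u - g v| ≤ ‖x - y‖ :=
      (mul_le_mul_of_nonneg_left huv (norm_nonneg y)).trans
        (norm_mul_norm_normalize_sub_le hx hy hyx)
    linarith
  refine LipschitzWith.of_dist_le_mul fun x y => ?_
  rw [dist_eq_norm, dist_eq_norm]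
  rcases le_total ‖y‖ ‖x‖ with h | h
  · exact key x y h
  · have := key y x h
    rw [abs_sub_comm, norm_sub_rev] at this
    exact this

variable [FiniteDimensional ℝ V] [MeasurableSpace V] [BorelSpace V]

variable (V) in
theorem integral_gaussianRadialDensity : ∫ x : V, gaussianRadialDensity V ‖x‖ = 1 := by
  unfold gaussianRadialDensity
  rw [integral_const_mul, GaussianFourier.integral_rexp_neg_mul_sq_norm (by norm_num)]
  rw [show π / (1 / 2) = 2 * π by ring]
  exact inv_mul_cancel₀ (by positivity)

variable (V) in
theorem integrable_gaussianRadialDensity : Integrable fun x : V => gaussianRadialDensity V ‖x‖ := by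
  by_contra h
  have := integral_gaussianRadialDensity V
  rw [integral_undef h] at this
  exact zero_ne_one this

theorem integral_stdGaussian_withDensity {F : Type*} [NormedAddCommGroup F] [NormedSpace ℝ F]
    (f : V → F) :
    ∫ x, f x ∂(volume.withDensity fun x : V => ENNReal.ofReal (gaussianRadialDensity V ‖x‖)) =
      ∫ x, gaussianRadialDensity V ‖x‖ • f x := by
  have hw : Measurable fun x : V => ENNReal.ofReal (gaussianRadialDensity V ‖x‖) :=
    (continuous_gaussianRadialDensity.comp continuous_norm).measurable.ennreal_ofReal
  rw [integral_withDensity_eq_integral_toReal_smul hw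
    (Eventually.of_forall fun x => ENNReal.ofReal_lt_top)]
  simp_rw [ENNReal.toReal_ofReal (gaussianRadialDensity_pos _).le]

-- Both measures are finite, and their characteristic functions agree by the Gaussian Fourier
-- integral.
variable (V) in
theorem stdGaussian_eq_withDensity : stdGaussian V =
    volume.withDensity fun x : V => ENNReal.ofReal (gaussianRadialDensity V ‖x‖) := by
  have hfin : IsFiniteMeasure
      (volume.withDensity fun x : V => ENNReal.ofReal (gaussianRadialDensity V ‖x‖)) := by
    refine ⟨?_⟩
    rw [withDensity_apply _ MeasurableSet.univ, Measure.restrict_univ,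
      ← ofReal_integral_eq_lintegral_ofReal (integrable_gaussianRadialDensity V)
        (Eventually.of_forall fun x => (gaussianRadialDensity_pos _).le)]
    exact ENNReal.ofReal_lt_top
  refine Measure.ext_of_charFun ?_
  ext t
  rw [charFun_stdGaussian, charFun_apply, integral_stdGaussian_withDensity]
  have h := GaussianFourier.integral_cexp_neg_mul_sq_norm_add (V := V) (b := 1 / 2) (by norm_num)
    Complex.I t
  have hZ : ((π : ℂ) / (1 / 2)) ^ (Module.finrank ℝ V / 2 : ℂ) =
      (((2 * π) ^ (Module.finrank ℝ V / 2 : ℝ) : ℝ) : ℂ) := by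
    rw [Complex.ofReal_cpow (by positivity)]
    congr 1
    · push_cast; ring
    · push_cast; ring
  have hp : (((2 * π) ^ (Module.finrank ℝ V / 2 : ℝ) : ℝ) : ℂ) ≠ 0 := by
    norm_cast; positivity
  calc _ = ((((2 * π) ^ (Module.finrank ℝ V / 2 : ℝ) : ℝ) : ℂ))⁻¹ *
        ∫ v : V, Complex.exp (-(1 / 2) * ‖v‖ ^ 2 + Complex.I * inner ℝ t v) := by
        rw [h, hZ, ← mul_assoc, inv_mul_cancel₀ hp, one_mul, Complex.I_sq]
        congr 1
        ring
    _ = _ := by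
        rw [← integral_const_mul]
        refine integral_congr_ae (Eventually.of_forall fun x => ?_)
        simp only [gaussianRadialDensity, Complex.real_smul, Complex.exp_add]
        push_cast
        rw [real_inner_comm, mul_comm Complex.I]
        ring

variable (V) in
/-- The radial part of the standard Gaussian measure in polar coordinates (up to normalization). -/
noncomputable def gaussianRadial : Measure (Set.Ioi (0 : ℝ)) :=
  (Measure.volumeIoiPow (Module.finrank ℝ V - 1)).withDensity
    fun r => ENNReal.ofReal (gaussianRadialDensity V r)

/-- In polar coordinates Lebesgue measure is a product and the Gaussian density depends only on the
radius, so direction and radius are independent. -/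
theorem stdGaussian_polar_prod {B : Set (Metric.sphere (0 : V) 1)} (hB : MeasurableSet B)
    {J : Set (Set.Ioi (0 : ℝ))} (hJ : MeasurableSet J) :
    stdGaussian V (Subtype.val '' (homeomorphUnitSphereProd V ⁻¹' (B ×ˢ J))) =
      (volume : Measure V).toSphere B * gaussianRadial V J := by
  have hw : Measurable fun x : V => ENNReal.ofReal (gaussianRadialDensity V ‖x‖) :=
    (continuous_gaussianRadialDensity.comp continuous_norm).measurable.ennreal_ofReal
  have hw' : Measurable fun p : Metric.sphere (0 : V) 1 × Set.Ioi (0 : ℝ) =>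
      ENNReal.ofReal (gaussianRadialDensity V p.2) :=
    (continuous_gaussianRadialDensity.comp
      (continuous_subtype_val.comp continuous_snd)).measurable.ennreal_ofReal
  have h0 : MeasurableSet ({0}ᶜ : Set V) := (measurableSet_singleton _).compl
  have hm : MeasurableSet (homeomorphUnitSphereProd V ⁻¹' (B ×ˢ J)) :=
    (homeomorphUnitSphereProd V).measurable (hB.prod hJ)
  rw [stdGaussian_eq_withDensity, withDensity_apply _ ((MeasurableEmbedding.subtype_coe h0
    ).measurableSet_image.2 hm)]
  have h1 := setLIntegral_subtype (μ := (volume : Measure V)) h0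
    (homeomorphUnitSphereProd V ⁻¹' (B ×ˢ J))
    (fun x : V => ENNReal.ofReal (gaussianRadialDensity V ‖x‖))
  rw [← h1]
  have h2 := (Measure.measurePreserving_homeomorphUnitSphereProd
    (volume : Measure V)).setLIntegral_comp_preimage_emb
    (homeomorphUnitSphereProd V).measurableEmbedding
    (fun p => ENNReal.ofReal (gaussianRadialDensity V p.2)) (B ×ˢ J)
  simp only [homeomorphUnitSphereProd_apply_snd_coe] at h2
  rw [h2, ← Measure.prod_restrict, lintegral_prod _ hw'.aemeasurable]
  simp only [lintegral_const, Measure.restrict_apply_univ]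
  rw [gaussianRadial, withDensity_apply _ hJ, mul_comm]

/-- The same factorization for integrals. It makes the homogeneous extension of a mean-zero function
have Gaussian mean zero. -/
theorem integral_stdGaussian_polar_mul (F : Metric.sphere (0 : V) 1 → ℝ) (h : ℝ → ℝ)
    (f : V → ℝ) (hf0 : f 0 = 0)
    (hf : ∀ x : ({0}ᶜ : Set V), f x =
      F (homeomorphUnitSphereProd V x).1 * h (homeomorphUnitSphereProd V x).2) :
    ∫ x, f x ∂(stdGaussian V) = (∫ u, F u ∂((volume : Measure V).toSphere)) *
      ∫ r : Set.Ioi (0 : ℝ), h r * gaussianRadialDensity V r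
        ∂(Measure.volumeIoiPow (Module.finrank ℝ V - 1)) := by
  have h0 : MeasurableSet ({0}ᶜ : Set V) := (measurableSet_singleton _).compl
  rw [stdGaussian_eq_withDensity, integral_stdGaussian_withDensity]
  have h1 : ∫ x, gaussianRadialDensity V ‖x‖ • f x =
      ∫ x in ({0}ᶜ : Set V), gaussianRadialDensity V ‖x‖ • f x := by
    refine (setIntegral_eq_integral_of_forall_compl_eq_zero fun x hx => ?_).symm
    have : x = 0 := by simpa using hx
    simp [this, hf0]
  rw [h1, ← integral_subtype_comap h0 fun x : V => gaussianRadialDensity V ‖x‖ • f x]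
  have h2 := (Measure.measurePreserving_homeomorphUnitSphereProd
    (volume : Measure V)).integral_comp
    (homeomorphUnitSphereProd V).measurableEmbedding
    (fun p => F p.1 * (h p.2 * gaussianRadialDensity V p.2))
  rw [← integral_prod_mul, ← h2]
  refine integral_congr_ae (Eventually.of_forall fun x => ?_)
  simp only [hf, smul_eq_mul, homeomorphUnitSphereProd_apply_snd_coe]
  ring

variable (V) in
/-- The uniform probability measure on the unit sphere. -/
noncomputable def uniformSphere : Measure (Metric.sphere (0 : V) 1) :=
  ((volume : Measure V).toSphere Set.univ)⁻¹ • (volume : Measure V).toSphere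

instance [Nontrivial V] : IsProbabilityMeasure (uniformSphere V) := by
  refine ⟨?_⟩
  rw [uniformSphere, Measure.smul_apply, smul_eq_mul]
  refine ENNReal.inv_mul_cancel ?_ (measure_ne_top _ _)
  rw [ne_eq, Measure.measure_univ_eq_zero]
  exact Measure.toSphere_ne_zero _

/-- Markov's inequality for exp (-‖x‖²), whose Gaussian mean is 3^(-n/2). The result (e^(1/π) /
3)^(n/2) is at most 1/2 because e^(1/π) ≤ 3/2 and n ≥ 2. -/
theorem stdGaussian_norm_lt_le (hn : 2 ≤ Module.finrank ℝ V) :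
    stdGaussian V {x | ‖x‖ < √(Module.finrank ℝ V / (2 * π))} ≤ ENNReal.ofReal (1 / 2) := by
  set n : ℝ := (Module.finrank ℝ V : ℝ)
  have hn' : (2 : ℝ) ≤ n := by simp only [n]; exact_mod_cast hn
  have hπ := pi_pos
  have hint : ∫⁻ x, ENNReal.ofReal (exp (-‖x‖ ^ 2)) ∂(stdGaussian V) =
      ENNReal.ofReal ((3 ^ (n / 2))⁻¹) := by
    have hle : ∀ x : V, ‖exp (-‖x‖ ^ 2)‖ ≤ 1 := fun x => by
      rw [norm_of_nonneg (exp_pos _).le]; exact exp_le_one_iff.2 (by simp)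
    have hi : Integrable (fun x : V => exp (-‖x‖ ^ 2)) (stdGaussian V) :=
      (integrable_const (1 : ℝ)).mono' (by fun_prop) (Eventually.of_forall hle)
    rw [← ofReal_integral_eq_lintegral_ofReal hi (Eventually.of_forall fun _ => (exp_pos _).le),
      stdGaussian_eq_withDensity, integral_stdGaussian_withDensity]
    congr 1
    have : ∀ x : V, gaussianRadialDensity V ‖x‖ • exp (-‖x‖ ^ 2) =
        ((2 * π) ^ (n / 2))⁻¹ * exp (-(3 / 2) * ‖x‖ ^ 2) := fun x => by
      rw [gaussianRadialDensity, smul_eq_mul, mul_assoc, ← exp_add]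
      congr 2; ring
    simp_rw [this]
    rw [integral_const_mul, GaussianFourier.integral_rexp_neg_mul_sq_norm (by norm_num),
      show π / (3 / 2) = (2 * π) / 3 by ring, div_rpow (by positivity) (by norm_num)]
    have : (2 * π) ^ (n / 2) ≠ 0 := by positivity
    change _ * ((2 * π) ^ (n / 2) / _) = _
    field_simp
    rfl
  have h1 : ENNReal.ofReal (exp (-(n / (2 * π)))) * stdGaussian V {x | ‖x‖ < √(n / (2 * π))} ≤
      ENNReal.ofReal ((3 ^ (n / 2))⁻¹) := by
    rw [← hint]
    refine le_trans ?_ (mul_meas_ge_le_lintegral₀ (ε := ENNReal.ofReal (exp (-(n / (2 * π)))))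
      (by fun_prop))
    gcongr with x
    intro hx
    refine ENNReal.ofReal_le_ofReal (exp_le_exp.2 ?_)
    have := (lt_sqrt (norm_nonneg x)).1 hx
    linarith
  have h2 : stdGaussian V {x | ‖x‖ < √(n / (2 * π))} ≤
      ENNReal.ofReal (exp (n / (2 * π)) * (3 ^ (n / 2))⁻¹) := by
    rw [ENNReal.ofReal_mul (exp_pos _).le]
    refine le_trans (le_of_eq ?_) (mul_le_mul_right h1 (ENNReal.ofReal (exp (n / (2 * π)))))
    rw [← mul_assoc, ← ENNReal.ofReal_mul (exp_pos _).le, ← exp_add, add_neg_cancel, exp_zero,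
      ENNReal.ofReal_one, one_mul]
  refine h2.trans (ENNReal.ofReal_le_ofReal ?_)
  have h3 : exp (1 / π) ≤ 3 / 2 := by
    have : exp (1 / π) ≤ exp (1 / 3) := exp_le_exp.2
      (one_div_le_one_div_of_le (by norm_num) pi_gt_three.le)
    refine this.trans ?_
    have he : exp (1 / 3) ^ 3 = exp 1 := by rw [← exp_nat_mul]; norm_num
    by_contra hlt
    push Not at hlt
    have := pow_lt_pow_left₀ hlt (by norm_num) (n := 3) (by norm_num)
    rw [he] at this
    linarith [exp_one_lt_d9]
  calc exp (n / (2 * π)) * (3 ^ (n / 2))⁻¹ = (exp (1 / π) / 3) ^ (n / 2) := by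
        rw [div_rpow (exp_pos _).le (by norm_num), ← exp_mul]
        rw [div_eq_mul_inv]
        congr 2
        field_simp
    _ ≤ (1 / 2) ^ (n / 2) := by
        refine rpow_le_rpow (by positivity) (by linarith) (by linarith)
    _ ≤ (1 / 2) ^ (1 : ℝ) := by
        refine rpow_le_rpow_of_exponent_ge (by norm_num) (by norm_num) (by linarith)
    _ = 1 / 2 := rpow_one _

/-- Lévy's lemma: concentration of measure on the sphere. -/
theorem uniformSphere_deviation_le (hn : 2 ≤ Module.finrank ℝ V)
    {g : Metric.sphere (0 : V) 1 → ℝ} (hg : LipschitzWith 1 g) {ε : ℝ} (hε : 0 < ε) :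
    (uniformSphere V).real {u | ∫ v, g v ∂(uniformSphere V) + ε ≤ g u} ≤
      2 * exp (-(ε ^ 2 * Module.finrank ℝ V / (9 * π ^ 3))) := by
  have hπ := pi_pos
  have : Nontrivial V := Module.nontrivial_of_finrank_pos (R := ℝ) (by omega)
  set n : ℝ := (Module.finrank ℝ V : ℝ)
  have hn' : (2 : ℝ) ≤ n := by simp only [n]; exact_mod_cast hn
  set σ := uniformSphere V with hσ
  set τ := (volume : Measure V).toSphere with hτ
  set m := ∫ v, g v ∂σ
  have hτ0 : τ Set.univ ≠ 0 := by
    rw [ne_eq, Measure.measure_univ_eq_zero]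
    exact Measure.toSphere_ne_zero _
  have hgi : Integrable g σ := hg.continuous.integrable_of_hasCompactSupport
    (HasCompactSupport.of_compactSpace g)
  have hbound : ∀ u, |g u - m| ≤ 2 := by
    intro u
    have h1 : g u - m = ∫ v, (g u - g v) ∂σ := by
      rw [integral_sub (integrable_const _) hgi]
      simp [m, σ]
    rw [h1, ← norm_eq_abs]
    refine (norm_integral_le_of_norm_le_const (Eventually.of_forall fun v => ?_)).trans
      (le_of_eq (by simp [σ] : (2 : ℝ) * σ.real Set.univ = 2))
    have h2 := hg.dist_le_mul u v
    rw [NNReal.coe_one, one_mul, dist_eq_norm, Subtype.dist_eq, dist_eq_norm] at h2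
    refine h2.trans ((norm_sub_le _ _).trans ?_)
    rw [norm_eq_of_mem_sphere u, norm_eq_of_mem_sphere v]
    norm_num
  set g' : Metric.sphere (0 : V) 1 → ℝ := fun u => g u - m
  have hg' : LipschitzWith 1 g' := by
    refine LipschitzWith.of_dist_le_mul fun u v => ?_
    simpa [g', dist_eq_norm] using hg.dist_le_mul u v
  -- On the part of the cone over the bad set B beyond radius ρ, f is at least ε ρ. Gaussian
  -- concentration bounds the mass of that set, which is a product of an angular and a radial
  -- factor.
  set f := homogeneousExtension g'
  have hf : LipschitzWith 3 f := lipschitzWith_homogeneousExtension hg' hbound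
  have hf0 : ∫ x, f x ∂(stdGaussian V) = 0 := by
    rw [integral_stdGaussian_polar_mul g' id f (dif_pos rfl)]
    · have h1 : ∫ u, g' u ∂σ = 0 := by
        rw [integral_sub hgi (integrable_const _)]
        simp [m, σ]
      rw [hσ, uniformSphere, integral_smul_measure, smul_eq_mul, mul_eq_zero] at h1
      rcases h1 with h1 | h1
      · exfalso
        rw [ENNReal.toReal_inv, inv_eq_zero, ENNReal.toReal_eq_zero_iff] at h1
        exact h1.elim hτ0 (measure_ne_top _ _)
      · rw [h1, zero_mul]
    · intro x
      rw [mul_comm, id, homeomorphUnitSphereProd_apply_snd_coe]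
      exact homogeneousExtension_of_ne g' x.2
  set ρ := √(n / (2 * π))
  have hρ : 0 < ρ := by positivity
  set B : Set (Metric.sphere (0 : V) 1) := {u | m + ε ≤ g u}
  have hB : MeasurableSet B := (isClosed_le continuous_const hg.continuous).measurableSet
  set J : Set (Set.Ioi (0 : ℝ)) := {r | ρ ≤ r}
  have hJ : MeasurableSet J := (isClosed_le continuous_const continuous_subtype_val).measurableSet
  have hBJ := stdGaussian_polar_prod hB hJ
  have huJ := stdGaussian_polar_prod (V := V) MeasurableSet.univ hJ
  have hdev := stdGaussian_deviation_le hf (by norm_num) (mul_pos hε hρ)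
  rw [hf0, zero_add] at hdev
  have hexp : 2 * (ε * ρ) ^ 2 / (π ^ 2 * ((3 : NNReal) : ℝ) ^ 2) = ε ^ 2 * n / (9 * π ^ 3) := by
    rw [mul_pow, sq_sqrt (by positivity)]
    push_cast
    field_simp
    norm_num
  rw [hexp] at hdev
  have h1 : τ B * gaussianRadial V J ≤ ENNReal.ofReal (exp (-(ε ^ 2 * n / (9 * π ^ 3)))) := by
    rw [← hBJ]
    refine (measure_mono ?_).trans hdev
    rintro _ ⟨x, ⟨hxB, hxJ⟩, rfl⟩
    change ε * ρ ≤ homogeneousExtension g' x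
    rw [homogeneousExtension_of_ne g' x.2]
    have h2 : m + ε ≤ g (homeomorphUnitSphereProd V x).1 := hxB
    have h3 : ρ ≤ ‖(x : V)‖ := by
      have : ρ ≤ ((homeomorphUnitSphereProd V x).2 : ℝ) := hxJ
      rwa [homeomorphUnitSphereProd_apply_snd_coe] at this
    rw [mul_comm]
    refine mul_le_mul h3 ?_ hε.le (norm_nonneg _)
    change ε ≤ g (homeomorphUnitSphereProd V x).1 - m
    linarith
  -- The radius exceeds ρ with probability at least 1/2; dividing by this produces the factor 2 in
  -- the conclusion.
  have h2 : ENNReal.ofReal (1 / 2) ≤ τ Set.univ * gaussianRadial V J := by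
    rw [← huJ]
    have h3 : {x : V | ‖x‖ < ρ}ᶜ ⊆
        Subtype.val '' (homeomorphUnitSphereProd V ⁻¹' (Set.univ ×ˢ J)) := by
      intro x hx
      have hx' : ρ ≤ ‖x‖ := not_lt.1 hx
      refine ⟨⟨x, norm_pos_iff.1 (hρ.trans_le hx')⟩, ⟨trivial, ?_⟩, rfl⟩
      change ρ ≤ ((homeomorphUnitSphereProd V _).2 : ℝ)
      rwa [homeomorphUnitSphereProd_apply_snd_coe]
    refine le_trans ?_ (measure_mono h3)
    rw [prob_compl_eq_one_sub (isOpen_lt continuous_norm continuous_const).measurableSet]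
    refine le_trans ?_ (tsub_le_tsub_left (stdGaussian_norm_lt_le hn) 1)
    rw [← ENNReal.ofReal_one, ← ENNReal.ofReal_sub _ (by norm_num)]
    norm_num
  have h3 : τ B ≤ ENNReal.ofReal (2 * exp (-(ε ^ 2 * n / (9 * π ^ 3)))) * τ Set.univ := by
    calc τ B = ENNReal.ofReal 2 * (τ B * ENNReal.ofReal (1 / 2)) := by
          rw [mul_left_comm, ← ENNReal.ofReal_mul (by norm_num)]; norm_num
      _ ≤ ENNReal.ofReal 2 * (τ B * (τ Set.univ * gaussianRadial V J)) := by gcongr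
      _ = ENNReal.ofReal 2 * (τ B * gaussianRadial V J) * τ Set.univ := by ring
      _ ≤ ENNReal.ofReal 2 * ENNReal.ofReal (exp (-(ε ^ 2 * n / (9 * π ^ 3)))) * τ Set.univ := by
          gcongr
      _ = _ := by rw [← ENNReal.ofReal_mul (by norm_num)]
  refine ENNReal.toReal_le_of_le_ofReal (by positivity) ?_
  rw [hσ, uniformSphere, Measure.smul_apply, smul_eq_mul]
  calc (τ Set.univ)⁻¹ * τ B ≤ (τ Set.univ)⁻¹ *
        (ENNReal.ofReal (2 * exp (-(ε ^ 2 * n / (9 * π ^ 3)))) * τ Set.univ) := by gcongr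
    _ = _ := by
      rw [mul_comm, mul_assoc, ENNReal.mul_inv_cancel hτ0 (measure_ne_top _ _), mul_one]

end Levy

end

/-! ### Invariance of the uniform measure under isometries -/

section SphereInvariance

variable {V : Type*} [NormedAddCommGroup V] [InnerProductSpace ℝ V]

/-- The action of a linear isometry on the unit sphere. -/
def sphereMap (e : V ≃ₗᵢ[ℝ] V) (u : Metric.sphere (0 : V) 1) : Metric.sphere (0 : V) 1 :=
  ⟨e u, by simp⟩

theorem continuous_sphereMap (e : V ≃ₗᵢ[ℝ] V) : Continuous (sphereMap e) :=
  (e.continuous.comp continuous_subtype_val).subtype_mk _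

variable [FiniteDimensional ℝ V] [MeasurableSpace V] [BorelSpace V]

/-- Surface measure of a set is defined by the volume of the cone over it, and a linear isometry
carries cones to cones preserving volume. -/
theorem map_sphereMap_uniformSphere (e : V ≃ₗᵢ[ℝ] V) :
    (uniformSphere V).map (sphereMap e) = uniformSphere V := by
  have hm := (continuous_sphereMap e).measurable
  rw [uniformSphere, Measure.map_smul]
  congr 1
  ext s hs
  rw [Measure.map_apply hm hs, Measure.toSphere_apply' _ (hm hs), Measure.toSphere_apply' _ hs]
  conv_rhs => rw [← e.measurePreserving.measure_preimage_emb e.toHomeomorph.measurableEmbedding]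
  congr 2
  ext x
  simp only [Set.mem_smul, Set.mem_image, Set.mem_preimage]
  constructor
  · rintro ⟨r, hr, _, ⟨u, hu, rfl⟩, rfl⟩
    exact ⟨r, hr, _, ⟨sphereMap e u, hu, rfl⟩, by simp [sphereMap]⟩
  · rintro ⟨r, hr, _, ⟨u, hu, rfl⟩, hx⟩
    refine ⟨r, hr, _, ⟨sphereMap e.symm u, ?_, rfl⟩, ?_⟩
    · convert hu
      ext
      simp [sphereMap]
    · apply e.injective
      rw [← hx]
      simp [sphereMap]

theorem integral_sphereMap {F : Type*} [NormedAddCommGroup F] [NormedSpace ℝ F]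
    (e : V ≃ₗᵢ[ℝ] V) {f : Metric.sphere (0 : V) 1 → F} (hf : Continuous f) :
    ∫ u, f (sphereMap e u) ∂(uniformSphere V) = ∫ u, f u ∂(uniformSphere V) := by
  conv_rhs => rw [← map_sphereMap_uniformSphere e]
  rw [integral_map (continuous_sphereMap e).measurable.aemeasurable]
  rw [map_sphereMap_uniformSphere e]
  exact hf.aestronglyMeasurable

theorem integrable_uniformSphere [Nontrivial V] {F : Type*} [NormedAddCommGroup F]
    {f : Metric.sphere (0 : V) 1 → F} (hf : Continuous f) : Integrable f (uniformSphere V) :=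
  hf.integrable_of_hasCompactSupport (HasCompactSupport.of_compactSpace f)

end SphereInvariance

/-! ### Second and fourth moments of the complex sphere -/

section SphereMoments

variable {ι : Type*} [Fintype ι]

local notation "W" => EuclideanSpace ℂ ι

/-- Complete v to an orthonormal basis; passing to coordinates in it is an isometry that turns ⟨v,
c⟩ into a coordinate. -/
theorem integral_sphere_coord (v : W) (hv : ‖v‖ = 1) (i : ι) (f : ℝ → ℝ) (hf : Continuous f) :
    ∫ c, f ‖inner ℂ v (c : W)‖ ∂(uniformSphere W) = ∫ c, f ‖(c : W) i‖ ∂(uniformSphere W) := by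
  have hon : Orthonormal ℂ (({i} : Set ι).domRestrict fun _ => v) := by
    refine ⟨fun _ => hv, fun a b hab => (hab (Subsingleton.elim a b)).elim⟩
  obtain ⟨b, hb⟩ := hon.exists_orthonormalBasis_extension_of_card_eq (by simp)
  have hbi : b i = v := hb i rfl
  let e : W ≃ₗᵢ[ℝ] W :=
    { b.repr.toLinearEquiv.restrictScalars ℝ with norm_map' := b.repr.norm_map }
  rw [← integral_sphereMap e (f := fun c => f ‖(c : W) i‖) (by fun_prop)]
  refine integral_congr_ae (Eventually.of_forall fun c => ?_)
  have : (sphereMap e c : W) i = inner ℂ v (c : W) := by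
    rw [← hbi, ← b.repr_apply_apply]
    rfl
  simp only [this]

theorem sum_norm_coord_sq (c : Metric.sphere (0 : W) 1) : ∑ i, ‖(c : W) i‖ ^ 2 = 1 := by
  rw [← EuclideanSpace.norm_sq_eq, norm_eq_of_mem_sphere, one_pow]

open Classical in
theorem inner_single_eq (i : ι) (c : W) :
    inner ℂ (EuclideanSpace.single i (1 : ℂ)) c = c i := by
  simp [EuclideanSpace.inner_single_left]

/-- This identity and the next one express mixed fourth-order quantities by pure fourth powers, so
that mixed moments follow from moments in a single direction. -/
theorem norm_four_polarization (a b : ℂ) :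
    ‖a + b‖ ^ 4 + ‖a - b‖ ^ 4 + ‖a + Complex.I * b‖ ^ 4 + ‖a - Complex.I * b‖ ^ 4 =
      4 * (‖a‖ ^ 4 + ‖b‖ ^ 4 + 4 * (‖a‖ ^ 2 * ‖b‖ ^ 2)) := by
  have h : ∀ z : ℂ, ‖z‖ ^ 4 = (z.re * z.re + z.im * z.im) ^ 2 := fun z => by
    rw [← Complex.normSq_apply, Complex.normSq_eq_norm_sq]; ring
  have h2 : ∀ z : ℂ, ‖z‖ ^ 2 = z.re * z.re + z.im * z.im := fun z => by
    rw [← Complex.normSq_apply, Complex.normSq_eq_norm_sq]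
  simp only [h, h2]
  simp
  ring

theorem norm_add_four_polarization (v w : W) :
    ‖v + w‖ ^ 4 + ‖v - w‖ ^ 4 + ‖v + (-Complex.I) • w‖ ^ 4 + ‖v - (-Complex.I) • w‖ ^ 4 =
      4 * (‖v‖ ^ 4 + ‖w‖ ^ 4 + 2 * (‖v‖ ^ 2 * ‖w‖ ^ 2) + 2 * ‖inner ℂ v w‖ ^ 2) := by
  have h4 : ∀ x : W, ‖x‖ ^ 4 = (‖x‖ ^ 2) ^ 2 := fun x => by ring
  have h2 : ‖inner ℂ v w‖ ^ 2 = (inner ℂ v w : ℂ).re * (inner ℂ v w : ℂ).re +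
      (inner ℂ v w : ℂ).im * (inner ℂ v w : ℂ).im := by
    rw [← Complex.normSq_apply, Complex.normSq_eq_norm_sq]
  rw [h4 (v + w), h4 (v - w), h4 (v + _), h4 (v - _), norm_add_sq (𝕜 := ℂ), norm_sub_sq (𝕜 := ℂ),
    norm_add_sq (𝕜 := ℂ), norm_sub_sq (𝕜 := ℂ), h2, inner_smul_right, norm_smul]
  simp
  ring

variable [Nonempty ι]

theorem exists_integral_sphere_inner_pow (n : ℕ) :
    ∃ A : ℝ, ∀ v : W, ∫ c, ‖inner ℂ v (c : W)‖ ^ (2 * (n + 1)) ∂(uniformSphere W) =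
      A * ‖v‖ ^ (2 * (n + 1)) := by
  obtain ⟨i⟩ := ‹Nonempty ι›
  have : Nonempty ι := ⟨i⟩
  refine ⟨∫ c, ‖(c : W) i‖ ^ (2 * (n + 1)) ∂(uniformSphere W), fun v => ?_⟩
  by_cases hv : v = 0
  · simp [hv]
  have hv' := norm_pos_iff.2 hv
  have h := integral_sphere_coord ((‖v‖⁻¹ : ℂ) • v)
    (by rw [norm_smul]; simp [hv'.ne']) i (fun x => x ^ (2 * (n + 1))) (by fun_prop)
  rw [← h, ← integral_mul_const]
  refine integral_congr_ae (Eventually.of_forall fun c => ?_)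
  simp only [inner_smul_left, norm_mul, mul_pow]
  simp only [map_inv₀, Complex.conj_ofReal, norm_inv, Complex.norm_real, norm_norm, inv_pow]
  field_simp

/-- By invariance and homogeneity the integral is A ‖v‖²; summing over an orthonormal basis gives A
d = 1. -/
theorem integral_sphere_inner_sq (v : W) :
    ∫ c, ‖inner ℂ v (c : W)‖ ^ 2 ∂(uniformSphere W) = ‖v‖ ^ 2 / Fintype.card ι := by
  classical
  obtain ⟨A, hA⟩ := exists_integral_sphere_inner_pow (ι := ι) 0
  simp only [zero_add, mul_one] at hA
  have h1 : ∑ i : ι, ∫ c, ‖inner ℂ (EuclideanSpace.single i (1 : ℂ)) (c : W)‖ ^ 2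
      ∂(uniformSphere W) = 1 := by
    rw [← integral_finsetSum _ fun i _ => integrable_uniformSphere (by fun_prop)]
    simp only [inner_single_eq, sum_norm_coord_sq]
    simp
  simp only [hA] at h1
  simp only [PiLp.norm_single, norm_one, one_pow, mul_one, Finset.sum_const,
    Finset.card_univ, nsmul_eq_mul] at h1
  have : (Fintype.card ι : ℝ) ≠ 0 := left_ne_zero_of_mul_eq_one h1
  rw [hA, eq_div_iff this]
  linear_combination ‖v‖ ^ 2 * h1

/-- Polarization of the pure moments A ‖v‖⁴ gives the shape with prefactor A/2. Summing over pairs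
of basis vectors and using (∑ |c_i|²)² = 1 yields (A/2)(d² + d) = 1. -/
theorem integral_sphere_inner_sq_mul_inner_sq (v w : W) :
    ∫ c, ‖inner ℂ v (c : W)‖ ^ 2 * ‖inner ℂ w (c : W)‖ ^ 2 ∂(uniformSphere W) =
      (‖v‖ ^ 2 * ‖w‖ ^ 2 + ‖inner ℂ v w‖ ^ 2) /
        (Fintype.card ι * (Fintype.card ι + 1)) := by
  classical
  obtain ⟨A, hA⟩ := exists_integral_sphere_inner_pow (ι := ι) 1
  norm_num at hA
  have hQ : ∀ v w : W,
      ∫ c, ‖inner ℂ v (c : W)‖ ^ 2 * ‖inner ℂ w (c : W)‖ ^ 2 ∂(uniformSphere W) =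
      A / 2 * (‖v‖ ^ 2 * ‖w‖ ^ 2 + ‖inner ℂ v w‖ ^ 2) := by
    intro v w
    have h1 : ∀ c : W, ‖inner ℂ (v + w) c‖ ^ 4 + ‖inner ℂ (v - w) c‖ ^ 4 +
        ‖inner ℂ (v + (-Complex.I) • w) c‖ ^ 4 + ‖inner ℂ (v - (-Complex.I) • w) c‖ ^ 4 =
        4 * (‖inner ℂ v c‖ ^ 4 + ‖inner ℂ w c‖ ^ 4 +
          4 * (‖inner ℂ v c‖ ^ 2 * ‖inner ℂ w c‖ ^ 2)) := by
      intro c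
      rw [← norm_four_polarization]
      simp only [inner_add_left, inner_sub_left, inner_smul_left]
      simp
    have h2 : ∫ c, (‖inner ℂ (v + w) (c : W)‖ ^ 4 + ‖inner ℂ (v - w) (c : W)‖ ^ 4 +
        ‖inner ℂ (v + (-Complex.I) • w) (c : W)‖ ^ 4 +
        ‖inner ℂ (v - (-Complex.I) • w) (c : W)‖ ^ 4) ∂(uniformSphere W) =
        ∫ c, (4 * (‖inner ℂ v (c : W)‖ ^ 4 + ‖inner ℂ w (c : W)‖ ^ 4 +
          4 * (‖inner ℂ v (c : W)‖ ^ 2 * ‖inner ℂ w (c : W)‖ ^ 2))) ∂(uniformSphere W) :=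
      integral_congr_ae (Eventually.of_forall fun c => h1 c)
    rw [integral_add, integral_add, integral_add, integral_const_mul, integral_add, integral_add,
      integral_const_mul] at h2
    rotate_left
    all_goals try exact integrable_uniformSphere (by fun_prop)
    simp only [hA] at h2
    have h3 := norm_add_four_polarization v w
    linear_combination (1 / 16) * A * h3 - (1 / 16) * h2
  have h1 : ∑ i : ι, ∑ j : ι, ∫ c, ‖inner ℂ (EuclideanSpace.single i (1 : ℂ)) (c : W)‖ ^ 2 *
      ‖inner ℂ (EuclideanSpace.single j (1 : ℂ)) (c : W)‖ ^ 2 ∂(uniformSphere W) = 1 := by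
    have hij : ∀ i j : ι, Integrable (fun c : Metric.sphere (0 : W) 1 =>
        ‖(c : W) i‖ ^ 2 * ‖(c : W) j‖ ^ 2) (uniformSphere W) :=
      fun i j => integrable_uniformSphere (by fun_prop)
    simp only [inner_single_eq]
    have hi : ∀ i : ι, ∑ j, ∫ c : Metric.sphere (0 : W) 1, ‖(c : W) i‖ ^ 2 * ‖(c : W) j‖ ^ 2
        ∂(uniformSphere W) = ∫ c : Metric.sphere (0 : W) 1, ‖(c : W) i‖ ^ 2 ∂(uniformSphere W) := by
      intro i
      rw [← integral_finsetSum _ fun j _ => hij i j]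
      simp only [← Finset.mul_sum, sum_norm_coord_sq, mul_one]
    rw [Finset.sum_congr rfl fun i _ => hi i,
      ← integral_finsetSum _ fun i _ => integrable_uniformSphere (by fun_prop)]
    simp only [sum_norm_coord_sq]
    simp
  simp only [hQ] at h1
  simp only [EuclideanSpace.inner_single_left, PiLp.norm_single] at h1
  have h2 : ∀ i j : ι, ‖(starRingEnd ℂ) 1 * (EuclideanSpace.single j (1 : ℂ) : W) i‖ ^ 2 =
      if i = j then 1 else 0 := by
    intro i j
    by_cases h : i = j <;> simp [h]
  simp only [h2, norm_one, one_pow, ← Finset.mul_sum, Finset.sum_add_distrib,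
    Finset.sum_const, Finset.card_univ, nsmul_eq_mul, mul_one, Finset.sum_ite_eq,
    Finset.mem_univ, if_true] at h1
  have hd : (0 : ℝ) < Fintype.card ι := by exact_mod_cast Fintype.card_pos
  rw [hQ, eq_div_iff (by positivity)]
  linear_combination (‖v‖ ^ 2 * ‖w‖ ^ 2 + ‖inner ℂ v w‖ ^ 2) * h1

/-- A variance bound for a random combination of the fixed vectors m k. The product part of the
covariance contributes minus a square and is dropped. The rest is split by ⟨m_k, m_l⟩ ≤ (‖m_k‖² +
‖m_l‖²)/2 and summed with the Bessel-type hypothesis. -/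
theorem integral_sphere_norm_sum_sq_le {κ 𝓗 : Type*} [NormedAddCommGroup 𝓗]
    [InnerProductSpace ℝ 𝓗] (s : Finset κ) (v : κ → W) (m : κ → 𝓗)
    (hv : ∀ x : W, ∑ k ∈ s, ‖inner ℂ x (v k)‖ ^ 2 ≤ ‖x‖ ^ 2) :
    ∫ c, ‖∑ k ∈ s, (‖inner ℂ (v k) (c : W)‖ ^ 2 - ‖v k‖ ^ 2 / Fintype.card ι) • m k‖ ^ 2
      ∂(uniformSphere W) ≤
      (∑ k ∈ s, ‖v k‖ ^ 2 * ‖m k‖ ^ 2) / (Fintype.card ι : ℝ) ^ 2 := by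
  set d : ℝ := (Fintype.card ι : ℝ) with hd_def
  have hd : 0 < d := by rw [hd_def]; exact_mod_cast Fintype.card_pos
  have hd1 : 1 ≤ d := by rw [hd_def]; exact_mod_cast Fintype.card_pos
  have expand : ∀ x : κ → ℝ, ‖∑ k ∈ s, x k • m k‖ ^ 2 =
      ∑ k ∈ s, ∑ l ∈ s, inner ℝ (m k) (m l) * (x k * x l) := by
    intro x
    rw [← real_inner_self_eq_norm_sq, sum_inner]
    refine Finset.sum_congr rfl fun k _ => ?_
    rw [inner_sum]
    refine Finset.sum_congr rfl fun l _ => ?_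
    rw [real_inner_smul_left, real_inner_smul_right]
    ring
  have hcov : ∀ k l, ∫ c, (‖inner ℂ (v k) (c : W)‖ ^ 2 - ‖v k‖ ^ 2 / d) *
      (‖inner ℂ (v l) (c : W)‖ ^ 2 - ‖v l‖ ^ 2 / d) ∂(uniformSphere W) =
      (‖inner ℂ (v k) (v l)‖ ^ 2 - ‖v k‖ ^ 2 * ‖v l‖ ^ 2 / d) / (d * (d + 1)) := by
    intro k l
    have e : ∀ c : Metric.sphere (0 : W) 1, (‖inner ℂ (v k) (c : W)‖ ^ 2 - ‖v k‖ ^ 2 / d) *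
        (‖inner ℂ (v l) (c : W)‖ ^ 2 - ‖v l‖ ^ 2 / d) =
        ‖inner ℂ (v k) (c : W)‖ ^ 2 * ‖inner ℂ (v l) (c : W)‖ ^ 2 -
        ‖v l‖ ^ 2 / d * ‖inner ℂ (v k) (c : W)‖ ^ 2 -
        ‖v k‖ ^ 2 / d * ‖inner ℂ (v l) (c : W)‖ ^ 2 +
        ‖v k‖ ^ 2 / d * (‖v l‖ ^ 2 / d) := fun c => by ring
    simp_rw [e]
    rw [integral_add, integral_sub, integral_sub, integral_const_mul, integral_const_mul,
      integral_sphere_inner_sq, integral_sphere_inner_sq, integral_sphere_inner_sq_mul_inner_sq]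
    rotate_left
    all_goals try exact integrable_uniformSphere (by fun_prop)
    simp only [integral_const, probReal_univ, one_smul, ← hd_def]
    field_simp
    ring
  have hint : ∀ k l, Integrable (fun c : Metric.sphere (0 : W) 1 => inner ℝ (m k) (m l) *
      ((‖inner ℂ (v k) (c : W)‖ ^ 2 - ‖v k‖ ^ 2 / d) *
      (‖inner ℂ (v l) (c : W)‖ ^ 2 - ‖v l‖ ^ 2 / d))) (uniformSphere W) :=
    fun k l => integrable_uniformSphere (by fun_prop)
  simp only [expand]
  rw [integral_finsetSum _ fun k _ => integrable_finsetSum _ fun l _ => hint k l]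
  simp_rw [integral_finsetSum s fun l _ => hint _ l, integral_const_mul, hcov]
  have hsplit : ∑ k ∈ s, ∑ l ∈ s, inner ℝ (m k) (m l) *
      ((‖inner ℂ (v k) (v l)‖ ^ 2 - ‖v k‖ ^ 2 * ‖v l‖ ^ 2 / d) / (d * (d + 1))) =
      (∑ k ∈ s, ∑ l ∈ s, inner ℝ (m k) (m l) * ‖inner ℂ (v k) (v l)‖ ^ 2) / (d * (d + 1)) -
      ‖∑ k ∈ s, (‖v k‖ ^ 2) • m k‖ ^ 2 / (d * (d * (d + 1))) := by
    rw [expand, Finset.sum_div, Finset.sum_div, ← Finset.sum_sub_distrib]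
    refine Finset.sum_congr rfl fun k _ => ?_
    rw [Finset.sum_div, Finset.sum_div, ← Finset.sum_sub_distrib]
    refine Finset.sum_congr rfl fun l _ => ?_
    field_simp
  have hmain : ∑ k ∈ s, ∑ l ∈ s, inner ℝ (m k) (m l) * ‖inner ℂ (v k) (v l)‖ ^ 2 ≤
      ∑ k ∈ s, ‖v k‖ ^ 2 * ‖m k‖ ^ 2 := by
    have h1 : ∀ k l, inner ℝ (m k) (m l) * ‖inner ℂ (v k) (v l)‖ ^ 2 ≤
        ‖m k‖ ^ 2 / 2 * ‖inner ℂ (v k) (v l)‖ ^ 2 + ‖m l‖ ^ 2 / 2 * ‖inner ℂ (v l) (v k)‖ ^ 2 := by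
      intro k l
      rw [norm_inner_symm (v l) (v k), ← add_mul]
      refine mul_le_mul_of_nonneg_right ?_ (sq_nonneg _)
      have := real_inner_le_norm (m k) (m l)
      nlinarith [sq_nonneg (‖m k‖ - ‖m l‖)]
    calc _ ≤ ∑ k ∈ s, ∑ l ∈ s, (‖m k‖ ^ 2 / 2 * ‖inner ℂ (v k) (v l)‖ ^ 2 +
          ‖m l‖ ^ 2 / 2 * ‖inner ℂ (v l) (v k)‖ ^ 2) :=
          Finset.sum_le_sum fun k _ => Finset.sum_le_sum fun l _ => h1 k l
      _ = ∑ k ∈ s, ‖m k‖ ^ 2 * ∑ l ∈ s, ‖inner ℂ (v k) (v l)‖ ^ 2 := by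
          simp_rw [Finset.sum_add_distrib]
          rw [Finset.sum_comm (s := s) (t := s)
            (f := fun k l => ‖m l‖ ^ 2 / 2 * ‖inner ℂ (v l) (v k)‖ ^ 2), ← Finset.sum_add_distrib]
          refine Finset.sum_congr rfl fun k _ => ?_
          rw [← Finset.mul_sum]
          ring
      _ ≤ _ := by
          refine Finset.sum_le_sum fun k _ => ?_
          rw [mul_comm]
          exact mul_le_mul_of_nonneg_right (hv (v k)) (sq_nonneg _)
  rw [hsplit]
  have h0 : 0 ≤ ∑ k ∈ s, ‖v k‖ ^ 2 * ‖m k‖ ^ 2 := Finset.sum_nonneg fun k _ => by positivity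
  calc _ ≤ (∑ k ∈ s, ‖v k‖ ^ 2 * ‖m k‖ ^ 2) / (d * (d + 1)) - 0 := by gcongr; positivity
    _ ≤ (∑ k ∈ s, ‖v k‖ ^ 2 * ‖m k‖ ^ 2) / d ^ 2 := by
      rw [sub_zero]
      refine div_le_div_of_nonneg_left h0 (by positivity) ?_
      nlinarith

end SphereMoments

/-! ### Time averages and trigonometric sums -/

section TimeAverages

variable {E F : Type*} [NormedAddCommGroup E] [NormedSpace ℝ E] [NormedAddCommGroup F]
  [NormedSpace ℝ F]

theorem hasTimeAverage_const [CompleteSpace E] (a : E) : HasTimeAverage (fun _ => a) a := by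
  refine tendsto_const_nhds.congr' ?_
  filter_upwards [eventually_gt_atTop 0] with T hT
  rw [intervalIntegral.integral_const, sub_zero, smul_smul, inv_mul_cancel₀ hT.ne', one_smul]

theorem HasTimeAverage.add {f g : ℝ → E} {a b : E} (hf : HasTimeAverage f a)
    (hg : HasTimeAverage g b) (hfc : Continuous f) (hgc : Continuous g) :
    HasTimeAverage (fun t => f t + g t) (a + b) := by
  refine (Tendsto.add hf hg).congr fun T => ?_
  rw [intervalIntegral.integral_add (hfc.intervalIntegrable _ _) (hgc.intervalIntegrable _ _),
    smul_add]

theorem hasTimeAverage_sum {J : Type*} (s : Finset J) {f : J → ℝ → E} {a : J → E}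
    (hf : ∀ j ∈ s, HasTimeAverage (f j) (a j)) (hfc : ∀ j, Continuous (f j)) :
    HasTimeAverage (fun t => ∑ j ∈ s, f j t) (∑ j ∈ s, a j) := by
  refine (tendsto_finsetSum s hf).congr fun T => ?_
  rw [intervalIntegral.integral_finsetSum fun j _ => (hfc j).intervalIntegrable _ _,
    Finset.smul_sum]

theorem HasTimeAverage.map [CompleteSpace E] [CompleteSpace F] (L : E →L[ℝ] F) {f : ℝ → E} {a : E}
    (hf : HasTimeAverage f a) (hfc : Continuous f) :
    HasTimeAverage (fun t => L (f t)) (L a) := by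
  refine ((L.continuous.tendsto a).comp hf).congr fun T => ?_
  simp only [Function.comp]
  rw [map_smul, L.intervalIntegral_comp_comm (hfc.intervalIntegrable _ _)]

theorem HasTimeAverage.const_mul {f : ℝ → ℝ} {a : ℝ} (hf : HasTimeAverage f a) (c : ℝ) :
    HasTimeAverage (fun t => c * f t) (c * a) := by
  refine (Tendsto.const_mul c hf).congr fun T => ?_
  rw [intervalIntegral.integral_const_mul, smul_eq_mul, smul_eq_mul]
  ring

theorem HasTimeAverage.smul_const [NormedSpace ℂ E] [IsScalarTower ℝ ℂ E] [CompleteSpace E]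
    {f : ℝ → ℂ} {a : ℂ} (hf : HasTimeAverage f a) (hfc : Continuous f) (v : E) :
    HasTimeAverage (fun t => f t • v) (a • v) :=
  hf.map ((ContinuousLinearMap.toSpanSingleton ℂ v).restrictScalars ℝ) hfc

theorem norm_timeAverage_sub_le {f g : ℝ → E} (hf : Continuous f) (hg : Continuous g) {ε : ℝ}
    (h : ∀ t, ‖f t - g t‖ ≤ ε) {T : ℝ} (hT : 0 < T) :
    ‖(T⁻¹ • ∫ t in (0 : ℝ)..T, f t) - T⁻¹ • ∫ t in (0 : ℝ)..T, g t‖ ≤ ε := by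
  rw [← smul_sub, ← intervalIntegral.integral_sub (hf.intervalIntegrable _ _)
    (hg.intervalIntegrable _ _), norm_smul, norm_inv, Real.norm_of_nonneg hT.le]
  have := intervalIntegral.norm_integral_le_of_norm_le_const (a := 0) (b := T)
    (f := fun t => f t - g t) (C := ε) fun t _ => h t
  rw [sub_zero, abs_of_pos hT] at this
  rw [inv_mul_le_iff₀ hT, mul_comm]
  exact this

theorem hasTimeAverage_of_approx {f : ℝ → E} {a : E} (hf : Continuous f)
    (h : ∀ ε > 0, ∃ (g : ℝ → E) (b : E), Continuous g ∧ HasTimeAverage g b ∧ ‖a - b‖ ≤ ε ∧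
      ∀ t, ‖f t - g t‖ ≤ ε) : HasTimeAverage f a := by
  refine Metric.tendsto_nhds.2 fun ε hε => ?_
  obtain ⟨g, b, hg, hgb, hab, hfg⟩ := h (ε / 4) (by positivity)
  filter_upwards [Metric.tendsto_nhds.1 hgb (ε / 4) (by positivity), eventually_gt_atTop 0]
    with T hT hT0
  have h1 := norm_timeAverage_sub_le hf hg hfg hT0
  rw [← dist_eq_norm] at h1
  rw [← dist_eq_norm, dist_comm] at hab
  have h2 := dist_triangle4 (T⁻¹ • ∫ t in (0 : ℝ)..T, f t) (T⁻¹ • ∫ t in (0 : ℝ)..T, g t) b a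
  linarith

/-- No candidate limit is available here: uniform approximation by functions with averages makes the
finite-time averages Cauchy. -/
theorem exists_hasTimeAverage_of_approx [CompleteSpace E] {f : ℝ → E} (hf : Continuous f)
    (h : ∀ ε > 0, ∃ (g : ℝ → E) (b : E), Continuous g ∧ HasTimeAverage g b ∧
      ∀ t, ‖f t - g t‖ ≤ ε) : ∃ a, HasTimeAverage f a := by
  refine cauchy_map_iff_exists_tendsto.1 (Metric.cauchy_iff.2 ⟨inferInstance, fun ε hε => ?_⟩)
  obtain ⟨g, b, hg, hgb, hfg⟩ := h (ε / 5) (by positivity)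
  have hev := (Metric.tendsto_nhds.1 hgb (ε / 5) (by positivity)).and (eventually_gt_atTop 0)
  refine ⟨_, image_mem_map hev, ?_⟩
  rintro _ ⟨T, ⟨hT, hT0⟩, rfl⟩ _ ⟨T', ⟨hT', hT0'⟩, rfl⟩
  have h1 := norm_timeAverage_sub_le hf hg hfg hT0
  have h1' := norm_timeAverage_sub_le hf hg hfg hT0'
  rw [← dist_eq_norm] at h1 h1'
  have h2 := dist_triangle4 (T⁻¹ • ∫ t in (0 : ℝ)..T, f t) (T⁻¹ • ∫ t in (0 : ℝ)..T, g t) b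
    (T'⁻¹ • ∫ t in (0 : ℝ)..T', f t)
  have h3 := dist_triangle b (T'⁻¹ • ∫ t in (0 : ℝ)..T', g t) (T'⁻¹ • ∫ t in (0 : ℝ)..T', f t)
  have e1 := dist_comm b (T'⁻¹ • ∫ t in (0 : ℝ)..T', g t)
  have e2 := dist_comm (T'⁻¹ • ∫ t in (0 : ℝ)..T', g t) (T'⁻¹ • ∫ t in (0 : ℝ)..T', f t)
  change dist (T⁻¹ • ∫ t in (0 : ℝ)..T, f t) (T'⁻¹ • ∫ t in (0 : ℝ)..T', f t) < ε
  linarith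

theorem HasTimeAverage.mono {f g : ℝ → ℝ} {a b : ℝ} (hf : HasTimeAverage f a)
    (hg : HasTimeAverage g b) (hfc : Continuous f) (hgc : Continuous g) (h : ∀ t, f t ≤ g t) :
    a ≤ b := by
  refine le_of_tendsto_of_tendsto hf hg ?_
  filter_upwards [eventually_gt_atTop 0] with T hT
  exact mul_le_mul_of_nonneg_left (intervalIntegral.integral_mono_on hT.le
    (hfc.intervalIntegrable _ _) (hgc.intervalIntegrable _ _) fun t _ => h t) (by positivity)

/-- Average 2 a f ≤ f² + a², with a the mean of f itself. -/
theorem HasTimeAverage.le_sqrt {f : ℝ → ℝ} {a c : ℝ} (hf : HasTimeAverage f a)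
    (hfc : Continuous f) (hf2 : HasTimeAverage (fun t => f t ^ 2) c) : a ≤ √c := by
  have h : 2 * a * a ≤ c + a ^ 2 := by
    have h1 := (hf2.add (hasTimeAverage_const (a ^ 2)) (by fun_prop) (by fun_prop))
    refine (hf.const_mul (2 * a)).mono h1 (by fun_prop) (by fun_prop) fun t => ?_
    nlinarith [sq_nonneg (f t - a)]
  exact Real.le_sqrt_of_sq_le (by nlinarith)

theorem HasTimeAverage.hasTimeMean {f : ℝ → ℝ} {a : ℝ} (hf : HasTimeAverage f a)
    (hfc : Continuous f) (h0 : ∀ t, 0 ≤ f t) :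
    HasTimeMean (fun t => ENNReal.ofReal (f t)) (ENNReal.ofReal a) := by
  refine ((ENNReal.continuous_ofReal.tendsto a).comp hf).congr' ?_
  filter_upwards [eventually_gt_atTop 0] with T hT
  simp only [Function.comp]
  rw [← ofReal_integral_eq_lintegral_ofReal hfc.integrableOn_Ioc (Eventually.of_forall h0),
    intervalIntegral.integral_of_le hT.le, smul_eq_mul, mul_comm,
    ENNReal.ofReal_mul' (by positivity), ENNReal.ofReal_inv_of_pos hT, div_eq_mul_inv]

/-- The oscillation `t ↦ e^{iνt}`. -/
noncomputable def oscillation (ν : ℝ) (t : ℝ) : ℂ := Complex.exp (Complex.I * ν * t)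

theorem continuous_oscillation (ν : ℝ) : Continuous (oscillation ν) := by
  unfold oscillation; fun_prop

theorem oscillation_mul (ν ν' t : ℝ) :
    oscillation ν t * oscillation ν' t = oscillation (ν + ν') t := by
  unfold oscillation
  rw [← Complex.exp_add]
  push_cast
  ring_nf

theorem conj_oscillation (ν t : ℝ) :
    (starRingEnd ℂ) (oscillation ν t) = oscillation (-ν) t := by
  unfold oscillation
  rw [← Complex.exp_conj]
  simp

theorem norm_oscillation (ν t : ℝ) : ‖oscillation ν t‖ = 1 := by
  unfold oscillation
  rw [Complex.norm_exp]
  simp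

theorem hasTimeAverage_oscillation (ν : ℝ) :
    HasTimeAverage (oscillation ν) (if ν = 0 then 1 else 0) := by
  by_cases hν : ν = 0
  · have : oscillation ν = fun _ => 1 := by
      ext t
      simp [oscillation, hν]
    rw [if_pos hν, this]
    exact hasTimeAverage_const 1
  rw [if_neg hν]
  have hc : Complex.I * ν ≠ 0 := by simp [hν]
  refine squeeze_zero_norm' (a := fun T => T⁻¹ * (2 / |ν|)) ?_ ?_
  · filter_upwards [eventually_gt_atTop 0] with T hT
    unfold oscillation
    rw [integral_exp_mul_complex hc, norm_smul, norm_inv, Real.norm_of_nonneg hT.le, norm_div]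
    gcongr
    · refine (norm_sub_le _ _).trans ?_
      have h1 := norm_oscillation ν T
      have h2 := norm_oscillation ν 0
      unfold oscillation at h1 h2
      rw [h1, h2]
      norm_num
    · simp
  · simpa using tendsto_inv_atTop_zero.mul_const (2 / |ν|)

/-- Parseval for trigonometric sums: distinct frequencies leave a nonzero frequency in every cross
term, which averages to zero. -/
theorem hasTimeAverage_norm_sum_sq {𝓗 J : Type*} [NormedAddCommGroup 𝓗] [InnerProductSpace ℂ 𝓗]
    (s : Finset J) (ν : J → ℝ) (hν : Set.InjOn ν s) (v : J → 𝓗) :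
    HasTimeAverage (fun t => ‖∑ j ∈ s, oscillation (ν j) t • v j‖ ^ 2) (∑ j ∈ s, ‖v j‖ ^ 2) := by
  classical
  have h1 : HasTimeAverage (fun t => ∑ j ∈ s, ∑ k ∈ s,
      oscillation (-ν j + ν k) t * inner ℂ (v j) (v k))
      (∑ j ∈ s, ∑ k ∈ s, (if -ν j + ν k = 0 then 1 else 0) * inner ℂ (v j) (v k)) := by
    refine hasTimeAverage_sum s (fun j _ => hasTimeAverage_sum s (fun k _ => ?_) fun k => ?_)
      fun j => ?_
    · exact (hasTimeAverage_oscillation _).smul_const (continuous_oscillation _)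
        (inner ℂ (v j) (v k) : ℂ)
    · exact (continuous_oscillation _).mul continuous_const
    · exact continuous_finsetSum _ fun k _ => (continuous_oscillation _).mul continuous_const
  have h2 := h1.map Complex.reCLM (continuous_finsetSum _ fun j _ =>
    continuous_finsetSum _ fun k _ => (continuous_oscillation _).mul continuous_const)
  convert! h2 using 1
  · ext t
    rw [← inner_self_eq_norm_sq (𝕜 := ℂ), sum_inner]
    simp only [inner_sum, inner_smul_left, inner_smul_right, conj_oscillation]
    change Complex.re _ = Complex.re _
    congr 1
    refine Finset.sum_congr rfl fun j _ => Finset.sum_congr rfl fun k _ => ?_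
    rw [← oscillation_mul]
    ring
  · rw [map_sum]
    refine Finset.sum_congr rfl fun j hj => ?_
    rw [Finset.sum_eq_single_of_mem j hj]
    · simp only [neg_add_cancel, if_true, one_mul]
      exact (inner_self_eq_norm_sq (𝕜 := ℂ) (v j)).symm
    · intro k hk hkj
      rw [if_neg, zero_mul]
      intro h
      exact hkj (hν hk hj (by linarith))

end TimeAverages

/-! ### Existence of averages along a torus flow -/

section Torus

variable {κ : Type*}

/-- The linear flow on the torus with frequencies `-E k`. -/
noncomputable def torusFlow (E : κ → ℝ) (t : ℝ) (k : κ) : Circle := Circle.exp (-E k * t)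

theorem coe_torusFlow (E : κ → ℝ) (t : ℝ) (k : κ) :
    (torusFlow E t k : ℂ) = oscillation (-E k) t := by
  rw [torusFlow, Circle.coe_exp, oscillation]
  push_cast
  ring_nf

theorem continuous_torusFlow (E : κ → ℝ) : Continuous (torusFlow E) := by
  refine continuous_pi fun k => ?_
  unfold torusFlow
  fun_prop

/-- Trigonometric polynomials. -/
noncomputable def trigPolynomials : Submodule ℂ (ℝ → ℂ) := Submodule.span ℂ (Set.range oscillation)

theorem mul_mem_trigPolynomials {f g : ℝ → ℂ} (hf : f ∈ trigPolynomials)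
    (hg : g ∈ trigPolynomials) : f * g ∈ trigPolynomials := by
  induction hf using Submodule.span_induction with
  | zero => rw [zero_mul]; exact Submodule.zero_mem _
  | add x y _ _ hx hy => rw [add_mul]; exact Submodule.add_mem _ hx hy
  | smul a x _ hx => rw [smul_mul_assoc]; exact Submodule.smul_mem _ _ hx
  | mem x hx =>
    obtain ⟨ν, rfl⟩ := hx
    induction hg using Submodule.span_induction with
    | zero => rw [mul_zero]; exact Submodule.zero_mem _
    | add x y _ _ hx hy => rw [mul_add]; exact Submodule.add_mem _ hx hy
    | smul a x _ hx => rw [mul_smul_comm]; exact Submodule.smul_mem _ _ hx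
    | mem x hx =>
      obtain ⟨ν', rfl⟩ := hx
      exact Submodule.subset_span ⟨ν + ν', by ext t; exact (oscillation_mul ν ν' t).symm⟩

theorem star_mem_trigPolynomials {f : ℝ → ℂ} (hf : f ∈ trigPolynomials) :
    star f ∈ trigPolynomials := by
  induction hf using Submodule.span_induction with
  | zero => rw [star_zero]; exact Submodule.zero_mem _
  | add x y _ _ hx hy => rw [star_add]; exact Submodule.add_mem _ hx hy
  | smul a x _ hx => rw [star_smul]; exact Submodule.smul_mem _ _ hx
  | mem x hx =>
    obtain ⟨ν, rfl⟩ := hx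
    exact Submodule.subset_span ⟨-ν, by ext t; exact (conj_oscillation ν t).symm⟩

theorem exists_hasTimeAverage_of_mem_trigPolynomials {f : ℝ → ℂ} (hf : f ∈ trigPolynomials) :
    Continuous f ∧ ∃ a, HasTimeAverage f a := by
  induction hf using Submodule.span_induction with
  | zero => exact ⟨continuous_const, 0, hasTimeAverage_const 0⟩
  | add x y _ _ hx hy =>
    obtain ⟨hxc, a, hxa⟩ := hx
    obtain ⟨hyc, b, hyb⟩ := hy
    exact ⟨hxc.add hyc, a + b, hxa.add hyb hxc hyc⟩
  | smul c x _ hx =>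
    obtain ⟨hxc, a, hxa⟩ := hx
    refine ⟨hxc.const_smul c, a • c, ?_⟩
    have := hxa.smul_const hxc c
    convert this using 1
    ext t
    simp [mul_comm]
  | mem x hx =>
    obtain ⟨ν, rfl⟩ := hx
    exact ⟨continuous_oscillation ν, _, hasTimeAverage_oscillation ν⟩

/-- The product of circles is compact for any index set and its coordinates separate points, so by
Stone–Weierstrass Φ is a uniform limit of polynomials in the coordinates and their conjugates. Along
the flow these become trigonometric polynomials, which have averages. -/
theorem exists_hasTimeAverage_torus_complex (E : κ → ℝ) (Φ : C(κ → Circle, ℂ)) :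
    ∃ a, HasTimeAverage (fun t => Φ (torusFlow E t)) a := by
  let coord : κ → C(κ → Circle, ℂ) := fun k => ⟨fun u => (u k : ℂ), by fun_prop⟩
  let A : StarSubalgebra ℂ C(κ → Circle, ℂ) := StarAlgebra.adjoin ℂ (Set.range coord)
  have hA : A.topologicalClosure = ⊤ := by
    refine ContinuousMap.starSubalgebra_topologicalClosure_eq_top_of_separatesPoints A ?_
    intro u v huv
    obtain ⟨k, hk⟩ := Function.ne_iff.1 huv
    refine ⟨coord k, ⟨coord k, StarAlgebra.subset_adjoin ℂ _ ⟨k, rfl⟩, rfl⟩, ?_⟩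
    exact fun h => hk (Circle.coe_injective h)
  have htrig : ∀ Ψ ∈ A, (fun t => Ψ (torusFlow E t)) ∈ trigPolynomials := by
    intro Ψ hΨ
    refine StarAlgebra.adjoin_induction
      (p := fun (Ψ : C(κ → Circle, ℂ)) _ => (fun t => Ψ (torusFlow E t)) ∈ trigPolynomials)
      ?_ ?_ ?_ ?_ ?_ hΨ
    · rintro _ ⟨k, rfl⟩
      refine Submodule.subset_span ⟨-E k, ?_⟩
      ext t
      exact (coe_torusFlow E t k).symm
    · intro r
      have h1 : oscillation 0 ∈ trigPolynomials := Submodule.subset_span ⟨0, rfl⟩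
      convert Submodule.smul_mem _ r h1 using 1
      ext t
      simp [oscillation, Algebra.algebraMap_eq_smul_one]
    · intro x y _ _ hx hy
      exact Submodule.add_mem _ hx hy
    · intro x y _ _ hx hy
      exact mul_mem_trigPolynomials hx hy
    · intro x _ hx
      exact star_mem_trigPolynomials hx
  refine exists_hasTimeAverage_of_approx (Φ.continuous.comp (continuous_torusFlow E))
    fun ε hε => ?_
  have hΦ : Φ ∈ closure (A : Set C(κ → Circle, ℂ)) := by
    rw [← StarSubalgebra.topologicalClosure_coe, hA]
    trivial
  obtain ⟨Ψ, hΨ, hd⟩ := Metric.mem_closure_iff.1 hΦ ε hε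
  obtain ⟨hc, b, hb⟩ := exists_hasTimeAverage_of_mem_trigPolynomials (htrig Ψ hΨ)
  refine ⟨_, b, hc, hb, fun t => ?_⟩
  rw [← dist_eq_norm]
  exact (ContinuousMap.dist_apply_le_dist _).trans hd.le

theorem exists_hasTimeAverage_torus (E : κ → ℝ) {f : (κ → Circle) → ℝ} (hf : Continuous f) :
    ∃ a, HasTimeAverage (fun t => f (torusFlow E t)) a := by
  obtain ⟨a, ha⟩ := exists_hasTimeAverage_torus_complex E
    ⟨fun u => (f u : ℂ), Complex.continuous_ofReal.comp hf⟩
  have hc : Continuous fun t => (f (torusFlow E t) : ℂ) :=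
    Complex.continuous_ofReal.comp (hf.comp (continuous_torusFlow E))
  exact ⟨_, ha.map Complex.reCLM hc⟩

end Torus

theorem summable_mul_of_hasSum_sq {J : Type*} {f g : J → ℝ} {A B : ℝ} (hf0 : ∀ j, 0 ≤ f j)
    (hg0 : ∀ j, 0 ≤ g j) (hA : 0 ≤ A) (hB : 0 ≤ B) (hf : HasSum (fun j => f j ^ 2) (A ^ 2))
    (hg : HasSum (fun j => g j ^ 2) (B ^ 2)) :
    (Summable fun j => f j * g j) ∧ ∑' j, f j * g j ≤ A * B := by
  obtain ⟨hs, hle⟩ := Real.summable_and_inner_le_Lp_mul_Lq_tsum_of_nonneg (p := 2) (q := 2)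
    (Real.holderConjugate_iff.2 (by norm_num)) hf0 hg0
    (by simpa using hf.summable) (by simpa using hg.summable)
  refine ⟨hs, hle.trans (le_of_eq ?_)⟩
  simp only [Real.rpow_two, hf.tsum_eq, hg.tsum_eq]
  rw [← Real.sqrt_eq_rpow, ← Real.sqrt_eq_rpow, Real.sqrt_sq hA, Real.sqrt_sq hB]

/-! ### Trace norm: duality and basic inequalities -/

section TraceNorm

variable {I : Type*} [DecidableEq I]

theorem inner_ket_left (i : I) (x : Ltwo I) : inner ℂ (ket i) x = x i := by
  rw [ket, lp.inner_single_left]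
  simp

theorem norm_ket (i : I) : ‖(ket i : Ltwo I)‖ = 1 := by
  rw [ket, lp.norm_single (by norm_num)]
  simp

theorem hasSum_norm_sq_apply {I : Type*} (x : Ltwo I) : HasSum (fun i => ‖x i‖ ^ 2) (‖x‖ ^ 2) := by
  have := lp.hasSum_norm (p := 2) (by norm_num) x
  simpa using this

theorem tsum_ofReal_norm_sq_apply {I : Type*} (x : Ltwo I) :
    ∑' i, ENNReal.ofReal (‖x i‖ ^ 2) = ENNReal.ofReal (‖x‖ ^ 2) := by
  rw [← (hasSum_norm_sq_apply x).tsum_eq,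
    ENNReal.ofReal_tsum_of_nonneg (fun _ => sq_nonneg _) (hasSum_norm_sq_apply x).summable]

/-- The square of the Hilbert–Schmidt norm, with value `∞` if the operator is not in that class. -/
noncomputable def hilbertSchmidtSq (X : Ltwo I →L[ℂ] Ltwo I) : ℝ≥0∞ :=
  ∑' i, ENNReal.ofReal (‖X (ket i)‖ ^ 2)

/-- Both sides are the sum of the squared moduli of all matrix entries, in the two orders of
summation. -/
theorem hilbertSchmidtSq_adjoint (X : Ltwo I →L[ℂ] Ltwo I) :
    hilbertSchmidtSq (ContinuousLinearMap.adjoint X) = hilbertSchmidtSq X := by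
  unfold hilbertSchmidtSq
  simp_rw [← tsum_ofReal_norm_sq_apply]
  rw [ENNReal.tsum_comm]
  refine tsum_congr fun i => tsum_congr fun j => ?_
  rw [← inner_ket_left i, ← inner_ket_left j, ContinuousLinearMap.adjoint_inner_right,
    norm_inner_symm]

/-- After taking adjoints the contraction acts last, where it shrinks each column. -/
theorem hilbertSchmidtSq_comp_le (X : Ltwo I →L[ℂ] Ltwo I) {B : Ltwo I →L[ℂ] Ltwo I}
    (hB : ‖B‖ ≤ 1) : hilbertSchmidtSq (X ∘L B) ≤ hilbertSchmidtSq X := by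
  rw [← hilbertSchmidtSq_adjoint, ← hilbertSchmidtSq_adjoint X, ContinuousLinearMap.adjoint_comp]
  refine ENNReal.tsum_le_tsum fun i => ENNReal.ofReal_le_ofReal ?_
  refine pow_le_pow_left₀ (norm_nonneg _) ?_ 2
  rw [ContinuousLinearMap.comp_apply]
  have h : ‖ContinuousLinearMap.adjoint B‖ ≤ 1 := by rwa [LinearIsometryEquiv.norm_map]
  exact (ContinuousLinearMap.le_of_opNorm_le _ h _).trans (one_mul _).le

section Abs

variable {H : Type*} [NormedAddCommGroup H] [InnerProductSpace ℂ H] [CompleteSpace H]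

theorem opAbs_isPositive (T : H →L[ℂ] H) : (opAbs T).IsPositive :=
  (ContinuousLinearMap.nonneg_iff_isPositive _).1 (CFC.abs_nonneg T)

theorem opAbs_opAbs_apply (T : H →L[ℂ] H) (x : H) :
    opAbs T (opAbs T x) = ContinuousLinearMap.adjoint T (T x) := by
  have h := CFC.abs_mul_abs T
  exact congrArg (fun A : H →L[ℂ] H => A x) h

theorem norm_opAbs_apply (T : H →L[ℂ] H) (x : H) : ‖opAbs T x‖ = ‖T x‖ := by
  have h1 : inner ℂ (opAbs T x) (opAbs T x) = inner ℂ (T x) (T x) := by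
    rw [← ContinuousLinearMap.adjoint_inner_right (opAbs T),
      (opAbs_isPositive T).isSelfAdjoint.adjoint_eq, opAbs_opAbs_apply,
      ContinuousLinearMap.adjoint_inner_right]
  rw [inner_self_eq_norm_sq_to_K, inner_self_eq_norm_sq_to_K] at h1
  have h2 : ‖opAbs T x‖ ^ 2 = ‖T x‖ ^ 2 := by exact_mod_cast h1
  exact (pow_left_inj₀ (norm_nonneg _) (norm_nonneg _) two_ne_zero).1 h2

theorem exists_sqrt_opAbs (T : H →L[ℂ] H) :
    ∃ R : H →L[ℂ] H, ContinuousLinearMap.adjoint R = R ∧ ∀ x, R (R x) = opAbs T x := by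
  have h0 : 0 ≤ CFC.sqrt (opAbs T) := CFC.sqrt_nonneg (opAbs T)
  have hsa : IsSelfAdjoint (CFC.sqrt (opAbs T)) :=
    ((ContinuousLinearMap.nonneg_iff_isPositive _).1 h0).isSelfAdjoint
  refine ⟨CFC.sqrt (opAbs T), hsa.adjoint_eq, fun x => ?_⟩
  have h1 : 0 ≤ opAbs T := CFC.abs_nonneg T
  have h := CFC.sqrt_mul_sqrt_self (opAbs T) h1
  exact congrArg (fun A : H →L[ℂ] H => A x) h

-- Y = (|T| + δ)⁻¹ gives the contraction T Y, a regularized substitute for the partial isometry in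
-- the polar decomposition of T.
open scoped ComplexOrder in
theorem exists_inverse_opAbs_add (T : H →L[ℂ] H) {δ : ℝ} (hδ : 0 < δ) :
    ∃ Y : H →L[ℂ] H, (∀ x, opAbs T (Y x) + (δ : ℂ) • Y x = x) ∧
      (∀ x, Y (opAbs T x) + (δ : ℂ) • Y x = x) ∧ ∀ x, ‖opAbs T (Y x)‖ ≤ ‖x‖ := by
  set P := opAbs T
  have hP := opAbs_isPositive T
  have hu : IsUnit (P + (δ : ℂ) • (1 : H →L[ℂ] H)) := by
    have hs : ((-δ : ℝ) : ℂ) ∉ spectrum ℂ P := by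
      intro h
      have := spectrum_nonneg_of_nonneg (𝕜 := ℂ) (a := P) (CFC.abs_nonneg T) h
      rw [Complex.nonneg_iff] at this
      have h2 := this.1
      rw [Complex.ofReal_re] at h2
      linarith
    have h2 := (spectrum.notMem_iff.1 hs).neg
    convert h2 using 1
    rw [Algebra.algebraMap_eq_smul_one]
    push_cast
    module
  obtain ⟨⟨A, Y, hAY, hYA⟩, hA⟩ := hu
  simp only at hA
  subst hA
  have h1 : ∀ x, P (Y x) + (δ : ℂ) • Y x = x := fun x => by
    have := congrArg (fun A : H →L[ℂ] H => A x) hAY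
    simpa using this
  have h2 : ∀ x, Y (P x) + (δ : ℂ) • Y x = x := fun x => by
    have := congrArg (fun A : H →L[ℂ] H => A x) hYA
    simpa using this
  refine ⟨Y, h1, h2, fun x => ?_⟩
  -- Expand ‖P Y x + δ Y x‖²; the cross term is nonnegative because P is.
  have h3 : ‖P (Y x)‖ ^ 2 ≤ ‖x‖ ^ 2 := by
    conv_rhs => rw [← h1 x]
    rw [norm_add_sq (𝕜 := ℂ), inner_smul_right]
    have h4 : 0 ≤ (inner ℂ (P (Y x)) (Y x)).re := hP.re_inner_nonneg_left (Y x)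
    have h5 : RCLike.re ((δ : ℂ) * inner ℂ (P (Y x)) (Y x)) =
        δ * (inner ℂ (P (Y x)) (Y x)).re := by
      simp
    rw [h5]
    nlinarith [mul_nonneg hδ.le h4, sq_nonneg ‖(δ : ℂ) • Y x‖]
  exact (pow_le_pow_iff_left₀ (norm_nonneg _) (norm_nonneg _) two_ne_zero).1 h3

end Abs

theorem traceNorm_eq_hilbertSchmidtSq {T R : Ltwo I →L[ℂ] Ltwo I}
    (hsa : ContinuousLinearMap.adjoint R = R) (hR : ∀ x, R (R x) = opAbs T x) :
    traceNorm T = hilbertSchmidtSq R := by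
  refine tsum_congr fun i => ?_
  congr 1
  rw [← hR, ← ContinuousLinearMap.adjoint_inner_left, hsa, inner_self_eq_norm_sq_to_K]
  norm_cast

/-- One half of duality. Write W T = V (|T| + δ) with V = W T (|T| + δ)⁻¹ a contraction, and |T| =
R². Each term is then at most the mean of ‖R V* i‖² and ‖R i‖² plus δ, and both Hilbert–Schmidt sums
are bounded by the trace norm. As A is finite the total error |A| δ vanishes with δ. -/
theorem sum_re_inner_le_traceNorm (T : Ltwo I →L[ℂ] Ltwo I) {W : Ltwo I →L[ℂ] Ltwo I}
    (hW : ‖W‖ ≤ 1) (A : Finset I) :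
    ENNReal.ofReal (∑ i ∈ A, (inner ℂ (ket i) (W (T (ket i)))).re) ≤ traceNorm T := by
  obtain ⟨R, hsa, hRR⟩ := exists_sqrt_opAbs T
  have key : ∀ δ > 0, ENNReal.ofReal (∑ i ∈ A, (inner ℂ (ket i) (W (T (ket i)))).re) ≤
      traceNorm T + ENNReal.ofReal (A.card * δ) := by
    intro δ hδ
    obtain ⟨Y, hY1, hY2, hY3⟩ := exists_inverse_opAbs_add T hδ
    have hTY : ∀ x, ‖T (Y x)‖ ≤ ‖x‖ := fun x => by rw [← norm_opAbs_apply]; exact hY3 x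
    set V := W ∘L T ∘L Y with hV
    have hV1 : ‖V‖ ≤ 1 := by
      refine ContinuousLinearMap.opNorm_le_bound _ zero_le_one fun x => ?_
      rw [one_mul]
      exact ((ContinuousLinearMap.le_of_opNorm_le _ hW _).trans (one_mul _).le).trans (hTY x)
    set B := ContinuousLinearMap.adjoint V
    have hB : ‖B‖ ≤ 1 := by rw [LinearIsometryEquiv.norm_map]; exact hV1
    have hterm : ∀ i : I, (inner ℂ (ket i) (W (T (ket i)))).re ≤
        (‖(R ∘L B) (ket i)‖ ^ 2 + ‖R (ket i)‖ ^ 2) / 2 + δ := by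
      intro i
      have e1 : W (T (ket i)) = V (R (R (ket i))) + (δ : ℂ) • V (ket i) := by
        rw [hRR]
        simp only [hV, ContinuousLinearMap.comp_apply]
        conv_lhs => rw [← hY2 (ket i)]
        simp only [map_add, map_smul]
      rw [e1, inner_add_right, Complex.add_re, inner_smul_right]
      have e2 : (inner ℂ (ket i) (V (R (R (ket i))))).re ≤ ‖(R ∘L B) (ket i)‖ * ‖R (ket i)‖ := by
        rw [← ContinuousLinearMap.adjoint_inner_left V, ← ContinuousLinearMap.adjoint_inner_left R,
          hsa]
        exact (Complex.re_le_norm _).trans (norm_inner_le_norm _ _)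
      have e3 : ((δ : ℂ) * inner ℂ (ket i) (V (ket i))).re ≤ δ := by
        rw [Complex.re_ofReal_mul]
        refine (mul_le_mul_of_nonneg_left ?_ hδ.le).trans (mul_one δ).le
        refine (Complex.re_le_norm _).trans ((norm_inner_le_norm _ _).trans ?_)
        rw [norm_ket, one_mul]
        refine (ContinuousLinearMap.le_of_opNorm_le _ hV1 _).trans ?_
        rw [norm_ket, one_mul]
      nlinarith [sq_nonneg (‖(R ∘L B) (ket i)‖ - ‖R (ket i)‖)]
    calc ENNReal.ofReal (∑ i ∈ A, (inner ℂ (ket i) (W (T (ket i)))).re)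
        ≤ ENNReal.ofReal (∑ i ∈ A, ((‖(R ∘L B) (ket i)‖ ^ 2 + ‖R (ket i)‖ ^ 2) / 2 + δ)) :=
          ENNReal.ofReal_le_ofReal (Finset.sum_le_sum fun i _ => hterm i)
      _ = ENNReal.ofReal (1 / 2) * (∑ i ∈ A, ENNReal.ofReal (‖(R ∘L B) (ket i)‖ ^ 2) +
            ∑ i ∈ A, ENNReal.ofReal (‖R (ket i)‖ ^ 2)) + ENNReal.ofReal (A.card * δ) := by
          rw [← ENNReal.ofReal_sum_of_nonneg fun _ _ => sq_nonneg _,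
            ← ENNReal.ofReal_sum_of_nonneg fun _ _ => sq_nonneg _,
            ← ENNReal.ofReal_add (by positivity) (by positivity),
            ← ENNReal.ofReal_mul (by norm_num), ← ENNReal.ofReal_add (by positivity) (by positivity),
            Finset.sum_add_distrib, ← Finset.sum_div, Finset.sum_add_distrib, Finset.sum_const,
            nsmul_eq_mul]
          congr 1
          ring
      _ ≤ ENNReal.ofReal (1 / 2) * (hilbertSchmidtSq R + hilbertSchmidtSq R) +
            ENNReal.ofReal (A.card * δ) := by
          gcongr
          · exact (ENNReal.sum_le_tsum A).trans (hilbertSchmidtSq_comp_le R hB)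
          · exact ENNReal.sum_le_tsum A
      _ = traceNorm T + ENNReal.ofReal (A.card * δ) := by
          rw [traceNorm_eq_hilbertSchmidtSq hsa hRR, ← two_mul, ← mul_assoc]
          congr 1
          rw [show (2 : ℝ≥0∞) = ENNReal.ofReal 2 by simp, ← ENNReal.ofReal_mul (by norm_num)]
          norm_num
  have hlim : Tendsto (fun δ : ℝ => traceNorm T + ENNReal.ofReal (A.card * δ)) (𝓝[>] 0)
      (𝓝 (traceNorm T)) := by
    have h1 : Tendsto (fun δ : ℝ => ENNReal.ofReal (A.card * δ)) (𝓝[>] 0) (𝓝 0) := by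
      have hc : Continuous fun δ : ℝ => ENNReal.ofReal (A.card * δ) :=
        ENNReal.continuous_ofReal.comp (by fun_prop)
      have := (hc.tendsto 0).mono_left (nhdsWithin_le_nhds (s := Set.Ioi 0))
      simpa using this
    simpa using h1.const_add (traceNorm T)
  exact ge_of_tendsto hlim (by filter_upwards [self_mem_nhdsWithin] with δ hδ using key δ hδ)

/-- The converse half: testing against the adjoint of T (|T| + δ)⁻¹ recovers each diagonal entry of
|T| up to δ. Subadditivity and passage to infinite sums then need no further spectral theory. -/
theorem traceNorm_le_of_forall {T : Ltwo I →L[ℂ] Ltwo I} {C : ℝ≥0∞}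
    (h : ∀ (W : Ltwo I →L[ℂ] Ltwo I) (A : Finset I), ‖W‖ ≤ 1 →
      ENNReal.ofReal (∑ i ∈ A, (inner ℂ (ket i) (W (T (ket i)))).re) ≤ C) : traceNorm T ≤ C := by
  unfold traceNorm
  rw [ENNReal.tsum_eq_iSup_sum]
  refine iSup_le fun A => ?_
  have hpos : ∀ i : I, 0 ≤ (inner ℂ (ket i) (opAbs T (ket i))).re :=
    fun i => (opAbs_isPositive T).re_inner_nonneg_right (ket i)
  rw [← ENNReal.ofReal_sum_of_nonneg fun i _ => hpos i]
  have key : ∀ δ > 0, ENNReal.ofReal (∑ i ∈ A, (inner ℂ (ket i) (opAbs T (ket i))).re) ≤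
      C + ENNReal.ofReal (A.card * δ) := by
    intro δ hδ
    obtain ⟨Y, hY1, hY2, hY3⟩ := exists_inverse_opAbs_add T hδ
    have hTY : ∀ x, ‖T (Y x)‖ ≤ ‖x‖ := fun x => by rw [← norm_opAbs_apply]; exact hY3 x
    have hcomm : ∀ x, Y (opAbs T x) = opAbs T (Y x) := fun x => by
      have := (hY1 x).trans (hY2 x).symm
      exact (add_right_cancel this).symm
    set V := T ∘L Y
    have hV1 : ‖V‖ ≤ 1 := by
      refine ContinuousLinearMap.opNorm_le_bound _ zero_le_one fun x => ?_
      rw [one_mul]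
      exact hTY x
    have hterm : ∀ i : I, (inner ℂ (ket i) (opAbs T (ket i))).re ≤
        (inner ℂ (ket i) (ContinuousLinearMap.adjoint V (T (ket i)))).re + δ := by
      intro i
      have e1 : ContinuousLinearMap.adjoint V (T (ket i)) =
          ContinuousLinearMap.adjoint Y (opAbs T (opAbs T (ket i))) := by
        rw [ContinuousLinearMap.adjoint_comp, opAbs_opAbs_apply]
        rfl
      rw [e1, ContinuousLinearMap.adjoint_inner_right]
      have hsa := (opAbs_isPositive T).isSelfAdjoint
      have e0 : inner ℂ (Y (ket i)) (opAbs T (opAbs T (ket i))) =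
          inner ℂ (opAbs T (Y (ket i))) (opAbs T (ket i)) := by
        rw [← ContinuousLinearMap.adjoint_inner_left (opAbs T), hsa.adjoint_eq]
      rw [e0]
      have e2 : opAbs T (Y (ket i)) = ket i - (δ : ℂ) • Y (ket i) := eq_sub_of_add_eq (hY1 _)
      rw [e2, inner_sub_left, Complex.sub_re, inner_smul_left, Complex.conj_ofReal,
        Complex.re_ofReal_mul]
      -- Moving |T| to the other side leaves |T| Y, which is a contraction.
      have e3 : (inner ℂ (Y (ket i)) (opAbs T (ket i))).re ≤ 1 := by
        rw [← ContinuousLinearMap.adjoint_inner_left (opAbs T), hsa.adjoint_eq]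
        refine (Complex.re_le_norm _).trans ((norm_inner_le_norm _ _).trans ?_)
        rw [norm_ket, mul_one]
        exact (hY3 _).trans (norm_ket i).le
      nlinarith
    have h1 := h (ContinuousLinearMap.adjoint V) A (by rw [LinearIsometryEquiv.norm_map]; exact hV1)
    calc ENNReal.ofReal (∑ i ∈ A, (inner ℂ (ket i) (opAbs T (ket i))).re)
        ≤ ENNReal.ofReal (∑ i ∈ A,
          (inner ℂ (ket i) (ContinuousLinearMap.adjoint V (T (ket i)))).re + A.card * δ) := by
          refine ENNReal.ofReal_le_ofReal ?_
          rw [← nsmul_eq_mul, ← Finset.sum_const, ← Finset.sum_add_distrib]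
          exact Finset.sum_le_sum fun i _ => hterm i
      _ ≤ _ := ENNReal.ofReal_add_le
      _ ≤ _ := by gcongr
  have hlim : Tendsto (fun δ : ℝ => C + ENNReal.ofReal (A.card * δ)) (𝓝[>] 0) (𝓝 C) := by
    have h1 : Tendsto (fun δ : ℝ => ENNReal.ofReal (A.card * δ)) (𝓝[>] 0) (𝓝 0) := by
      have hc : Continuous fun δ : ℝ => ENNReal.ofReal (A.card * δ) :=
        ENNReal.continuous_ofReal.comp (by fun_prop)
      have := (hc.tendsto 0).mono_left (nhdsWithin_le_nhds (s := Set.Ioi 0))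
      simpa using this
    simpa using h1.const_add C
  exact ge_of_tendsto hlim (by filter_upwards [self_mem_nhdsWithin] with δ hδ using key δ hδ)

theorem traceNorm_add_le (X Y : Ltwo I →L[ℂ] Ltwo I) :
    traceNorm (X + Y) ≤ traceNorm X + traceNorm Y := by
  refine traceNorm_le_of_forall fun W A hW => ?_
  simp only [add_apply, map_add, inner_add_right, Complex.add_re,
    Finset.sum_add_distrib]
  exact ENNReal.ofReal_add_le.trans (add_le_add (sum_re_inner_le_traceNorm X hW A)
    (sum_re_inner_le_traceNorm Y hW A))

theorem traceNorm_neg (X : Ltwo I →L[ℂ] Ltwo I) : traceNorm (-X) = traceNorm X := by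
  unfold traceNorm opAbs
  rw [CFC.abs_neg]

theorem traceNorm_sub_le (X Y : Ltwo I →L[ℂ] Ltwo I) :
    traceNorm (X - Y) ≤ traceNorm X + traceNorm Y := by
  rw [sub_eq_add_neg, ← traceNorm_neg Y]
  exact traceNorm_add_le X (-Y)

theorem abs_toReal_traceNorm_sub_le {X Y : Ltwo I →L[ℂ] Ltwo I} {C : ℝ}
    (hX : traceNorm X ≠ ∞) (hY : traceNorm Y ≠ ∞) (h : traceNorm (X - Y) ≤ ENNReal.ofReal C)
    (hC : 0 ≤ C) : |(traceNorm X).toReal - (traceNorm Y).toReal| ≤ C := by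
  have h1 : ∀ A B : Ltwo I →L[ℂ] Ltwo I, traceNorm A ≠ ∞ → traceNorm B ≠ ∞ →
      traceNorm (A - B) ≤ ENNReal.ofReal C → (traceNorm A).toReal ≤ C + (traceNorm B).toReal := by
    intro A B hA hB hAB
    have h2 : traceNorm A ≤ ENNReal.ofReal C + traceNorm B := by
      have := traceNorm_add_le (A - B) B
      rw [sub_add_cancel] at this
      exact this.trans (add_le_add_left hAB _)
    have h3 := ENNReal.toReal_mono (ENNReal.add_ne_top.2 ⟨ENNReal.ofReal_ne_top, hB⟩) h2
    rwa [ENNReal.toReal_add ENNReal.ofReal_ne_top hB, ENNReal.toReal_ofReal hC] at h3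
  rw [abs_le]
  have h4 := h1 X Y hX hY h
  have h5 := h1 Y X hY hX (by rw [← traceNorm_neg, neg_sub]; exact h)
  constructor <;> linarith

theorem norm_sum_inner_mul_inner_le (x y : Ltwo I) (A : Finset I) :
    ‖∑ i ∈ A, inner ℂ (ket i) x * inner ℂ y (ket i)‖ ≤ ‖x‖ * ‖y‖ := by
  have hb : ∀ z : Ltwo I, √(∑ i ∈ A, ‖inner ℂ (ket i) z‖ ^ 2) ≤ ‖z‖ := fun z => by
    refine Real.sqrt_le_iff.2 ⟨norm_nonneg _, ?_⟩
    simp only [inner_ket_left]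
    exact sum_le_hasSum A (fun _ _ => sq_nonneg _) (hasSum_norm_sq_apply z)
  calc _ ≤ ∑ i ∈ A, ‖inner ℂ (ket i) x‖ * ‖inner ℂ (ket i) y‖ := by
        refine (norm_sum_le _ _).trans (Finset.sum_le_sum fun i _ => ?_)
        rw [norm_mul, norm_inner_symm y]
    _ ≤ √(∑ i ∈ A, ‖inner ℂ (ket i) x‖ ^ 2) * √(∑ i ∈ A, ‖inner ℂ (ket i) y‖ ^ 2) :=
        Real.sum_mul_le_sqrt_mul_sqrt _ _ _
    _ ≤ _ := mul_le_mul (hb x) (hb y) (Real.sqrt_nonneg _) (norm_nonneg _)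

/-- The finite-section functional L is continuous in operator norm, so it passes through the sum; on
each rank-one term it is bounded by Cauchy–Schwarz and Bessel. -/
theorem traceNorm_le_of_hasSum_ketbra {J : Type*} {x y : J → Ltwo I}
    {X : Ltwo I →L[ℂ] Ltwo I} (hX : HasSum (fun j => ketbra (x j) (y j)) X)
    (hs : Summable fun j => ‖x j‖ * ‖y j‖) :
    traceNorm X ≤ ENNReal.ofReal (∑' j, ‖x j‖ * ‖y j‖) := by
  refine traceNorm_le_of_forall fun W A hW => ENNReal.ofReal_le_ofReal ?_
  let L : (Ltwo I →L[ℂ] Ltwo I) →L[ℂ] ℂ :=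
    ∑ i ∈ A, (innerSL ℂ (ket i)) ∘L W ∘L (ContinuousLinearMap.apply ℂ (Ltwo I) (ket i))
  have hL : ∀ T, L T = ∑ i ∈ A, inner ℂ (ket i) (W (T (ket i))) := fun T => by
    simp [L]
  have h1 := hX.mapL L
  have h2 : ∀ j, ‖L (ketbra (x j) (y j))‖ ≤ ‖x j‖ * ‖y j‖ := fun j => by
    rw [hL]
    have : ∀ i, inner ℂ (ket i) (W (ketbra (x j) (y j) (ket i))) =
        inner ℂ (ket i) (W (x j)) * inner ℂ (y j) (ket i) := fun i => by
      rw [ketbra, InnerProductSpace.rankOne_apply, map_smul, inner_smul_right, mul_comm]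
    simp only [this]
    refine (norm_sum_inner_mul_inner_le _ _ A).trans ?_
    gcongr
    exact (ContinuousLinearMap.le_of_opNorm_le _ hW _).trans (one_mul _).le
  rw [← Complex.re_sum, ← hL, ← h1.tsum_eq]
  exact (Complex.re_le_norm _).trans (tsum_of_norm_bounded hs.hasSum h2)

/-- A diagonal entry of |X| is at most ‖|X| i‖ = ‖X i‖, and only |A| of them are nonzero;
Cauchy–Schwarz does the rest. -/
theorem traceNorm_le_sqrt_card_mul {X : Ltwo I →L[ℂ] Ltwo I} {A : Finset I}
    (hA : ∀ i ∉ A, X (ket i) = 0) :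
    traceNorm X ≤ ENNReal.ofReal (√(A.card * ∑ i ∈ A, ‖X (ket i)‖ ^ 2)) := by
  have h0 : ∀ i ∉ A, ENNReal.ofReal (inner ℂ (ket i) (opAbs X (ket i))).re = 0 := by
    intro i hi
    have : opAbs X (ket i) = 0 := by
      rw [← norm_eq_zero, norm_opAbs_apply, hA i hi, norm_zero]
    simp [this]
  have hpos : ∀ i : I, 0 ≤ (inner ℂ (ket i) (opAbs X (ket i))).re :=
    fun i => (opAbs_isPositive X).re_inner_nonneg_right (ket i)
  unfold traceNorm
  rw [tsum_eq_sum (s := A) h0, ← ENNReal.ofReal_sum_of_nonneg fun i _ => hpos i]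
  refine ENNReal.ofReal_le_ofReal (Real.le_sqrt_of_sq_le ?_)
  have h1 : ∑ i ∈ A, (inner ℂ (ket i) (opAbs X (ket i))).re ≤ ∑ i ∈ A, ‖X (ket i)‖ := by
    refine Finset.sum_le_sum fun i _ => ?_
    rw [← norm_opAbs_apply]
    refine (Complex.re_le_norm _).trans ((norm_inner_le_norm _ _).trans ?_)
    rw [norm_ket, one_mul]
  calc _ ≤ (∑ i ∈ A, ‖X (ket i)‖) ^ 2 :=
        pow_le_pow_left₀ (Finset.sum_nonneg fun i _ => hpos i) h1 2
    _ ≤ _ := sq_sum_le_card_mul_sum_sq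

end TraceNorm

theorem ofReal_sum_le {J : Type*} {f : J → ℝ} (s : Finset J) :
    ENNReal.ofReal (∑ j ∈ s, f j) ≤ ∑ j ∈ s, ENNReal.ofReal (f j) := by
  classical
  induction s using Finset.induction_on with
  | empty => simp
  | insert a s ha ih =>
    rw [Finset.sum_insert ha, Finset.sum_insert ha]
    exact ENNReal.ofReal_add_le.trans (add_le_add_right ih _)

theorem traceNorm_le_tsum_of_hasSum {I J : Type*} [DecidableEq I] {f : J → Ltwo I →L[ℂ] Ltwo I}
    {X : Ltwo I →L[ℂ] Ltwo I} (hX : HasSum f X) : traceNorm X ≤ ∑' j, traceNorm (f j) := by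
  refine traceNorm_le_of_forall fun W A hW => ?_
  let L : (Ltwo I →L[ℂ] Ltwo I) →L[ℂ] ℂ :=
    ∑ i ∈ A, (innerSL ℂ (ket i)) ∘L W ∘L (ContinuousLinearMap.apply ℂ (Ltwo I) (ket i))
  have hL : ∀ T, L T = ∑ i ∈ A, inner ℂ (ket i) (W (T (ket i))) := fun T => by simp [L]
  have hre : ∀ T, ENNReal.ofReal (L T).re ≤ traceNorm T := fun T => by
    rw [hL, Complex.re_sum]
    exact sum_re_inner_le_traceNorm T hW A
  have h1 := hX.mapL L
  have h2 : Tendsto (fun s : Finset J => ENNReal.ofReal (∑ j ∈ s, L (f j)).re) atTop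
      (𝓝 (ENNReal.ofReal (L X).re)) :=
    (ENNReal.continuous_ofReal.tendsto _).comp ((Complex.continuous_re.tendsto _).comp h1)
  rw [← Complex.re_sum, ← hL]
  refine le_of_tendsto h2 (Eventually.of_forall fun s => ?_)
  rw [Complex.re_sum]
  exact (ofReal_sum_le s).trans
    ((Finset.sum_le_sum fun j _ => hre (f j)).trans (ENNReal.sum_le_tsum s))

/-! ### Algebra of rank-one operators -/

section Ketbra

variable {I : Type*}

theorem ketbra_apply (x y z : Ltwo I) : ketbra x y z = inner ℂ y z • x := rfl

theorem norm_ketbra (x y : Ltwo I) : ‖ketbra x y‖ = ‖x‖ * ‖y‖ :=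
  InnerProductSpace.norm_rankOne x y

theorem ketbra_add_left (x x' y : Ltwo I) : ketbra (x + x') y = ketbra x y + ketbra x' y := by
  simp [ketbra]

theorem ketbra_add_right (x y y' : Ltwo I) : ketbra x (y + y') = ketbra x y + ketbra x y' := by
  simp [ketbra]

theorem ketbra_smul_left (c : ℂ) (x y : Ltwo I) : ketbra (c • x) y = c • ketbra x y := by
  simp [ketbra]

theorem ketbra_smul_right (c : ℂ) (x y : Ltwo I) :
    ketbra x (c • y) = (starRingEnd ℂ) c • ketbra x y := by
  simp [ketbra]

theorem ketbra_sum_left {J : Type*} (s : Finset J) (x : J → Ltwo I) (y : Ltwo I) :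
    ketbra (∑ j ∈ s, x j) y = ∑ j ∈ s, ketbra (x j) y := by
  simp [ketbra]

theorem ketbra_sum_right {J : Type*} (s : Finset J) (x : Ltwo I) (y : J → Ltwo I) :
    ketbra x (∑ j ∈ s, y j) = ∑ j ∈ s, ketbra x (y j) := by
  simp [ketbra]

theorem ketbra_self_sub (x y : Ltwo I) :
    ketbra x x - ketbra y y = ketbra (x - y) x + ketbra y (x - y) := by
  simp only [ketbra, map_sub, sub_apply]
  abel

theorem norm_ketbra_self_sub_le (x y : Ltwo I) :
    ‖ketbra x x - ketbra y y‖ ≤ (‖x‖ + ‖y‖) * ‖x - y‖ := by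
  rw [ketbra_self_sub]
  refine (norm_add_le _ _).trans (le_of_eq ?_)
  rw [norm_ketbra, norm_ketbra]
  ring

theorem comp_ketbra_comp {I' : Type*} (L : Ltwo I →L[ℂ] Ltwo I') (x y : Ltwo I) :
    L ∘L ketbra x y ∘L ContinuousLinearMap.adjoint L = ketbra (L x) (L y) := by
  ext1 z
  simp only [ContinuousLinearMap.comp_apply, ketbra_apply, map_smul,
    ContinuousLinearMap.adjoint_inner_right]

end Ketbra

/-! ### Partial trace of sums of rank-one operators -/

section PartialTrace

variable {N : ℕ} (S : Finset (Fin N))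

theorem slice_apply (m : {i // i ∉ S} → ℕ) (x : Fock N) (a : {i // i ∈ S} → ℕ) :
    slice S m x a = x (glue S a m) := rfl

/-- Parseval, with the occupation numbers outside S summed last. -/
theorem hasSum_norm_slice_sq (x : Fock N) : HasSum (fun m => ‖slice S m x‖ ^ 2) (‖x‖ ^ 2) := by
  have h1 := hasSum_norm_sq_apply x
  rw [← (Equiv.piEquivPiSubtypeProd (fun i => i ∈ S) (fun _ => ℕ)).symm.hasSum_iff,
    ← (Equiv.prodComm ({i // i ∉ S} → ℕ) ({i // i ∈ S} → ℕ)).hasSum_iff] at h1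
  exact h1.prod_fiberwise fun m => hasSum_norm_sq_apply (slice S m x)

theorem summable_norm_slice_mul (x y : Fock N) :
    Summable (fun m => ‖slice S m x‖ * ‖slice S m y‖) ∧
      ∑' m, ‖slice S m x‖ * ‖slice S m y‖ ≤ ‖x‖ * ‖y‖ :=
  summable_mul_of_hasSum_sq (fun _ => norm_nonneg _) (fun _ => norm_nonneg _) (norm_nonneg _)
    (norm_nonneg _) (hasSum_norm_slice_sq S x) (hasSum_norm_slice_sq S y)

/-- The partial trace is an unconditional sum in operator norm, which has the default value 0 unless
it converges. Cauchy–Schwarz over the slices makes the double family absolutely summable, so the sum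
is genuine and can be reordered. -/
theorem hasSum_partialTrace {J : Type*} {x y : J → Fock N} {T : Fock N →L[ℂ] Fock N}
    (hT : HasSum (fun j => ketbra (x j) (y j)) T) (hs : Summable fun j => ‖x j‖ * ‖y j‖) :
    HasSum (fun p : ({i // i ∉ S} → ℕ) × J => ketbra (slice S p.1 (x p.2)) (slice S p.1 (y p.2)))
      (partialTrace S T) := by
  have hsum : Summable fun p : J × ({i // i ∉ S} → ℕ) =>
      ‖slice S p.2 (x p.1)‖ * ‖slice S p.2 (y p.1)‖ := by
    refine (summable_prod_of_nonneg fun p => by positivity).2 ⟨fun j =>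
      (summable_norm_slice_mul S (x j) (y j)).1, ?_⟩
    exact hs.of_nonneg_of_le (fun j => tsum_nonneg fun m => by positivity)
      fun j => (summable_norm_slice_mul S (x j) (y j)).2
  have hsum' : Summable fun p : ({i // i ∉ S} → ℕ) × J =>
      ketbra (slice S p.1 (x p.2)) (slice S p.1 (y p.2)) := by
    refine Summable.of_norm ?_
    simp only [norm_ketbra]
    exact ((Equiv.prodComm ({i // i ∉ S} → ℕ) J).summable_iff).2 hsum
  obtain ⟨X, hX⟩ := hsum'
  have hfib : ∀ m, HasSum (fun j => ketbra (slice S m (x j)) (slice S m (y j)))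
      (slice S m ∘L T ∘L ContinuousLinearMap.adjoint (slice S m)) := by
    intro m
    have h1 := hT.mapL ((ContinuousLinearMap.compL ℂ (SubFock S) (Fock N) (SubFock S)
      (slice S m)).comp ((ContinuousLinearMap.compL ℂ (SubFock S) (Fock N) (Fock N)).flip
        (ContinuousLinearMap.adjoint (slice S m))))
    convert h1 using 1
    · ext1 j
      exact (comp_ketbra_comp (slice S m) (x j) (y j)).symm
    · rfl
  have h2 := hX.prod_fiberwise hfib
  have h3 : partialTrace S T = X := h2.tsum_eq
  rw [h3]
  exact hX

theorem hasSum_partialTrace_ketbra (x y : Fock N) :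
    HasSum (fun m => ketbra (slice S m x) (slice S m y)) (partialTrace S (ketbra x y)) := by
  have h := hasSum_partialTrace S (J := Unit) (x := fun _ => x) (y := fun _ => y)
    (hasSum_unique _) Summable.of_finite
  exact h.prod_fiberwise fun m => hasSum_unique _

theorem hasSum_partialTrace_of_hasSum {J : Type*} {x y : J → Fock N} {T : Fock N →L[ℂ] Fock N}
    (hT : HasSum (fun j => ketbra (x j) (y j)) T) (hs : Summable fun j => ‖x j‖ * ‖y j‖) :
    HasSum (fun j => partialTrace S (ketbra (x j) (y j))) (partialTrace S T) := by
  have h := hasSum_partialTrace S hT hs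
  rw [← (Equiv.prodComm J ({i // i ∉ S} → ℕ)).hasSum_iff] at h
  exact h.prod_fiberwise fun j => hasSum_partialTrace_ketbra S (x j) (y j)

theorem traceNorm_partialTrace_ketbra_le (x y : Fock N) :
    traceNorm (partialTrace S (ketbra x y)) ≤ ENNReal.ofReal (‖x‖ * ‖y‖) :=
  (traceNorm_le_of_hasSum_ketbra (hasSum_partialTrace_ketbra S x y)
    (summable_norm_slice_mul S x y).1).trans
    (ENNReal.ofReal_le_ofReal (summable_norm_slice_mul S x y).2)

theorem partialTrace_ketbra_add_left (x x' y : Fock N) :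
    partialTrace S (ketbra (x + x') y) =
      partialTrace S (ketbra x y) + partialTrace S (ketbra x' y) := by
  refine (hasSum_partialTrace_ketbra S (x + x') y).unique ?_
  convert (hasSum_partialTrace_ketbra S x y).add (hasSum_partialTrace_ketbra S x' y) using 2
  rw [map_add, ketbra_add_left]

theorem partialTrace_ketbra_add_right (x y y' : Fock N) :
    partialTrace S (ketbra x (y + y')) =
      partialTrace S (ketbra x y) + partialTrace S (ketbra x y') := by
  refine (hasSum_partialTrace_ketbra S x (y + y')).unique ?_
  convert (hasSum_partialTrace_ketbra S x y).add (hasSum_partialTrace_ketbra S x y') using 2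
  rw [map_add, ketbra_add_right]

theorem partialTrace_ketbra_self_sub (x y : Fock N) :
    partialTrace S (ketbra x x) - partialTrace S (ketbra y y) =
      partialTrace S (ketbra (x - y) x) + partialTrace S (ketbra y (x - y)) := by
  have h1 := partialTrace_ketbra_add_left S (x - y) y x
  have h2 := partialTrace_ketbra_add_right S y (x - y) y
  rw [sub_add_cancel] at h1 h2
  rw [h1, h2]
  abel

theorem traceNorm_partialTrace_ketbra_self_sub_le (x y : Fock N) :
    traceNorm (partialTrace S (ketbra x x) - partialTrace S (ketbra y y)) ≤
      ENNReal.ofReal ((‖x‖ + ‖y‖) * ‖x - y‖) := by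
  rw [partialTrace_ketbra_self_sub]
  refine (traceNorm_add_le _ _).trans ?_
  refine (add_le_add (traceNorm_partialTrace_ketbra_le S _ _)
    (traceNorm_partialTrace_ketbra_le S _ _)).trans (le_of_eq ?_)
  rw [← ENNReal.ofReal_add (by positivity) (by positivity)]
  congr 1
  ring

end PartialTrace

/-! ### Basis projections -/

section Cutoff

open ContinuousLinearMap (adjoint)

theorem proj_apply {I : Type*} [DecidableEq I] (A : Finset I) (x : Ltwo I) (i : I) :
    proj A x i = if i ∈ A then x i else 0 := by
  have h : proj A x = ∑ j ∈ A, x j • (ket j : Ltwo I) := by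
    simp only [proj, sum_apply, ketbra_apply, inner_ket_left]
  rw [h, ← inner_ket_left i (∑ j ∈ A, x j • ket j), inner_sum]
  simp only [inner_smul_right, inner_ket_left]
  have h2 : ∀ j, (ket j : Ltwo I) i = if i = j then 1 else 0 := fun j => by
    rw [ket, lp.single_apply]
    split_ifs with h <;> simp_all
  simp [h2]

theorem adjoint_proj {I : Type*} [DecidableEq I] (A : Finset I) : adjoint (proj A) = proj A := by
  simp [proj, ketbra, map_sum]

theorem norm_sq_proj_apply {I : Type*} [DecidableEq I] (A : Finset I) (x : Ltwo I) :
    ‖proj A x‖ ^ 2 = ∑ i ∈ A, ‖x i‖ ^ 2 := by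
  refine (hasSum_norm_sq_apply (proj A x)).unique ?_
  have : (fun i => ‖proj A x i‖ ^ 2) = fun i => if i ∈ A then ‖x i‖ ^ 2 else 0 := by
    ext i
    rw [proj_apply]
    split_ifs <;> simp
  rw [this]
  have h := hasSum_sum_of_ne_finset_zero (L := SummationFilter.unconditional _)
    (f := fun i => if i ∈ A then ‖x i‖ ^ 2 else 0) (s := A)
    fun i hi => by simp [hi]
  convert h using 1
  exact Finset.sum_congr rfl fun i hi => by simp [hi]

theorem norm_sq_proj_add {I : Type*} [DecidableEq I] (A : Finset I) (x : Ltwo I) :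
    ‖proj A x‖ ^ 2 + ‖x - proj A x‖ ^ 2 = ‖x‖ ^ 2 := by
  have h := ((hasSum_norm_sq_apply (proj A x)).add (hasSum_norm_sq_apply (x - proj A x)))
  refine h.unique ?_
  convert hasSum_norm_sq_apply x using 2 with i
  rw [lp.coeFn_sub, Pi.sub_apply, proj_apply]
  split_ifs <;> simp

theorem norm_proj_apply_le {I : Type*} [DecidableEq I] (A : Finset I) (x : Ltwo I) :
    ‖proj A x‖ ≤ ‖x‖ := by
  have := norm_sq_proj_add A x
  exact (pow_le_pow_iff_left₀ (norm_nonneg _) (norm_nonneg _) two_ne_zero).1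
    (by nlinarith [sq_nonneg ‖x - proj A x‖])

end Cutoff

section

open ContinuousLinearMap (adjoint)

/-! ### Finite matrices and the Hilbert–Schmidt norm -/

section Matrices

variable {I : Type*} [DecidableEq I]

theorem ket_apply (i j : I) : (ket i : Ltwo I) j = if i = j then 1 else 0 := by
  rw [ket, lp.single_apply]
  split_ifs <;> simp_all

theorem orthonormal_ket : Orthonormal ℂ (ket : I → Ltwo I) := by
  rw [orthonormal_iff_ite]
  intro i j
  rw [inner_ket_left, ket_apply]
  simp [eq_comm]

/-- The matrix of an operator with respect to the basis vectors in `A`. -/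
noncomputable def matrixOn (A : Finset I) : (Ltwo I →L[ℂ] Ltwo I) →L[ℂ] EuclideanSpace ℂ (A × A) :=
  (EuclideanSpace.equiv (A × A) ℂ).symm.toContinuousLinearMap ∘L
    ContinuousLinearMap.pi fun p : A × A =>
      innerSL ℂ (ket p.1.1) ∘L ContinuousLinearMap.apply ℂ (Ltwo I) (ket p.2.1 : Ltwo I)

theorem matrixOn_apply (A : Finset I) (X : Ltwo I →L[ℂ] Ltwo I) (p : A × A) :
    matrixOn A X p = X (ket p.2.1) p.1.1 := by
  rw [← inner_ket_left]
  rfl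

theorem norm_sq_matrixOn (A : Finset I) (X : Ltwo I →L[ℂ] Ltwo I) :
    ‖matrixOn A X‖ ^ 2 = ∑ i ∈ A, ∑ j ∈ A, ‖X (ket j) i‖ ^ 2 := by
  rw [EuclideanSpace.norm_sq_eq, Fintype.sum_prod_type]
  simp only [matrixOn_apply]
  rw [← Finset.sum_coe_sort A (fun i => ∑ j ∈ A, ‖X (ket j) i‖ ^ 2)]
  refine Finset.sum_congr rfl fun i _ => ?_
  exact Finset.sum_coe_sort A (fun j => ‖X (ket j) i.1‖ ^ 2)

theorem sum_norm_sq_apply_ket {A : Finset I} {X : Ltwo I →L[ℂ] Ltwo I}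
    (h : ∀ x, ∀ i ∉ A, X x i = 0) : ∑ j ∈ A, ‖X (ket j)‖ ^ 2 = ‖matrixOn A X‖ ^ 2 := by
  rw [norm_sq_matrixOn, Finset.sum_comm]
  refine Finset.sum_congr rfl fun j _ => ?_
  refine (hasSum_norm_sq_apply _).unique ?_
  exact hasSum_sum_of_ne_finset_zero fun i hi => by simp [h (ket j) i hi]

/-- For an operator living on the block A, the Euclidean norm of the matrix is the Hilbert–Schmidt
norm. This moves averages and variances to a finite-dimensional Hilbert space. -/
theorem traceNorm_le_sqrt_mul_norm_matrixOn {A : Finset I} {X : Ltwo I →L[ℂ] Ltwo I}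
    (h1 : ∀ j ∉ A, X (ket j) = 0) (h2 : ∀ x, ∀ i ∉ A, X x i = 0) :
    traceNorm X ≤ ENNReal.ofReal (√A.card * ‖matrixOn A X‖) := by
  refine (traceNorm_le_sqrt_card_mul h1).trans (le_of_eq ?_)
  rw [sum_norm_sq_apply_ket h2, Real.sqrt_mul (by positivity), Real.sqrt_sq (norm_nonneg _)]

theorem re_trace_comp_self {A : Finset I} {X : Ltwo I →L[ℂ] Ltwo I}
    (h1 : ∀ j ∉ A, X (ket j) = 0) (h2 : ∀ x, ∀ i ∉ A, X x i = 0) (hX : adjoint X = X) :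
    (trace (X ∘L X)).re = ‖matrixOn A X‖ ^ 2 := by
  unfold trace
  rw [tsum_eq_sum (s := A) fun j hj => by simp [h1 j hj], Complex.re_sum,
    ← sum_norm_sq_apply_ket h2]
  refine Finset.sum_congr rfl fun j _ => ?_
  rw [ContinuousLinearMap.comp_apply, ← ContinuousLinearMap.adjoint_inner_left, hX]
  exact inner_self_eq_norm_sq (𝕜 := ℂ) _

end Matrices

/-! ### The truncated reduction as a finite matrix -/

section Truncation

variable {N : ℕ} (F : FreeTheory N) (S : Finset (Fin N)) (Λ : ℝ)

/-- The occupation numbers of the modes in `S` that occur below the cutoff. -/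
noncomputable def innerModes : Finset ({i // i ∈ S} → ℕ) :=
  (F.below Λ).image fun n i => n i

/-- The occupation numbers of the modes outside `S` that occur below the cutoff. -/
noncomputable def outerModes : Finset ({i // i ∉ S} → ℕ) :=
  (F.below Λ).image fun n i => n i

theorem card_innerModes : (innerModes F S Λ).card = F.dSub S Λ := rfl

theorem mem_innerModes {a : {i // i ∈ S} → ℕ} {m : {i // i ∉ S} → ℕ}
    (h : glue S a m ∈ F.below Λ) : a ∈ innerModes F S Λ := by
  refine Finset.mem_image.2 ⟨_, h, ?_⟩
  ext i
  simp [glue, i.2]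

theorem mem_outerModes {a : {i // i ∈ S} → ℕ} {m : {i // i ∉ S} → ℕ}
    (h : glue S a m ∈ F.below Λ) : m ∈ outerModes F S Λ := by
  refine Finset.mem_image.2 ⟨_, h, ?_⟩
  ext i
  simp [glue, i.2]

/-- `⟨m| P^Λ`. -/
noncomputable def cutSlice (m : {i // i ∉ S} → ℕ) : Fock N →L[ℂ] SubFock S :=
  slice S m ∘L F.cutoffProj Λ

theorem cutSlice_apply (m : {i // i ∉ S} → ℕ) (x : Fock N) (a : {i // i ∈ S} → ℕ) :
    cutSlice F S Λ m x a = if glue S a m ∈ F.below Λ then x (glue S a m) else 0 := by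
  rw [cutSlice, ContinuousLinearMap.comp_apply, slice_apply]
  exact proj_apply _ _ _

theorem cutSlice_eq_zero {m : {i // i ∉ S} → ℕ} (hm : m ∉ outerModes F S Λ) :
    cutSlice F S Λ m = 0 := by
  ext x a
  rw [cutSlice_apply, if_neg fun h => hm (mem_outerModes F S Λ h)]
  rfl

theorem adjoint_cutSlice_ket (m : {i // i ∉ S} → ℕ) (a : {i // i ∈ S} → ℕ) :
    adjoint (cutSlice F S Λ m) (ket a) =
      if glue S a m ∈ F.below Λ then ket (glue S a m) else 0 := by
  ext n
  rw [← inner_ket_left, ContinuousLinearMap.adjoint_inner_right, ← inner_conj_symm,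
    inner_ket_left, cutSlice_apply]
  split_ifs
  · rw [ket_apply, ket_apply]
    simp [eq_comm]
  · simp

/-- The truncated reduction as a bounded linear map. -/
noncomputable def truncReducedCLM :
    (Fock N →L[ℂ] Fock N) →L[ℂ] (SubFock S →L[ℂ] SubFock S) :=
  ∑ m ∈ outerModes F S Λ,
    (ContinuousLinearMap.compL ℂ (SubFock S) (Fock N) (SubFock S) (cutSlice F S Λ m)).comp
      ((ContinuousLinearMap.compL ℂ (SubFock S) (Fock N) (Fock N)).flip
        (adjoint (cutSlice F S Λ m)))

theorem truncReducedCLM_apply (T : Fock N →L[ℂ] Fock N) :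
    truncReducedCLM F S Λ T = ∑ m ∈ outerModes F S Λ,
      cutSlice F S Λ m ∘L T ∘L adjoint (cutSlice F S Λ m) := by
  rw [truncReducedCLM, sum_apply]
  rfl

/-- Only finitely many configurations outside S occur below the cutoff, so the partial trace is a
finite sum and hence continuous and linear in T. -/
theorem truncReduced_eq (T : Fock N →L[ℂ] Fock N) :
    F.truncReduced S Λ T = truncReducedCLM F S Λ T := by
  have h : ∀ m, slice S m ∘L (F.cutoffProj Λ ∘L T ∘L F.cutoffProj Λ) ∘L adjoint (slice S m) =
      cutSlice F S Λ m ∘L T ∘L adjoint (cutSlice F S Λ m) := fun m => by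
    rw [cutSlice, ContinuousLinearMap.adjoint_comp, FreeTheory.cutoffProj, adjoint_proj]
    rfl
  rw [truncReducedCLM_apply, FreeTheory.truncReduced, partialTrace]
  simp only [h]
  refine tsum_eq_sum fun m hm => ?_
  rw [cutSlice_eq_zero F S Λ hm, ContinuousLinearMap.zero_comp]

theorem truncReduced_ketbra (x y : Fock N) :
    F.truncReduced S Λ (ketbra x y) =
      partialTrace S (ketbra (F.cutoffProj Λ x) (F.cutoffProj Λ y)) := by
  rw [FreeTheory.truncReduced, ← comp_ketbra_comp, FreeTheory.cutoffProj, adjoint_proj]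

theorem truncReducedCLM_ketbra (x y : Fock N) :
    truncReducedCLM F S Λ (ketbra x y) = ∑ m ∈ outerModes F S Λ,
      ketbra (cutSlice F S Λ m x) (cutSlice F S Λ m y) := by
  simp only [truncReducedCLM_apply, comp_ketbra_comp]

theorem truncReducedCLM_ket (T : Fock N →L[ℂ] Fock N) {a : {i // i ∈ S} → ℕ}
    (ha : a ∉ innerModes F S Λ) : truncReducedCLM F S Λ T (ket a) = 0 := by
  rw [truncReducedCLM_apply, sum_apply]
  refine Finset.sum_eq_zero fun m _ => ?_
  rw [ContinuousLinearMap.comp_apply, ContinuousLinearMap.comp_apply, adjoint_cutSlice_ket,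
    if_neg fun h => ha (mem_innerModes F S Λ h), map_zero, map_zero]

theorem subFock_sum_apply {J : Type*} (s : Finset J) (f : J → SubFock S) (a : {i // i ∈ S} → ℕ) :
    (∑ j ∈ s, f j) a = ∑ j ∈ s, f j a := by
  rw [lp.coeFn_sum, Finset.sum_apply]

theorem truncReducedCLM_apply_apply (T : Fock N →L[ℂ] Fock N) (x : SubFock S)
    {a : {i // i ∈ S} → ℕ} (ha : a ∉ innerModes F S Λ) : truncReducedCLM F S Λ T x a = 0 := by
  rw [truncReducedCLM_apply, sum_apply, subFock_sum_apply]
  refine Finset.sum_eq_zero fun m _ => ?_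
  rw [ContinuousLinearMap.comp_apply, cutSlice_apply,
    if_neg fun h => ha (mem_innerModes F S Λ h)]

/-- The matrix of the truncated reduction of an operator. -/
noncomputable def reducedMatrix :
    (Fock N →L[ℂ] Fock N) →L[ℂ] EuclideanSpace ℂ (innerModes F S Λ × innerModes F S Λ) :=
  matrixOn (innerModes F S Λ) ∘L truncReducedCLM F S Λ

theorem traceNorm_truncReducedCLM_le (T : Fock N →L[ℂ] Fock N) :
    traceNorm (truncReducedCLM F S Λ T) ≤
      ENNReal.ofReal (√(F.dSub S Λ) * ‖reducedMatrix F S Λ T‖) :=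
  traceNorm_le_sqrt_mul_norm_matrixOn (fun _ => truncReducedCLM_ket F S Λ T)
    fun x _ => truncReducedCLM_apply_apply F S Λ T x

theorem re_trace_truncReducedCLM_comp_self (x : Fock N) :
    (trace (truncReducedCLM F S Λ (ketbra x x) ∘L truncReducedCLM F S Λ (ketbra x x))).re =
      ‖reducedMatrix F S Λ (ketbra x x)‖ ^ 2 := by
  refine re_trace_comp_self (fun _ => truncReducedCLM_ket F S Λ _)
    (fun x _ => truncReducedCLM_apply_apply F S Λ _ x) ?_
  rw [truncReducedCLM_ketbra]
  simp [ketbra, map_sum]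

theorem reducedMatrix_ketbra_apply (x y : Fock N) (p : innerModes F S Λ × innerModes F S Λ) :
    reducedMatrix F S Λ (ketbra x y) p = ∑ m ∈ outerModes F S Λ,
      cutSlice F S Λ m x p.1 * (starRingEnd ℂ) (cutSlice F S Λ m y p.2) := by
  rw [reducedMatrix, ContinuousLinearMap.comp_apply, matrixOn_apply, truncReducedCLM_ketbra,
    sum_apply, subFock_sum_apply]
  refine Finset.sum_congr rfl fun m _ => ?_
  rw [ketbra_apply, lp.coeFn_smul, Pi.smul_apply, smul_eq_mul, ← inner_conj_symm, inner_ket_left,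
    mul_comm]

/-- Exchanging x and y replaces the matrix by its conjugate transpose. -/
theorem norm_reducedMatrix_ketbra_comm (x y : Fock N) :
    ‖reducedMatrix F S Λ (ketbra x y)‖ = ‖reducedMatrix F S Λ (ketbra y x)‖ := by
  rw [EuclideanSpace.norm_eq, EuclideanSpace.norm_eq]
  congr 1
  rw [← (Equiv.prodComm (innerModes F S Λ) (innerModes F S Λ)).sum_comp]
  refine Finset.sum_congr rfl fun p _ => ?_
  rw [reducedMatrix_ketbra_apply, reducedMatrix_ketbra_apply, ← Complex.norm_conj, map_sum]
  congr 2
  refine Finset.sum_congr rfl fun m _ => ?_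
  simp [mul_comm]

/-- The vector `w` with `⟨y, w⟩` a given entry of the reduced matrix of `|x⟩⟨y|`. -/
noncomputable def entryVector (x : Fock N) (p : innerModes F S Λ × innerModes F S Λ) : Fock N :=
  ∑ m ∈ outerModes F S Λ, (if glue S p.2.1 m ∈ F.below Λ then cutSlice F S Λ m x p.1 else 0) •
    ket (glue S p.2.1 m)

theorem reducedMatrix_ketbra_apply_eq_inner (x y : Fock N)
    (p : innerModes F S Λ × innerModes F S Λ) :
    reducedMatrix F S Λ (ketbra x y) p = inner ℂ y (entryVector F S Λ x p) := by
  rw [reducedMatrix_ketbra_apply, entryVector, inner_sum]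
  refine Finset.sum_congr rfl fun m _ => ?_
  rw [inner_smul_right, ← inner_conj_symm, inner_ket_left, cutSlice_apply F S Λ m y]
  split_ifs <;> simp

theorem norm_sq_entryVector_le (x : Fock N) (p : innerModes F S Λ × innerModes F S Λ) :
    ‖entryVector F S Λ x p‖ ^ 2 ≤ ∑ m ∈ outerModes F S Λ, ‖cutSlice F S Λ m x p.1‖ ^ 2 := by
  have ho : Orthonormal ℂ fun m => (ket (glue S p.2.1 m) : Fock N) := by
    refine orthonormal_ket.comp _ fun m m' h => ?_
    have h' := (Equiv.piEquivPiSubtypeProd (fun i => i ∈ S) (fun _ => ℕ)).symm.injective h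
    exact (Prod.mk.inj h').2
  rw [← inner_self_eq_norm_sq (𝕜 := ℂ), entryVector, ho.inner_sum, map_sum]
  refine Finset.sum_le_sum fun m _ => ?_
  rw [← Complex.normSq_eq_conj_mul_self]
  change (((Complex.normSq _ : ℝ) : ℂ)).re ≤ _
  rw [Complex.ofReal_re, Complex.normSq_eq_norm_sq]
  split_ifs
  · exact le_rfl
  · simp

/-- Each matrix entry is an inner product ⟨b l, w⟩ with w independent of l, so Bessel removes the
sum over l. The squared norm of w does not grow with the column index, whose summation costs a
factor d_S; the row index and the slices add up to at most ‖x‖². -/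
theorem sum_norm_sq_reducedMatrix_ketbra_le {κ : Type*} {b : κ → Fock N} (hb : Orthonormal ℂ b)
    (s : Finset κ) (x : Fock N) :
    ∑ l ∈ s, ‖reducedMatrix F S Λ (ketbra x (b l))‖ ^ 2 ≤ F.dSub S Λ * ‖x‖ ^ 2 := by
  simp only [EuclideanSpace.norm_sq_eq, reducedMatrix_ketbra_apply_eq_inner]
  rw [Finset.sum_comm]
  calc _ ≤ ∑ p : innerModes F S Λ × innerModes F S Λ,
        ∑ m ∈ outerModes F S Λ, ‖cutSlice F S Λ m x p.1‖ ^ 2 :=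
        Finset.sum_le_sum fun p _ => (hb.sum_inner_products_le _).trans
          (norm_sq_entryVector_le F S Λ x p)
    _ = F.dSub S Λ * ∑ m ∈ outerModes F S Λ, ∑ a ∈ innerModes F S Λ,
          ‖cutSlice F S Λ m x a‖ ^ 2 := by
        rw [Fintype.sum_prod_type_right]
        simp only [Finset.sum_const, Finset.card_univ, Fintype.card_coe, card_innerModes,
          nsmul_eq_mul]
        rw [Finset.sum_coe_sort (innerModes F S Λ) (fun a => ∑ m ∈ outerModes F S Λ,
          ‖cutSlice F S Λ m x a‖ ^ 2), Finset.sum_comm]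
    _ ≤ F.dSub S Λ * ∑ m ∈ outerModes F S Λ, ‖slice S m (F.cutoffProj Λ x)‖ ^ 2 := by
        gcongr with m
        exact sum_le_hasSum _ (fun _ _ => sq_nonneg _) (hasSum_norm_sq_apply (cutSlice F S Λ m x))
    _ ≤ F.dSub S Λ * ‖F.cutoffProj Λ x‖ ^ 2 := by
        gcongr
        exact sum_le_hasSum _ (fun _ _ => sq_nonneg _) (hasSum_norm_slice_sq S _)
    _ ≤ _ := by
        gcongr
        exact norm_proj_apply_le _ _

end Truncation

end

/-! ### Vectors with rotated phases -/

section TorusState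

variable {κ 𝓗 : Type*} [NormedAddCommGroup 𝓗] [InnerProductSpace ℂ 𝓗] (b : HilbertBasis κ ℂ 𝓗)

/-- The component of `ψ` along a basis vector. -/
noncomputable def component (ψ : 𝓗) (k : κ) : 𝓗 := inner ℂ (b k) ψ • b k

theorem norm_component (ψ : 𝓗) (k : κ) : ‖component b ψ k‖ = ‖inner ℂ (b k) ψ‖ := by
  rw [component, norm_smul, b.orthonormal.1 k, mul_one]

theorem hasSum_component (ψ : 𝓗) : HasSum (component b ψ) ψ := by
  have := b.hasSum_repr ψ
  simp only [b.repr_apply_apply] at this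
  exact this

theorem hasSum_norm_component_sq (ψ : 𝓗) : HasSum (fun k => ‖component b ψ k‖ ^ 2) (‖ψ‖ ^ 2) := by
  have h := hasSum_norm_sq_apply (b.repr ψ)
  simp only [LinearIsometryEquiv.norm_map, b.repr_apply_apply] at h
  simpa only [norm_component] using h

theorem inner_component (ψ : 𝓗) (k l : κ) [DecidableEq κ] :
    inner ℂ (b l) (component b ψ k) = if l = k then inner ℂ (b k) ψ else 0 := by
  rw [component, inner_smul_right, orthonormal_iff_ite.1 b.orthonormal]
  simp

/-- The vector obtained from `ψ` by multiplying its coordinates with phases. -/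
noncomputable def torusState (ψ : 𝓗) (u : κ → Circle) : 𝓗 :=
  ∑' k, (u k : ℂ) • component b ψ k

theorem torusState_aux (ψ : 𝓗) (u : κ → Circle) :
    ∃ f : Ltwo κ, (∀ k, f k = (u k : ℂ) * inner ℂ (b k) ψ) ∧ ‖f‖ = ‖ψ‖ := by
  have hm : Memℓp (fun k => (u k : ℂ) * inner ℂ (b k) ψ) 2 := by
    refine memℓp_gen ?_
    have h := (hasSum_norm_component_sq b ψ).summable
    simpa [norm_component, Circle.norm_coe] using h
  refine ⟨⟨_, hm⟩, fun k => rfl, ?_⟩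
  have h1 := hasSum_norm_sq_apply (⟨_, hm⟩ : Ltwo κ)
  have h2 := hasSum_norm_component_sq b ψ
  simp only [norm_component] at h2
  simp only [norm_mul, Circle.norm_coe, one_mul] at h1
  exact (pow_left_inj₀ (norm_nonneg _) (norm_nonneg _) two_ne_zero).1 (h1.unique h2)

theorem hasSum_torusState (ψ : 𝓗) (u : κ → Circle) :
    HasSum (fun k => (u k : ℂ) • component b ψ k) (torusState b ψ u) := by
  obtain ⟨f, hf, -⟩ := torusState_aux b ψ u
  have h := b.hasSum_repr_symm f
  have : Summable fun k => (u k : ℂ) • component b ψ k := by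
    refine h.summable.congr fun k => ?_
    rw [hf, component, smul_smul]
  exact this.hasSum

theorem norm_torusState (ψ : 𝓗) (u : κ → Circle) : ‖torusState b ψ u‖ = ‖ψ‖ := by
  obtain ⟨f, hf, hfn⟩ := torusState_aux b ψ u
  have h := b.hasSum_repr_symm f
  have h2 : torusState b ψ u = b.repr.symm f := by
    refine (hasSum_torusState b ψ u).unique ?_
    convert h using 2 with k
    rw [hf, component, smul_smul]
  rw [h2, LinearIsometryEquiv.norm_map, hfn]

theorem component_sub (ψ φ : 𝓗) (k : κ) :
    component b (ψ - φ) k = component b ψ k - component b φ k := by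
  rw [component, component, component, inner_sub_right, sub_smul]

theorem torusState_sub (ψ φ : 𝓗) (u : κ → Circle) :
    torusState b ψ u - torusState b φ u = torusState b (ψ - φ) u := by
  refine HasSum.unique ((hasSum_torusState b ψ u).sub (hasSum_torusState b φ u)) ?_
  convert hasSum_torusState b (ψ - φ) u using 2 with k
  rw [component_sub, smul_sub]

theorem norm_torusState_sub (ψ φ : 𝓗) (u : κ → Circle) :
    ‖torusState b ψ u - torusState b φ u‖ = ‖ψ - φ‖ := by
  rw [torusState_sub, norm_torusState]

/-- The partial sums of the expansion of `ψ`. -/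
noncomputable def truncate (s : Finset κ) (ψ : 𝓗) : 𝓗 := ∑ k ∈ s, component b ψ k

theorem tendsto_truncate (ψ : 𝓗) : Tendsto (fun s => ‖ψ - truncate b s ψ‖) atTop (𝓝 0) := by
  have h : Tendsto (fun s => truncate b s ψ) atTop (𝓝 ψ) := hasSum_component b ψ
  simpa using (tendsto_const_nhds (x := ψ)).sub h |>.norm

theorem component_truncate [DecidableEq κ] (s : Finset κ) (ψ : 𝓗) (k : κ) :
    component b (truncate b s ψ) k = if k ∈ s then component b ψ k else 0 := by
  rw [component, truncate, inner_sum]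
  simp only [inner_component]
  rw [Finset.sum_ite_eq]
  split_ifs
  · rfl
  · rw [zero_smul]

theorem torusState_truncate (s : Finset κ) (ψ : 𝓗) (u : κ → Circle) :
    torusState b (truncate b s ψ) u = ∑ k ∈ s, (u k : ℂ) • component b ψ k := by
  classical
  refine (hasSum_torusState b _ u).unique ?_
  simp only [component_truncate]
  have h := hasSum_sum_of_ne_finset_zero (L := SummationFilter.unconditional _)
    (f := fun k => (u k : ℂ) • if k ∈ s then component b ψ k else 0) (s := s)
    fun k hk => by rw [if_neg hk, smul_zero]
  convert h using 1
  exact Finset.sum_congr rfl fun k hk => by rw [if_pos hk]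

theorem norm_truncate_le (s : Finset κ) (ψ : 𝓗) : ‖truncate b s ψ‖ ≤ ‖ψ‖ := by
  classical
  have h := hasSum_le (fun k => ?_) (hasSum_norm_component_sq b (truncate b s ψ))
    (hasSum_norm_component_sq b ψ)
  · exact (pow_le_pow_iff_left₀ (norm_nonneg _) (norm_nonneg _) two_ne_zero).1 h
  · rw [component_truncate]
    split_ifs
    · exact le_rfl
    · simp

/-- In the product topology finite truncations are clearly continuous, and they approximate
uniformly because changing phases preserves norms. -/
theorem continuous_torusState (ψ : 𝓗) : Continuous (torusState b ψ) := by
  refine continuous_of_uniform_approx_of_continuous fun V hV => ?_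
  obtain ⟨ε, hε, hV⟩ := Metric.mem_uniformity_dist.1 hV
  obtain ⟨s, hs⟩ := ((tendsto_truncate b ψ).eventually (gt_mem_nhds hε)).exists
  refine ⟨torusState b (truncate b s ψ), ?_, fun u => hV ?_⟩
  · simp only [funext (torusState_truncate b s ψ)]
    refine continuous_finsetSum _ fun k _ => Continuous.smul ?_ continuous_const
    fun_prop
  · rw [dist_eq_norm, norm_torusState_sub]
    exact hs

end TorusState

/-! ### The equilibrium state and its effective dimension -/

section Equilibrium

variable {N : ℕ} {κ : Type*} (b : HilbertBasis κ ℂ (Fock N)) (E : κ → ℝ) (ψ : Fock N)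

theorem evolve_eq_torusState (t : ℝ) : evolve b E ψ t = torusState b ψ (torusFlow E t) := by
  refine tsum_congr fun k => ?_
  rw [coe_torusFlow, component, smul_smul, oscillation]
  congr 3
  push_cast
  ring

theorem norm_evolve (t : ℝ) : ‖evolve b E ψ t‖ = ‖ψ‖ := by
  rw [evolve_eq_torusState, norm_torusState]

theorem continuous_evolve : Continuous (evolve b E ψ) := by
  simp only [funext (evolve_eq_torusState b E ψ)]
  exact (continuous_torusState b ψ).comp (continuous_torusFlow E)

theorem continuous_ketbra_self {I : Type*} : Continuous fun x : Ltwo I => ketbra x x := by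
  refine continuous_iff_continuousAt.2 fun y => tendsto_iff_norm_sub_tendsto_zero.2 ?_
  have hc : Continuous fun x : Ltwo I => (‖x‖ + ‖y‖) * ‖x - y‖ := by fun_prop
  refine squeeze_zero (fun _ => norm_nonneg _) (fun x => norm_ketbra_self_sub_le x y) ?_
  simpa using hc.tendsto y

theorem continuous_state : Continuous (state b E ψ) :=
  continuous_ketbra_self.comp (continuous_evolve b E ψ)

/-- The dephased state `∑_k |⟨k|ψ⟩|² |k⟩⟨k|`. -/
noncomputable def dephased : Fock N →L[ℂ] Fock N :=
  ∑' k, ketbra (component b ψ k) (component b ψ k)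

theorem summable_norm_component_mul :
    Summable fun k => ‖component b ψ k‖ * ‖component b ψ k‖ := by
  simpa only [sq] using (hasSum_norm_component_sq b ψ).summable

theorem hasSum_dephased :
    HasSum (fun k => ketbra (component b ψ k) (component b ψ k)) (dephased b ψ) := by
  refine Summable.hasSum (Summable.of_norm ?_)
  simpa only [norm_ketbra] using summable_norm_component_mul b ψ

theorem NondegenerateGaps.injective {E : κ → ℝ} (hE : NondegenerateGaps E) :
    Function.Injective E := by
  intro k l hkl
  rcases hE k l l l (by rw [hkl]) with h | h
  · exact h.1
  · exact h.1

theorem state_truncate (s : Finset κ) (t : ℝ) :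
    state b E (truncate b s ψ) t = ∑ k ∈ s, ∑ l ∈ s,
      oscillation (E l - E k) t • ketbra (component b ψ k) (component b ψ l) := by
  rw [state, evolve_eq_torusState, torusState_truncate, ketbra_sum_left]
  refine Finset.sum_congr rfl fun k _ => ?_
  rw [ketbra_sum_right]
  refine Finset.sum_congr rfl fun l _ => ?_
  rw [ketbra_smul_left, ketbra_smul_right, smul_smul, coe_torusFlow, coe_torusFlow,
    conj_oscillation, oscillation_mul]
  congr 2
  ring

theorem norm_state_sub_le (φ : Fock N) (t : ℝ) :
    ‖state b E ψ t - state b E φ t‖ ≤ (‖ψ‖ + ‖φ‖) * ‖ψ - φ‖ := by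
  refine (norm_ketbra_self_sub_le _ _).trans (le_of_eq ?_)
  rw [norm_evolve, norm_evolve, evolve_eq_torusState, evolve_eq_torusState, norm_torusState_sub]

theorem eventually_norm_state_sub_truncate_le {ε : ℝ} (hε : 0 < ε) :
    ∀ᶠ s in atTop, ∀ t, ‖state b E ψ t - state b E (truncate b s ψ) t‖ ≤ ε := by
  have h := (tendsto_truncate b ψ).const_mul (‖ψ‖ + ‖ψ‖)
  rw [mul_zero] at h
  filter_upwards [h.eventually (gt_mem_nhds hε)] with s hs t
  refine (norm_state_sub_le b E ψ _ t).trans (le_trans ?_ hs.le)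
  gcongr
  exact norm_truncate_le b s ψ

theorem eventually_norm_dephased_sub_sum_le {ε : ℝ} (hε : 0 < ε) :
    ∀ᶠ s in atTop, ‖dephased b ψ - ∑ k ∈ s, ketbra (component b ψ k) (component b ψ k)‖ ≤ ε := by
  have h : Tendsto _ atTop _ := hasSum_dephased b ψ
  filter_upwards [Metric.tendsto_nhds.1 h ε hε] with s hs
  rw [← dist_eq_norm, dist_comm]
  exact hs.le

/-- For finitely many levels only equal energies survive averaging, and injectivity of E leaves the
diagonal; the general case follows by approximation uniform in time. -/
theorem hasTimeAverage_state {E : κ → ℝ} (hE : Function.Injective E) :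
    HasTimeAverage (state b E ψ) (dephased b ψ) := by
  classical
  refine hasTimeAverage_of_approx (continuous_state b E ψ) fun ε hε => ?_
  obtain ⟨s, hs1, hs2⟩ :=
    ((eventually_norm_state_sub_truncate_le b E ψ hε).and
      (eventually_norm_dephased_sub_sum_le b ψ hε)).exists
  refine ⟨_, _, continuous_state b E (truncate b s ψ), ?_, hs2, hs1⟩
  simp only [funext (state_truncate b E ψ s)]
  have h : ∑ k ∈ s, ketbra (component b ψ k) (component b ψ k) = ∑ k ∈ s, ∑ l ∈ s,
      (if E l - E k = 0 then (1 : ℂ) else 0) • ketbra (component b ψ k) (component b ψ l) := by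
    refine Finset.sum_congr rfl fun k hk => ?_
    rw [Finset.sum_eq_single_of_mem k hk]
    · simp
    · intro l _ hl
      rw [if_neg, zero_smul]
      exact fun h => hl (hE (sub_eq_zero.1 h))
  rw [h]
  refine hasTimeAverage_sum _ (fun k _ => hasTimeAverage_sum _ (fun l _ => ?_) fun l => ?_)
    fun k => ?_
  · exact (hasTimeAverage_oscillation _).smul_const (continuous_oscillation _) _
  · exact (continuous_oscillation _).smul continuous_const
  · exact continuous_finsetSum _ fun l _ => (continuous_oscillation _).smul continuous_const

theorem equilibrium_eq_dephased {E : κ → ℝ} (hE : Function.Injective E) :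
    equilibrium b E ψ = dephased b ψ :=
  (hasTimeAverage_state b ψ hE).limUnder_eq

/-- The terms are nonnegative, so the diagonal sum and the sum over j can be exchanged. -/
theorem hasSum_diag_of_hasSum_ketbra {I J : Type*} [DecidableEq I] {x : J → Ltwo I}
    {T : Ltwo I →L[ℂ] Ltwo I} {A : ℝ} (hT : HasSum (fun j => ketbra (x j) (x j)) T)
    (hA : HasSum (fun j => ‖x j‖ ^ 2) A) :
    (∀ i, HasSum (fun j => ‖x j i‖ ^ 2) (inner ℂ (ket i) (T (ket i))).re) ∧
      HasSum (fun i => inner ℂ (ket i) (T (ket i))) (A : ℂ) := by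
  have h1 : ∀ i, HasSum (fun j => ((‖x j i‖ ^ 2 : ℝ) : ℂ)) (inner ℂ (ket i) (T (ket i))) := by
    intro i
    have h := hT.mapL ((innerSL ℂ (ket i)) ∘L (ContinuousLinearMap.apply ℂ (Ltwo I) (ket i)))
    have e : (fun j => ((‖x j i‖ ^ 2 : ℝ) : ℂ)) =
        fun j => inner ℂ (ket i) (ketbra (x j) (x j) (ket i)) := by
      ext1 j
      rw [ketbra_apply, inner_smul_right, ← inner_conj_symm, inner_ket_left,
        ← Complex.normSq_eq_conj_mul_self, Complex.normSq_eq_norm_sq]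
    rw [e]
    exact h
  have h2 : ∀ i, HasSum (fun j => ‖x j i‖ ^ 2) (inner ℂ (ket i) (T (ket i))).re := fun i =>
    Complex.hasSum_re (h1 i)
  refine ⟨h2, ?_⟩
  have hs : Summable fun p : J × I => ‖x p.1 p.2‖ ^ 2 := by
    refine (summable_prod_of_nonneg fun p => by positivity).2
      ⟨fun j => (hasSum_norm_sq_apply (x j)).summable, ?_⟩
    simpa only [(hasSum_norm_sq_apply _).tsum_eq] using hA.summable
  have hs2 : HasSum (fun p : J × I => ‖x p.1 p.2‖ ^ 2) A := by
    obtain ⟨B, hB⟩ := hs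
    rw [hA.unique (hB.prod_fiberwise fun j => hasSum_norm_sq_apply (x j))]
    exact hB
  rw [← (Equiv.prodComm I J).hasSum_iff] at hs2
  have h3 : HasSum (fun i => (inner ℂ (ket i) (T (ket i))).re) A := hs2.prod_fiberwise h2
  have h4 : ∀ i, inner ℂ (ket i) (T (ket i)) = (((inner ℂ (ket i) (T (ket i))).re : ℝ) : ℂ) :=
    fun i => by
      refine (h1 i).unique ?_
      exact Complex.hasSum_ofReal.2 (h2 i)
  rw [funext h4]
  exact Complex.hasSum_ofReal.2 h3

theorem summable_norm_inner_pow_four : Summable fun k => ‖inner ℂ (b k) ψ‖ ^ 4 := by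
  have h := (hasSum_norm_component_sq b ψ).summable
  simp only [norm_component] at h
  refine (h.mul_left (‖ψ‖ ^ 2)).of_nonneg_of_le (fun _ => by positivity) fun k => ?_
  have h3 : ‖inner ℂ (b k) ψ‖ ≤ ‖ψ‖ := by
    have := norm_inner_le_norm (𝕜 := ℂ) (b k) ψ
    rwa [b.orthonormal.1 k, one_mul] at this
  rw [show ‖inner ℂ (b k) ψ‖ ^ 4 = ‖inner ℂ (b k) ψ‖ ^ 2 * ‖inner ℂ (b k) ψ‖ ^ 2 by ring]
  gcongr

theorem ketbra_component (ψ : Fock N) (k : κ) : ketbra (component b ψ k) (component b ψ k) =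
    ((‖inner ℂ (b k) ψ‖ ^ 2 : ℝ) : ℂ) • ketbra (b k) (b k) := by
  rw [component, ketbra_smul_left, ketbra_smul_right, smul_smul, Complex.mul_conj,
    Complex.normSq_eq_norm_sq]

/-- The b k are eigenvectors with eigenvalue p_k, so the square is the sum of the rank-one operators
of p_k • b k, with trace ∑ p_k². -/
theorem trace_dephased_comp_self :
    trace (dephased b ψ ∘L dephased b ψ) = ((∑' k, ‖inner ℂ (b k) ψ‖ ^ 4 : ℝ) : ℂ) := by
  classical
  have h0 := ketbra_component b ψ
  have hb : ∀ k, dephased b ψ (b k) = ((‖inner ℂ (b k) ψ‖ ^ 2 : ℝ) : ℂ) • b k := fun k => by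
    have h := (hasSum_dephased b ψ).mapL (ContinuousLinearMap.apply ℂ (Fock N) (b k))
    refine h.unique ?_
    have h2 := hasSum_single (L := SummationFilter.unconditional _) (f := fun l =>
      ContinuousLinearMap.apply ℂ (Fock N) (b k) (ketbra (component b ψ l) (component b ψ l))) k ?_
    · convert h2 using 1
      rw [h0, ContinuousLinearMap.apply_apply, smul_apply, ketbra_apply,
        orthonormal_iff_ite.1 b.orthonormal, if_pos rfl, one_smul]
    · intro l hl
      rw [h0, ContinuousLinearMap.apply_apply, smul_apply, ketbra_apply,
        orthonormal_iff_ite.1 b.orthonormal, if_neg hl, zero_smul, smul_zero]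
  have h1 : HasSum (fun k => ketbra (((‖inner ℂ (b k) ψ‖ ^ 2 : ℝ) : ℂ) • b k)
      (((‖inner ℂ (b k) ψ‖ ^ 2 : ℝ) : ℂ) • b k)) (dephased b ψ ∘L dephased b ψ) := by
    have h := (hasSum_dephased b ψ).mapL (ContinuousLinearMap.compL ℂ (Fock N) (Fock N) (Fock N)
      (dephased b ψ))
    convert h using 1
    · ext1 k
      rw [h0]
      ext1 x
      simp only [ContinuousLinearMap.compL_apply, ContinuousLinearMap.comp_apply, smul_apply,
        ketbra_apply, map_smul, hb, inner_smul_left, Complex.conj_ofReal, smul_smul]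
      congr 1
      ring
    · rfl
  refine (hasSum_diag_of_hasSum_ketbra h1 ?_).2.tsum_eq
  convert (summable_norm_inner_pow_four b ψ).hasSum using 2 with k
  rw [norm_smul, b.orthonormal.1 k, mul_one, Complex.norm_real, Real.norm_of_nonneg (by positivity)]
  ring

theorem dEff_dephased : dEff (dephased b ψ) = 1 / ∑' k, ‖inner ℂ (b k) ψ‖ ^ 4 := by
  rw [dEff, trace_dephased_comp_self, Complex.ofReal_re]

end Equilibrium

/-! ### Fluctuations around equilibrium -/

section Fluctuations

variable {N : ℕ} (F : FreeTheory N) (S : Finset (Fin N)) (Λ : ℝ)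

theorem traceNorm_truncReducedCLM_ne_top (T : Fock N →L[ℂ] Fock N) :
    traceNorm (truncReducedCLM F S Λ T) ≠ ∞ :=
  ((traceNorm_truncReducedCLM_le F S Λ T).trans_lt ENNReal.ofReal_lt_top).ne

theorem continuous_toReal_traceNorm_truncReducedCLM :
    Continuous fun T : Fock N →L[ℂ] Fock N => (traceNorm (truncReducedCLM F S Λ T)).toReal := by
  refine continuous_iff_continuousAt.2 fun T₀ => tendsto_iff_norm_sub_tendsto_zero.2 ?_
  have hc : Continuous fun T : Fock N →L[ℂ] Fock N =>
      √(F.dSub S Λ) * ‖reducedMatrix F S Λ (T - T₀)‖ := by fun_prop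
  refine squeeze_zero (g := fun T : Fock N →L[ℂ] Fock N =>
    √(F.dSub S Λ) * ‖reducedMatrix F S Λ (T - T₀)‖) (fun _ => norm_nonneg _) (fun T => ?_) ?_
  · refine abs_toReal_traceNorm_sub_le (traceNorm_truncReducedCLM_ne_top F S Λ _)
      (traceNorm_truncReducedCLM_ne_top F S Λ _) ?_ (by positivity)
    rw [← map_sub]
    exact traceNorm_truncReducedCLM_le F S Λ _
  · simpa using hc.tendsto T₀

variable {κ : Type*} (b : HilbertBasis κ ℂ (Fock N)) {E : κ → ℝ} (ψ : Fock N)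

/-- By p_k p_l ≤ (p_k² + p_l²)/2 the double sum splits into two halves, equal by the symmetry of
exchanging k and l; in each, the Bessel bound gives d_S. -/
theorem sum_product_norm_sq_reducedMatrix_le (s : Finset κ) :
    ∑ k ∈ s, ∑ l ∈ s, ‖reducedMatrix F S Λ (ketbra (component b ψ k) (component b ψ l))‖ ^ 2 ≤
      F.dSub S Λ * ∑ k ∈ s, ‖inner ℂ (b k) ψ‖ ^ 4 := by
  have h0 : ∀ k l, ‖reducedMatrix F S Λ (ketbra (component b ψ k) (component b ψ l))‖ ^ 2 =
      ‖inner ℂ (b k) ψ‖ ^ 2 * ‖inner ℂ (b l) ψ‖ ^ 2 *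
        ‖reducedMatrix F S Λ (ketbra (b k) (b l))‖ ^ 2 := fun k l => by
    rw [component, component, ketbra_smul_left, ketbra_smul_right, map_smul, map_smul, norm_smul,
      norm_smul, Complex.norm_conj]
    ring
  have h1 : ∀ k, ∑ l ∈ s, ‖reducedMatrix F S Λ (ketbra (b k) (b l))‖ ^ 2 ≤ F.dSub S Λ :=
    fun k => by
      have := sum_norm_sq_reducedMatrix_ketbra_le F S Λ b.orthonormal s (b k)
      rwa [b.orthonormal.1 k, one_pow, mul_one] at this
  have h2 : ∑ k ∈ s, ∑ l ∈ s,
      ‖inner ℂ (b k) ψ‖ ^ 4 * ‖reducedMatrix F S Λ (ketbra (b k) (b l))‖ ^ 2 ≤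
        F.dSub S Λ * ∑ k ∈ s, ‖inner ℂ (b k) ψ‖ ^ 4 := by
    rw [Finset.mul_sum]
    refine Finset.sum_le_sum fun k _ => ?_
    rw [← Finset.mul_sum, mul_comm]
    exact mul_le_mul_of_nonneg_right (h1 k) (by positivity)
  have h3 : ∑ k ∈ s, ∑ l ∈ s,
      ‖inner ℂ (b l) ψ‖ ^ 4 * ‖reducedMatrix F S Λ (ketbra (b k) (b l))‖ ^ 2 ≤
        F.dSub S Λ * ∑ k ∈ s, ‖inner ℂ (b k) ψ‖ ^ 4 := by
    rw [Finset.sum_comm]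
    simp only [norm_reducedMatrix_ketbra_comm F S Λ (b _) (b _)]
    refine le_trans (le_of_eq ?_) h2
    refine Finset.sum_congr rfl fun k _ => Finset.sum_congr rfl fun l _ => ?_
    rw [norm_reducedMatrix_ketbra_comm]
  have h4 : ∑ k ∈ s, ∑ l ∈ s, ‖reducedMatrix F S Λ (ketbra (component b ψ k) (component b ψ l))‖ ^ 2
      ≤ ∑ k ∈ s, ∑ l ∈ s, (‖inner ℂ (b k) ψ‖ ^ 4 *
        ‖reducedMatrix F S Λ (ketbra (b k) (b l))‖ ^ 2 + ‖inner ℂ (b l) ψ‖ ^ 4 *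
        ‖reducedMatrix F S Λ (ketbra (b k) (b l))‖ ^ 2) / 2 := by
    refine Finset.sum_le_sum fun k _ => Finset.sum_le_sum fun l _ => ?_
    rw [h0, ← add_mul, mul_div_right_comm]
    refine mul_le_mul_of_nonneg_right ?_ (by positivity)
    nlinarith [sq_nonneg (‖inner ℂ (b k) ψ‖ ^ 2 - ‖inner ℂ (b l) ψ‖ ^ 2)]
  simp only [← Finset.sum_div, Finset.sum_add_distrib] at h4
  linarith

/-- Subtracting the dephased part leaves ordered pairs k ≠ l with frequencies E l - E k. These are
pairwise distinct by the gap condition, so Parseval applies. -/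
theorem hasTimeAverage_norm_sq_reducedMatrix (hE : NondegenerateGaps E) (s : Finset κ) :
    ∃ a, HasTimeAverage (fun t => ‖reducedMatrix F S Λ (state b E (truncate b s ψ) t -
      ∑ k ∈ s, ketbra (component b ψ k) (component b ψ k))‖ ^ 2) a ∧
      a ≤ F.dSub S Λ * ∑ k ∈ s, ‖inner ℂ (b k) ψ‖ ^ 4 := by
  classical
  have h1 : ∀ t, state b E (truncate b s ψ) t -
      ∑ k ∈ s, ketbra (component b ψ k) (component b ψ k) = ∑ p ∈ s.offDiag,
        oscillation (E p.2 - E p.1) t • ketbra (component b ψ p.1) (component b ψ p.2) := by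
    intro t
    rw [state_truncate, ← Finset.sum_product', ← Finset.diag_union_offDiag,
      Finset.sum_union (Finset.disjoint_diag_offDiag s), Finset.sum_diag]
    simp [oscillation]
  simp only [h1, map_sum, map_smul]
  refine ⟨_, hasTimeAverage_norm_sum_sq s.offDiag _ ?_ _, ?_⟩
  · rintro ⟨k, l⟩ hkl ⟨m, n⟩ _ h
    rcases hE l k n m h with h' | h'
    · exact absurd h'.1.symm (Finset.mem_offDiag.1 hkl).2.2
    · exact Prod.ext h'.2 h'.1
  · refine le_trans ?_ (sum_product_norm_sq_reducedMatrix_le F S Λ b ψ s)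
    rw [← Finset.sum_product']
    refine Finset.sum_le_sum_of_subset_of_nonneg ?_ fun _ _ _ => by positivity
    intro p hp
    rw [Finset.mem_offDiag] at hp
    exact Finset.mem_product.2 ⟨hp.1, hp.2.1⟩

theorem exists_hasTimeAverage_state {f : (Fock N →L[ℂ] Fock N) → ℝ} (hf : Continuous f) :
    ∃ a, HasTimeAverage (fun t => f (state b E ψ t)) a := by
  simp only [state, evolve_eq_torusState]
  exact exists_hasTimeAverage_torus E
    (f := fun u => f (ketbra (torusState b ψ u) (torusState b ψ u)))
    (hf.comp (continuous_ketbra_self.comp (continuous_torusState b ψ)))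

theorem hasTimeAverage_norm_reducedMatrix_le (hE : NondegenerateGaps E) {a : ℝ}
    (ha : HasTimeAverage (fun t => ‖reducedMatrix F S Λ (state b E ψ t - dephased b ψ)‖) a) :
    a ≤ √(F.dSub S Λ * ∑' k, ‖inner ℂ (b k) ψ‖ ^ 4) := by
  refine le_of_forall_pos_le_add fun ε hε => ?_
  -- The added 1 keeps M positive, so that the tolerance ε / (2M) makes sense.
  set M := ‖reducedMatrix F S Λ‖ + 1
  have hM : 0 < M := by positivity
  obtain ⟨s, hs1, hs2⟩ :=
    ((eventually_norm_state_sub_truncate_le b E ψ (ε := ε / (2 * M)) (by positivity)).and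
    (eventually_norm_dephased_sub_sum_le b ψ (ε := ε / (2 * M)) (by positivity))).exists
  set D := ∑ k ∈ s, ketbra (component b ψ k) (component b ψ k) with hD
  obtain ⟨c, hc⟩ := exists_hasTimeAverage_state b (E := E) (truncate b s ψ)
    (f := fun T => ‖reducedMatrix F S Λ (T - D)‖) (by fun_prop)
  obtain ⟨m, hm, hmle⟩ := hasTimeAverage_norm_sq_reducedMatrix F S Λ b ψ hE s
  have hcont : ∀ φ D, Continuous fun t => ‖reducedMatrix F S Λ (state b E φ t - D)‖ := fun φ D =>
    ((reducedMatrix F S Λ).continuous.comp ((continuous_state b E φ).sub continuous_const)).norm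
  have h1 : c ≤ √m := hc.le_sqrt (hcont _ _) hm
  have h2 : a ≤ c + ε := by
    refine ha.mono (hc.add (hasTimeAverage_const ε) (hcont _ _) continuous_const) (hcont _ _)
      ((hcont _ _).add continuous_const) fun t => ?_
    have h3 : ‖reducedMatrix F S Λ ((state b E ψ t - state b E (truncate b s ψ) t) -
        (dephased b ψ - D))‖ ≤ ε := by
      refine (ContinuousLinearMap.le_opNorm _ _).trans ?_
      have h4 := (norm_sub_le (state b E ψ t - state b E (truncate b s ψ) t)
        (dephased b ψ - D)).trans (add_le_add (hs1 t) hs2)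
      calc _ ≤ M * (ε / (2 * M) + ε / (2 * M)) :=
            mul_le_mul (by simp [M]) h4 (norm_nonneg _) hM.le
        _ = ε := by field_simp; ring
    have h5 : state b E ψ t - dephased b ψ = (state b E (truncate b s ψ) t - D) +
      ((state b E ψ t - state b E (truncate b s ψ) t) - (dephased b ψ - D)) := by abel
    rw [h5, map_add]
    exact (norm_add_le _ _).trans (add_le_add_right h3 _)
  refine h2.trans (add_le_add_left (h1.trans (Real.sqrt_le_sqrt (hmle.trans ?_))) _)
  exact mul_le_mul_of_nonneg_left ((summable_norm_inner_pow_four b ψ).sum_le_tsum s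
    fun _ _ => by positivity) (by positivity)

theorem exists_hasTimeMean_traceNorm_truncReduced (hE : NondegenerateGaps E) :
    ∃ m, HasTimeMean (fun t => traceNorm (F.truncReduced S Λ (state b E ψ t) -
      F.truncReduced S Λ (dephased b ψ))) m ∧
      m ≤ ENNReal.ofReal √((F.dSub S Λ : ℝ) ^ 2 / dEff (dephased b ψ)) := by
  simp only [truncReduced_eq, ← map_sub]
  have hc1 : Continuous fun T : Fock N →L[ℂ] Fock N =>
      (traceNorm (truncReducedCLM F S Λ (T - dephased b ψ))).toReal :=
    (continuous_toReal_traceNorm_truncReducedCLM F S Λ).comp (continuous_id.sub continuous_const)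
  have hc2 : Continuous fun T : Fock N →L[ℂ] Fock N =>
      ‖reducedMatrix F S Λ (T - dephased b ψ)‖ := by fun_prop
  obtain ⟨a, ha⟩ := exists_hasTimeAverage_state b (E := E) ψ hc1
  obtain ⟨c, hc⟩ := exists_hasTimeAverage_state b (E := E) ψ hc2
  refine ⟨ENNReal.ofReal a, ?_, ENNReal.ofReal_le_ofReal ?_⟩
  · have h := ha.hasTimeMean (hc1.comp (continuous_state b E ψ)) fun t => ENNReal.toReal_nonneg
    simpa only [ENNReal.ofReal_toReal (traceNorm_truncReducedCLM_ne_top F S Λ _)] using h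
  · have h1 : a ≤ √(F.dSub S Λ) * c := by
      refine ha.mono (hc.const_mul _) (hc1.comp (continuous_state b E ψ))
        (continuous_const.mul (hc2.comp (continuous_state b E ψ))) fun t => ?_
      exact ENNReal.toReal_le_of_le_ofReal (by positivity) (traceNorm_truncReducedCLM_le F S Λ _)
    have h2 := hasTimeAverage_norm_reducedMatrix_le F S Λ b ψ hE hc
    refine h1.trans ((mul_le_mul_of_nonneg_left h2 (Real.sqrt_nonneg _)).trans (le_of_eq ?_))
    rw [← Real.sqrt_mul (by positivity), dEff_dephased]
    congr 1
    rw [one_div, div_inv_eq_mul]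
    ring

end Fluctuations

/-! ### Error of the energy cutoff -/

section TruncationError

variable {N : ℕ} (F : FreeTheory N) (S : Finset (Fin N)) (Λ : ℝ)
  {κ : Type*} (b : HilbertBasis κ ℂ (Fock N)) {E : κ → ℝ} (ψ : Fock N)

/-- The error made by truncating before reducing. -/
noncomputable def truncError (T : Fock N →L[ℂ] Fock N) : SubFock S →L[ℂ] SubFock S :=
  partialTrace S T - F.truncReduced S Λ T

theorem traceNorm_truncError_ketbra_le (x : Fock N) :
    traceNorm (truncError F S Λ (ketbra x x)) ≤
      ENNReal.ofReal (2 * (‖x‖ * ‖x - F.cutoffProj Λ x‖)) := by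
  rw [truncError, truncReduced_ketbra]
  refine (traceNorm_partialTrace_ketbra_self_sub_le S _ _).trans (ENNReal.ofReal_le_ofReal ?_)
  have h : ‖F.cutoffProj Λ x‖ ≤ ‖x‖ := norm_proj_apply_le _ _
  nlinarith [norm_nonneg (x - F.cutoffProj Λ x)]

theorem traceNorm_truncError_ketbra_sub_le (x y : Fock N) :
    traceNorm (truncError F S Λ (ketbra x x) - truncError F S Λ (ketbra y y)) ≤
      ENNReal.ofReal (2 * ((‖x‖ + ‖y‖) * ‖x - y‖)) := by
  rw [truncError, truncError, truncReduced_ketbra, truncReduced_ketbra, sub_sub_sub_comm]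
  refine (traceNorm_sub_le _ _).trans ?_
  refine (add_le_add (traceNorm_partialTrace_ketbra_self_sub_le S _ _)
    (traceNorm_partialTrace_ketbra_self_sub_le S _ _)).trans ?_
  rw [← ENNReal.ofReal_add (by positivity) (by positivity), two_mul, ← map_sub]
  refine ENNReal.ofReal_le_ofReal (add_le_add le_rfl ?_)
  gcongr <;> exact norm_proj_apply_le _ _

theorem hasSum_truncError :
    HasSum (fun k => truncError F S Λ (ketbra (component b ψ k) (component b ψ k)))
      (truncError F S Λ (dephased b ψ)) := by
  simp only [truncError, truncReduced_eq]
  exact (hasSum_partialTrace_of_hasSum S (hasSum_dephased b ψ)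
    (summable_norm_component_mul b ψ)).sub ((hasSum_dephased b ψ).mapL (truncReducedCLM F S Λ))

/-- The weight of the dephased state above the cutoff. -/
noncomputable def highEnergyWeight : ℝ :=
  ‖ψ‖ ^ 2 - ∑ n ∈ F.below Λ, (inner ℂ (ket n) (dephased b ψ (ket n))).re

theorem hasSum_diag_dephased (n : Fin N → ℕ) :
    HasSum (fun k => ‖component b ψ k n‖ ^ 2) (inner ℂ (ket n) (dephased b ψ (ket n))).re :=
  (hasSum_diag_of_hasSum_ketbra (hasSum_dephased b ψ) (hasSum_norm_component_sq b ψ)).1 n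

theorem diag_dephased_nonneg (n : Fin N → ℕ) :
    0 ≤ (inner ℂ (ket n) (dephased b ψ (ket n))).re :=
  (hasSum_diag_dephased b ψ n).nonneg fun _ => by positivity

theorem norm_sub_cutoffProj_sq (x : Fock N) :
    ‖x - F.cutoffProj Λ x‖ ^ 2 = ‖x‖ ^ 2 - ∑ n ∈ F.below Λ, ‖x n‖ ^ 2 := by
  have h1 := norm_sq_proj_add (F.below Λ) x
  rw [norm_sq_proj_apply] at h1
  rw [FreeTheory.cutoffProj]
  linarith

theorem hasSum_norm_sub_cutoffProj_sq :
    HasSum (fun k => ‖component b ψ k - F.cutoffProj Λ (component b ψ k)‖ ^ 2)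
      (highEnergyWeight F Λ b ψ) := by
  simp only [norm_sub_cutoffProj_sq]
  exact (hasSum_norm_component_sq b ψ).sub
    (hasSum_sum fun n _ => hasSum_diag_dephased b ψ n)

theorem highEnergyWeight_nonneg : 0 ≤ highEnergyWeight F Λ b ψ :=
  (hasSum_norm_sub_cutoffProj_sq F Λ b ψ).nonneg fun _ => by positivity

/-- Add the errors of the rank-one terms 2‖x_k‖‖x_k - P x_k‖ and apply Cauchy–Schwarz over the
levels. -/
theorem traceNorm_truncError_dephased_le :
    traceNorm (truncError F S Λ (dephased b ψ)) ≤
      ENNReal.ofReal (2 * (‖ψ‖ * √(highEnergyWeight F Λ b ψ))) := by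
  have h2 := hasSum_norm_sub_cutoffProj_sq F Λ b ψ
  rw [← Real.sq_sqrt (highEnergyWeight_nonneg F Λ b ψ)] at h2
  obtain ⟨hs, hle⟩ := summable_mul_of_hasSum_sq (fun _ => norm_nonneg _) (fun _ => norm_nonneg _)
    (norm_nonneg _) (Real.sqrt_nonneg _) (hasSum_norm_component_sq b ψ) h2
  refine (traceNorm_le_tsum_of_hasSum (hasSum_truncError F S Λ b ψ)).trans ?_
  refine (ENNReal.tsum_le_tsum fun k => traceNorm_truncError_ketbra_le F S Λ _).trans ?_
  rw [← ENNReal.ofReal_tsum_of_nonneg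
    (fun _ => mul_nonneg zero_le_two (mul_nonneg (norm_nonneg _) (norm_nonneg _)))
    (hs.mul_left 2), tsum_mul_left]
  exact ENNReal.ofReal_le_ofReal (mul_le_mul_of_nonneg_left hle zero_le_two)

/-- The squared norm above the cutoff is ‖ψ‖² minus finitely many diagonal entries of the state, a
continuous affine function, so it averages to its value at ω. -/
theorem hasTimeAverage_norm_sub_cutoffProj_sq (hE : Function.Injective E) :
    HasTimeAverage (fun t => ‖evolve b E ψ t - F.cutoffProj Λ (evolve b E ψ t)‖ ^ 2)
      (highEnergyWeight F Λ b ψ) := by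
  let L : (Fock N →L[ℂ] Fock N) →L[ℂ] ℂ := -∑ n ∈ F.below Λ,
    (innerSL ℂ (ket n)) ∘L (ContinuousLinearMap.apply ℂ (Fock N) (ket n))
  have hL : ∀ T, (L T).re = -∑ n ∈ F.below Λ, (inner ℂ (ket n) (T (ket n))).re := fun T => by
    simp [L]
  have h1 := (hasTimeAverage_state b ψ hE).map (Complex.reCLM ∘L L.restrictScalars ℝ)
    (continuous_state b E ψ)
  have h2 := (hasTimeAverage_const (‖ψ‖ ^ 2)).add h1 continuous_const
    ((Complex.reCLM ∘L L.restrictScalars ℝ).continuous.comp (continuous_state b E ψ))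
  convert h2 using 1
  · ext t
    change _ = _ + (L _).re
    rw [hL, norm_sub_cutoffProj_sq, norm_evolve, ← sub_eq_add_neg]
    congr 1
    refine Finset.sum_congr rfl fun n _ => ?_
    rw [state, ketbra_apply, inner_smul_right, ← inner_conj_symm, inner_ket_left,
      ← Complex.normSq_eq_conj_mul_self, Complex.normSq_eq_norm_sq, Complex.ofReal_re]
  · change _ = _ + (L _).re
    rw [hL, ← sub_eq_add_neg]
    rfl

theorem continuous_toReal_traceNorm_truncError {D : SubFock S →L[ℂ] SubFock S}
    (hD : traceNorm D ≠ ∞) :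
    Continuous fun x : Fock N => (traceNorm (truncError F S Λ (ketbra x x) - D)).toReal := by
  have hfin : ∀ x, traceNorm (truncError F S Λ (ketbra x x) - D) ≠ ∞ := fun x =>
    ((traceNorm_sub_le _ _).trans_lt (ENNReal.add_lt_top.2
      ⟨(traceNorm_truncError_ketbra_le F S Λ x).trans_lt ENNReal.ofReal_lt_top, hD.lt_top⟩)).ne
  refine continuous_iff_continuousAt.2 fun y => tendsto_iff_norm_sub_tendsto_zero.2 ?_
  have hc : Continuous fun x : Fock N => 2 * ((‖x‖ + ‖y‖) * ‖x - y‖) := by fun_prop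
  refine squeeze_zero (fun _ => norm_nonneg _) (fun x => abs_toReal_traceNorm_sub_le
    (C := 2 * ((‖x‖ + ‖y‖) * ‖x - y‖)) (hfin x) (hfin y) ?_ (by positivity))
    (by simpa using hc.tendsto y)
  rw [sub_sub_sub_cancel_right]
  exact traceNorm_truncError_ketbra_sub_le F S Λ x y

/-- Markov's inequality: every basis vector outside the cutoff has free energy at least Λ, and those
inside contribute nonnegatively. -/
theorem ofReal_highEnergyWeight_mul_le :
    ENNReal.ofReal (highEnergyWeight F Λ b ψ) * ENNReal.ofReal Λ ≤
      F.meanEnergy (dephased b ψ) := by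
  have h1 := (hasSum_diag_of_hasSum_ketbra (hasSum_dephased b ψ) (hasSum_norm_component_sq b ψ)).2
  have h2 : HasSum (fun n => (inner ℂ (ket n) (dephased b ψ (ket n))).re) (‖ψ‖ ^ 2) :=
    Complex.hasSum_re h1
  have h3 : HasSum (fun n => if n ∈ F.below Λ then
      (inner ℂ (ket n) (dephased b ψ (ket n))).re else 0)
      (∑ n ∈ F.below Λ, (inner ℂ (ket n) (dephased b ψ (ket n))).re) := by
    have h := hasSum_sum_of_ne_finset_zero (L := SummationFilter.unconditional _)
      (f := fun n => if n ∈ F.below Λ then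
        (inner ℂ (ket n) (dephased b ψ (ket n))).re else 0) (s := F.below Λ)
      fun n hn => by simp [hn]
    convert h using 1
    exact Finset.sum_congr rfl fun n hn => by simp [hn]
  have h4 := h2.sub h3
  have h5 : ∀ n, 0 ≤ (inner ℂ (ket n) (dephased b ψ (ket n))).re -
      if n ∈ F.below Λ then (inner ℂ (ket n) (dephased b ψ (ket n))).re else 0 := fun n => by
    have := diag_dephased_nonneg b ψ n
    split_ifs <;> linarith
  rw [highEnergyWeight, ← h4.tsum_eq, ENNReal.ofReal_tsum_of_nonneg h5 h4.summable,
    ← ENNReal.tsum_mul_right]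
  refine ENNReal.tsum_le_tsum fun n => ?_
  rw [← ENNReal.ofReal_mul (h5 n)]
  refine ENNReal.ofReal_le_ofReal ?_
  have h0 := diag_dephased_nonneg b ψ n
  split_ifs with hn
  · rw [sub_self, zero_mul]
    refine mul_nonneg (Finset.sum_nonneg fun i _ => ?_) h0
    exact mul_nonneg (F.μ_pos i).le (Nat.cast_nonneg _)
  · rw [sub_zero, mul_comm]
    refine mul_le_mul_of_nonneg_right ?_ h0
    by_contra h
    exact hn ((Set.Finite.mem_toFinset _).2 (not_le.1 h))

theorem exists_hasTimeMean_traceNorm_truncError (hE : Function.Injective E) (hψ : ‖ψ‖ = 1)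
    (hΛ : 0 < Λ) :
    ∃ m, HasTimeMean (fun t => traceNorm (truncError F S Λ (state b E ψ t) -
      truncError F S Λ (dephased b ψ))) m ∧
      m ≤ 6 * (F.meanEnergy (dephased b ψ) / ENNReal.ofReal Λ) ^ (1 / 2 : ℝ) := by
  have hD := ((traceNorm_truncError_dephased_le F S Λ b ψ).trans_lt ENNReal.ofReal_lt_top).ne
  have hc1 := continuous_toReal_traceNorm_truncError F S Λ hD
  set q := highEnergyWeight F Λ b ψ
  have hq : 0 ≤ q := highEnergyWeight_nonneg F Λ b ψ
  have hfin : ∀ x, traceNorm (truncError F S Λ (ketbra x x) -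
      truncError F S Λ (dephased b ψ)) ≠ ∞ := fun x =>
    ((traceNorm_sub_le _ _).trans_lt (ENNReal.add_lt_top.2
      ⟨(traceNorm_truncError_ketbra_le F S Λ x).trans_lt ENNReal.ofReal_lt_top, hD.lt_top⟩)).ne
  have hmean : ∀ {f : Fock N → ℝ}, Continuous f →
      ∃ a, HasTimeAverage (fun t => f (evolve b E ψ t)) a := fun {f} hf => by
    simp only [evolve_eq_torusState]
    exact exists_hasTimeAverage_torus E (hf.comp (continuous_torusState b ψ))
  have hc2 : Continuous fun x : Fock N => ‖x - F.cutoffProj Λ x‖ := by fun_prop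
  have hev := continuous_evolve b E ψ
  obtain ⟨a, ha⟩ := hmean hc1
  obtain ⟨c, hc⟩ := hmean hc2
  have hcq : c ≤ √q := hc.le_sqrt (hc2.comp hev)
    (hasTimeAverage_norm_sub_cutoffProj_sq F Λ b ψ hE)
  -- One term for the evolving state and one for ω. With c ≤ √q the total is 4 √q, so the constant 6
  -- leaves room.
  have hac : a ≤ 2 * c + 2 * √q := by
    refine ha.mono ((hc.const_mul 2).add (hasTimeAverage_const (2 * √q))
      (continuous_const.mul (hc2.comp hev)) continuous_const) (hc1.comp hev)
      ((continuous_const.mul (hc2.comp hev)).add continuous_const) fun t => ?_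
    refine ENNReal.toReal_le_of_le_ofReal (by positivity) ?_
    rw [ENNReal.ofReal_add (by positivity) (by positivity)]
    refine (traceNorm_sub_le _ _).trans (add_le_add ?_ ?_)
    · refine (traceNorm_truncError_ketbra_le F S Λ _).trans (le_of_eq ?_)
      rw [norm_evolve, hψ, one_mul]
    · refine (traceNorm_truncError_dephased_le F S Λ b ψ).trans (le_of_eq ?_)
      rw [hψ, one_mul]
  refine ⟨ENNReal.ofReal a, ?_, ?_⟩
  · have h := ha.hasTimeMean (hc1.comp hev) fun t => ENNReal.toReal_nonneg
    simp only [ENNReal.ofReal_toReal (hfin _)] at h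
    exact h
  · have h1 : ENNReal.ofReal q ≤ F.meanEnergy (dephased b ψ) / ENNReal.ofReal Λ := by
      rw [ENNReal.le_div_iff_mul_le (Or.inl (by simpa using hΛ)) (Or.inl ENNReal.ofReal_ne_top)]
      exact ofReal_highEnergyWeight_mul_le F Λ b ψ
    calc ENNReal.ofReal a ≤ ENNReal.ofReal (6 * √q) :=
          ENNReal.ofReal_le_ofReal (by nlinarith [Real.sqrt_nonneg q])
      _ = 6 * ENNReal.ofReal q ^ (1 / 2 : ℝ) := by
          rw [ENNReal.ofReal_mul (by norm_num), Real.sqrt_eq_rpow,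
            ENNReal.ofReal_rpow_of_nonneg hq (by norm_num)]
          norm_num
      _ ≤ _ := by gcongr

end TruncationError

/-! ### The energy shell in coordinates -/

section Shell

variable {N : ℕ} (F : FreeTheory N) (Δ : ℝ) {κ : Type*} (b : HilbertBasis κ ℂ (Fock N))

/-- The inclusion of the energy shell. -/
noncomputable def shellVec (c : EuclideanSpace ℂ {n // n ∈ F.shell Δ}) : Fock N :=
  ∑ n : {n // n ∈ F.shell Δ}, c n • ket n.1

theorem shellState_eq (c : F.ShellSphere Δ) : F.shellState Δ c = shellVec F Δ c.1 := rfl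

theorem orthonormal_ket_shell :
    Orthonormal ℂ fun n : {n // n ∈ F.shell Δ} => (ket n.1 : Fock N) :=
  orthonormal_ket.comp _ Subtype.val_injective

theorem norm_shellVec (c : EuclideanSpace ℂ {n // n ∈ F.shell Δ}) : ‖shellVec F Δ c‖ = ‖c‖ := by
  refine (pow_left_inj₀ (norm_nonneg _) (norm_nonneg _) two_ne_zero).1 ?_
  rw [EuclideanSpace.norm_sq_eq, ← inner_self_eq_norm_sq (𝕜 := ℂ), shellVec,
    (orthonormal_ket_shell F Δ).inner_sum, map_sum]
  refine Finset.sum_congr rfl fun n _ => ?_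
  rw [← Complex.normSq_eq_conj_mul_self]
  change (((Complex.normSq _ : ℝ) : ℂ)).re = _
  rw [Complex.ofReal_re, Complex.normSq_eq_norm_sq]

theorem shellVec_sub (c c' : EuclideanSpace ℂ {n // n ∈ F.shell Δ}) :
    shellVec F Δ (c - c') = shellVec F Δ c - shellVec F Δ c' := by
  simp [shellVec, sub_smul]

theorem norm_shellState (c : F.ShellSphere Δ) : ‖F.shellState Δ c‖ = 1 := by
  rw [shellState_eq, norm_shellVec]
  exact norm_eq_of_mem_sphere c

theorem norm_shellState_sub (c c' : F.ShellSphere Δ) :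
    ‖F.shellState Δ c - F.shellState Δ c'‖ = dist c c' := by
  rw [shellState_eq, shellState_eq, ← shellVec_sub, norm_shellVec, ← dist_eq_norm]
  rfl

/-- The coordinates of the projection to the energy shell. -/
noncomputable def shellCoords (x : Fock N) : EuclideanSpace ℂ {n // n ∈ F.shell Δ} :=
  WithLp.toLp 2 fun n => x n.1

theorem inner_shellVec (x : Fock N) (c : EuclideanSpace ℂ {n // n ∈ F.shell Δ}) :
    inner ℂ x (shellVec F Δ c) = inner ℂ (shellCoords F Δ x) c := by
  rw [shellVec, inner_sum, PiLp.inner_apply]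
  refine Finset.sum_congr rfl fun n _ => ?_
  rw [inner_smul_right, ← inner_conj_symm, inner_ket_left]
  simp [shellCoords]

theorem norm_sq_shellCoords (x : Fock N) :
    ‖shellCoords F Δ x‖ ^ 2 = (inner ℂ x (F.shellProj Δ x)).re := by
  have h : inner ℂ x (F.shellProj Δ x) = ((‖F.shellProj Δ x‖ ^ 2 : ℝ) : ℂ) := by
    have h2 : F.shellProj Δ x = F.shellProj Δ (F.shellProj Δ x) := by
      ext i
      simp only [FreeTheory.shellProj, proj_apply]
      split_ifs <;> rfl
    have h3 := inner_self_eq_norm_sq_to_K (𝕜 := ℂ) (F.shellProj Δ x)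
    rw [h2, ← ContinuousLinearMap.adjoint_inner_left, FreeTheory.shellProj, adjoint_proj,
      ← FreeTheory.shellProj, ← h2, h3]
    norm_cast
  rw [h, Complex.ofReal_re, FreeTheory.shellProj, norm_sq_proj_apply, EuclideanSpace.norm_sq_eq]
  exact Finset.sum_coe_sort (F.shell Δ) (fun n => ‖x n‖ ^ 2)

theorem norm_shellCoords_le (x : Fock N) : ‖shellCoords F Δ x‖ ≤ ‖x‖ := by
  refine (pow_le_pow_iff_left₀ (norm_nonneg _) (norm_nonneg _) two_ne_zero).1 ?_
  rw [EuclideanSpace.norm_sq_eq]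
  refine le_trans (le_of_eq (Finset.sum_coe_sort (F.shell Δ) (fun n => ‖x n‖ ^ 2))) ?_
  exact sum_le_hasSum _ (fun _ _ => sq_nonneg _) (hasSum_norm_sq_apply x)

/-- The trace of the shell projector in the eigenbasis; exchanging sums reduces it to ‖ket n‖² = 1
for each n in the shell. -/
theorem hasSum_norm_sq_shellCoords :
    HasSum (fun k => ‖shellCoords F Δ (b k)‖ ^ 2) (F.dShell Δ) := by
  have h1 : ∀ n, HasSum (fun k => ‖b k n‖ ^ 2) 1 := fun n => by
    have h := hasSum_norm_component_sq b (ket n)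
    simp only [norm_component, norm_ket, one_pow] at h
    convert h using 2 with k
    rw [norm_inner_symm, inner_ket_left]
  have h2 := hasSum_sum (s := F.shell Δ) fun n _ => h1 n
  simp only [Finset.sum_const, nsmul_eq_mul, mul_one] at h2
  have e : (fun k => ‖shellCoords F Δ (b k)‖ ^ 2) =
      fun k => ∑ n ∈ F.shell Δ, ‖b k n‖ ^ 2 := by
    ext k
    rw [EuclideanSpace.norm_sq_eq]
    exact Finset.sum_coe_sort (F.shell Δ) (fun n => ‖b k n‖ ^ 2)
  rw [e]
  exact h2

theorem sum_norm_sq_inner_shellCoords_le (s : Finset κ)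
    (x : EuclideanSpace ℂ {n // n ∈ F.shell Δ}) :
    ∑ k ∈ s, ‖inner ℂ x (shellCoords F Δ (b k))‖ ^ 2 ≤ ‖x‖ ^ 2 := by
  rw [← norm_shellVec F Δ x]
  refine le_trans (le_of_eq ?_) (b.orthonormal.sum_inner_products_le (shellVec F Δ x) (s := s))
  refine Finset.sum_congr rfl fun k _ => ?_
  rw [norm_inner_symm, inner_shellVec]

theorem norm_sq_inner_shellState_le (c : F.ShellSphere Δ) (x : Fock N) :
    ‖inner ℂ x (F.shellState Δ c)‖ ^ 2 ≤ ‖shellCoords F Δ x‖ ^ 2 := by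
  rw [shellState_eq, inner_shellVec]
  refine pow_le_pow_left₀ (norm_nonneg _) ((norm_inner_le_norm _ _).trans (le_of_eq ?_)) 2
  rw [norm_eq_of_mem_sphere c, mul_one]

theorem continuous_shellState : Continuous (F.shellState Δ) := by
  refine continuous_iff_continuousAt.2 fun y => tendsto_iff_norm_sub_tendsto_zero.2 ?_
  have hc : Continuous fun x : F.ShellSphere Δ => dist x y := by fun_prop
  simp only [norm_shellState_sub]
  simpa using hc.tendsto y

theorem uniform_eq : F.uniform Δ = uniformSphere (EuclideanSpace ℂ {n // n ∈ F.shell Δ}) := rfl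

theorem finrank_shell :
    Module.finrank ℝ (EuclideanSpace ℂ {n // n ∈ F.shell Δ}) = 2 * F.dShell Δ := by
  rw [finrank_real_of_complex, finrank_euclideanSpace, Fintype.card_coe, FreeTheory.dShell]

end Shell

/-! ### The ℓ⁴ norm of the coefficients -/

section Typicality

variable {κ 𝓗 : Type*} [NormedAddCommGroup 𝓗] [InnerProductSpace ℂ 𝓗] (b : HilbertBasis κ ℂ 𝓗)

instance fact_one_le_four : Fact ((1 : ℝ≥0∞) ≤ 4) := ⟨by norm_num⟩

/-- The coordinates of a vector, as an element of `ℓ⁴`. -/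
noncomputable def quarticCoords (ψ : 𝓗) : lp (fun _ : κ => ℂ) 4 :=
  ⟨b.repr ψ, (lp.memℓp (b.repr ψ)).of_exponent_ge (by norm_num)⟩

theorem hasSum_norm_quarticCoords_pow (ψ : 𝓗) :
    HasSum (fun k => ‖inner ℂ (b k) ψ‖ ^ 4) (‖quarticCoords b ψ‖ ^ 4) := by
  have h := lp.hasSum_norm (p := 4) (by norm_num) (quarticCoords b ψ)
  have h4 : (4 : ℝ≥0∞).toReal = ((4 : ℕ) : ℝ) := by norm_num
  simp only [h4, Real.rpow_natCast] at h
  simp only [← b.repr_apply_apply]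
  exact h

theorem norm_quarticCoords_le (ψ : 𝓗) : ‖quarticCoords b ψ‖ ≤ ‖ψ‖ := by
  refine (pow_le_pow_iff_left₀ (norm_nonneg _) (norm_nonneg _) four_ne_zero).1 ?_
  have h := (hasSum_norm_component_sq b ψ).mul_left (‖ψ‖ ^ 2)
  simp only [norm_component] at h
  rw [show ‖ψ‖ ^ 4 = ‖ψ‖ ^ 2 * ‖ψ‖ ^ 2 by ring]
  refine hasSum_le (fun k => ?_) (hasSum_norm_quarticCoords_pow b ψ) h
  have h3 : ‖inner ℂ (b k) ψ‖ ≤ ‖ψ‖ := by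
    have := norm_inner_le_norm (𝕜 := ℂ) (b k) ψ
    rwa [b.orthonormal.1 k, one_mul] at this
  rw [show ‖inner ℂ (b k) ψ‖ ^ 4 = ‖inner ℂ (b k) ψ‖ ^ 2 * ‖inner ℂ (b k) ψ‖ ^ 2 by ring]
  gcongr

/-- Coordinates are linear and the ℓ⁴ norm is dominated by the ℓ² norm; this is the Lipschitz bound
needed for Lévy's lemma. -/
theorem abs_norm_quarticCoords_sub_le (ψ φ : 𝓗) :
    |‖quarticCoords b ψ‖ - ‖quarticCoords b φ‖| ≤ ‖ψ - φ‖ := by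
  refine (abs_norm_sub_norm_le _ _).trans (le_trans (le_of_eq ?_) (norm_quarticCoords_le b (ψ - φ)))
  congr 1
  ext k
  simp [quarticCoords]

theorem integral_pow_four_le {Ω : Type*} [MeasurableSpace Ω] {μ : Measure Ω}
    [IsProbabilityMeasure μ] {f : Ω → ℝ} (hf : Integrable f μ)
    (hf4 : Integrable (fun x => f x ^ 4) μ) : (∫ x, f x ∂μ) ^ 4 ≤ ∫ x, f x ^ 4 ∂μ := by
  set a := ∫ x, f x ∂μ
  have h : ∫ x, 4 * a ^ 3 * f x ∂μ ≤ ∫ x, (f x ^ 4 + 3 * a ^ 4) ∂μ := by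
    refine integral_mono (hf.const_mul _) (hf4.add (integrable_const _)) fun x => ?_
    -- The tangent-line inequality x⁴ ≥ 4a³x - 3a⁴, in factored form.
    have h2 : 0 ≤ (f x - a) ^ 2 * ((f x + a) ^ 2 + 2 * a ^ 2) := by positivity
    simp only
    nlinarith
  rw [integral_const_mul, integral_add hf4 (integrable_const _), integral_const,
    probReal_univ, one_smul] at h
  change 4 * a ^ 3 * a ≤ _ at h
  nlinarith

theorem integral_sq_le {Ω : Type*} [MeasurableSpace Ω] {μ : Measure Ω}
    [IsProbabilityMeasure μ] {f : Ω → ℝ} (hf : Integrable f μ)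
    (hf2 : Integrable (fun x => f x ^ 2) μ) : (∫ x, f x ∂μ) ^ 2 ≤ ∫ x, f x ^ 2 ∂μ := by
  set a := ∫ x, f x ∂μ
  have h : ∫ x, 2 * a * f x ∂μ ≤ ∫ x, (f x ^ 2 + a ^ 2) ∂μ := by
    refine integral_mono (hf.const_mul _) (hf2.add (integrable_const _)) fun x => ?_
    simp only
    nlinarith [sq_nonneg (f x - a)]
  rw [integral_const_mul, integral_add hf2 (integrable_const _), integral_const,
    probReal_univ, one_smul] at h
  change 2 * a * a ≤ _ at h
  nlinarith

end Typicality

/-! ### Typical size of the effective dimension -/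

section TypicalDimension

variable {N : ℕ} (F : FreeTheory N) (Δ : ℝ) {κ : Type*} (b : HilbertBasis κ ℂ (Fock N))

theorem continuous_norm_quarticCoords : Continuous fun ψ : Fock N => ‖quarticCoords b ψ‖ := by
  refine continuous_iff_continuousAt.2 fun y => tendsto_iff_norm_sub_tendsto_zero.2 ?_
  have hc : Continuous fun x : Fock N => ‖x - y‖ := by fun_prop
  refine squeeze_zero (fun _ => norm_nonneg _)
    (fun x => abs_norm_quarticCoords_sub_le b x y) ?_
  simpa using hc.tendsto y

theorem nontrivial_shell (hΔ : (F.shell Δ).Nonempty) :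
    Nontrivial (EuclideanSpace ℂ {n // n ∈ F.shell Δ}) := by
  obtain ⟨n, hn⟩ := hΔ
  have : Nonempty {n // n ∈ F.shell Δ} := ⟨⟨n, hn⟩⟩
  infer_instance

theorem eventually_tail_shellCoords_le {ε : ℝ} (hε : 0 < ε) : ∀ᶠ s : Finset κ in atTop,
    (F.dShell Δ : ℝ) - ∑ k ∈ s, ‖shellCoords F Δ (b k)‖ ^ 2 ≤ ε := by
  have h : Tendsto _ atTop _ := hasSum_norm_sq_shellCoords F Δ b
  filter_upwards [Metric.tendsto_nhds.1 h ε hε] with s hs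
  rw [Real.dist_eq, abs_sub_comm] at hs
  exact (le_abs_self _).trans hs.le

/-- With v_k the shell part of b k, the fourth moment of ⟨v_k, c⟩ is 2‖v_k‖⁴ / (d(d + 1)), at most
2‖v_k‖² / d². Now ∑ ‖v_k‖² = d. -/
theorem integral_norm_quarticCoords_pow_le (hΔ : (F.shell Δ).Nonempty) :
    ∫ c, ‖quarticCoords b (F.shellState Δ c)‖ ^ 4 ∂(F.uniform Δ) ≤ 2 / F.dShell Δ := by
  have := nontrivial_shell F Δ hΔ
  have : Nonempty {n // n ∈ F.shell Δ} := hΔ.to_subtype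
  have hd : 0 < (F.dShell Δ : ℝ) := by exact_mod_cast hΔ.card_pos
  rw [uniform_eq]
  refine le_of_forall_pos_le_add fun ε hε => ?_
  obtain ⟨s, hs⟩ := (eventually_tail_shellCoords_le F Δ b hε).exists
  -- Beyond s the quartic terms are at most ‖v_k‖², whose tail is below ε uniformly in c.
  have hpt : ∀ c : F.ShellSphere Δ, ‖quarticCoords b (F.shellState Δ c)‖ ^ 4 ≤
      ∑ k ∈ s, ‖inner ℂ (shellCoords F Δ (b k)) c.1‖ ^ 2 *
        ‖inner ℂ (shellCoords F Δ (b k)) c.1‖ ^ 2 + ε := by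
    intro c
    have h1 := (hasSum_norm_sq_shellCoords F Δ b).sub
      (hasSum_norm_quarticCoords_pow b (F.shellState Δ c))
    have hle : ∀ k, ‖inner ℂ (b k) (F.shellState Δ c)‖ ^ 4 ≤ ‖shellCoords F Δ (b k)‖ ^ 2 := by
      intro k
      have h2 := norm_sq_inner_shellState_le F Δ c (b k)
      have h3 : ‖shellCoords F Δ (b k)‖ ^ 2 ≤ 1 := by
        have := norm_shellCoords_le F Δ (b k)
        rw [b.orthonormal.1 k] at this
        exact pow_le_one₀ (norm_nonneg _) this
      nlinarith [sq_nonneg ‖inner ℂ (b k) (F.shellState Δ c)‖]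
    have h4 := sum_le_hasSum s (fun k _ => sub_nonneg.2 (hle k)) h1
    rw [Finset.sum_sub_distrib] at h4
    have h5 : ∑ k ∈ s, ‖inner ℂ (b k) (F.shellState Δ c)‖ ^ 4 =
        ∑ k ∈ s, ‖inner ℂ (shellCoords F Δ (b k)) c.1‖ ^ 2 *
        ‖inner ℂ (shellCoords F Δ (b k)) c.1‖ ^ 2 := by
      refine Finset.sum_congr rfl fun k _ => ?_
      rw [shellState_eq, inner_shellVec]
      ring
    linarith
  have hcont : ∀ k, Continuous fun c : F.ShellSphere Δ =>
      ‖inner ℂ (shellCoords F Δ (b k)) c.1‖ ^ 2 * ‖inner ℂ (shellCoords F Δ (b k)) c.1‖ ^ 2 :=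
    fun k => by fun_prop
  have hint : Integrable (fun c : F.ShellSphere Δ =>
      ‖quarticCoords b (F.shellState Δ c)‖ ^ 4)
      (uniformSphere (EuclideanSpace ℂ {n // n ∈ F.shell Δ})) :=
    integrable_uniformSphere
      (((continuous_norm_quarticCoords b).comp (continuous_shellState F Δ)).pow 4)
  have hint2 := integrable_uniformSphere
    (continuous_finsetSum s fun k _ => hcont k)
  refine (integral_mono hint (hint2.add (integrable_const ε)) hpt).trans ?_
  rw [integral_add' hint2 (integrable_const ε), integral_const, probReal_univ, one_smul,
    integral_finsetSum _ fun k _ => integrable_uniformSphere (hcont k)]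
  refine add_le_add_left ?_ ε
  simp only [integral_sphere_inner_sq_mul_inner_sq]
  have hcard : (Fintype.card {n // n ∈ F.shell Δ} : ℝ) = F.dShell Δ := by
    rw [Fintype.card_coe, FreeTheory.dShell]
  rw [hcard]
  have h6 : ∀ k, (‖shellCoords F Δ (b k)‖ ^ 2 * ‖shellCoords F Δ (b k)‖ ^ 2 +
      ‖inner ℂ (shellCoords F Δ (b k)) (shellCoords F Δ (b k))‖ ^ 2) /
      (F.dShell Δ * (F.dShell Δ + 1) : ℝ) ≤ 2 / (F.dShell Δ : ℝ) ^ 2 *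
        ‖shellCoords F Δ (b k)‖ ^ 2 := by
    intro k
    have h3 : ‖shellCoords F Δ (b k)‖ ^ 2 ≤ 1 := by
      have := norm_shellCoords_le F Δ (b k)
      rw [b.orthonormal.1 k] at this
      exact pow_le_one₀ (norm_nonneg _) this
    have h7 : ‖inner ℂ (shellCoords F Δ (b k)) (shellCoords F Δ (b k))‖ =
        ‖shellCoords F Δ (b k)‖ ^ 2 := by
      rw [inner_self_eq_norm_sq_to_K]
      simp
    rw [h7, div_mul_eq_mul_div]
    refine div_le_div₀ (by positivity) ?_ (by positivity) (by nlinarith)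
    nlinarith [sq_nonneg ‖shellCoords F Δ (b k)‖]
  refine (Finset.sum_le_sum fun k _ => h6 k).trans ?_
  rw [← Finset.mul_sum]
  have h8 := sum_le_hasSum s (fun _ _ => by positivity) (hasSum_norm_sq_shellCoords F Δ b)
  refine (mul_le_mul_of_nonneg_left h8 (by positivity)).trans (le_of_eq ?_)
  field_simp

theorem dEff_dephased_eq (ψ : Fock N) : dEff (dephased b ψ) = 1 / ‖quarticCoords b ψ‖ ^ 4 := by
  rw [dEff_dephased, (hasSum_norm_quarticCoords_pow b ψ).tsum_eq]

theorem norm_quarticCoords_pos {ψ : Fock N} (hψ : ψ ≠ 0) : 0 < ‖quarticCoords b ψ‖ := by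
  refine norm_pos_iff.2 fun h => hψ ?_
  rw [← b.repr.map_eq_zero_iff]
  ext k
  exact congrArg (fun f : lp (fun _ : κ => ℂ) 4 => f k) h

/-- Source of (ln 2)² in the constant: the increment of 2^x from 1/4 to 1/2 is at least (ln 2)/4. A
numerical estimate suffices. -/
theorem sq_log_two_div_le : (Real.log 2) ^ 2 / 16 ≤ (√2 - √(√2)) ^ 2 := by
  have h1 : (1.414 : ℝ) ≤ √2 := Real.le_sqrt_of_sq_le (by norm_num)
  have h2 : √2 ≤ 1.41422 := Real.sqrt_le_iff.2 ⟨by norm_num, by norm_num⟩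
  have h3 : √(√2) ≤ 1.19 := Real.sqrt_le_iff.2 ⟨by norm_num, by linarith⟩
  have h4 := Real.log_two_lt_d9
  have h5 := Real.log_two_gt_d9
  nlinarith

/-- With r = d^(-1/4), the mean ℓ⁴ norm is at most 2^(1/4) r, whereas d_eff < d/4 forces a norm of
at least √2 r. Lévy's lemma applies to the gap (√2 - 2^(1/4)) r in real dimension 2d, and r² d = √d
accounts for the rate. -/
theorem uniform_dEff_lt_le (hΔ : (F.shell Δ).Nonempty) :
    (F.uniform Δ).real {c | dEff (dephased b (F.shellState Δ c)) < (F.dShell Δ : ℝ) / 4} ≤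
      2 * Real.exp (-((Real.log 2) ^ 2 / (72 * Real.pi ^ 3)) * Real.sqrt (F.dShell Δ)) := by
  have := nontrivial_shell F Δ hΔ
  have hd1 : 0 < F.dShell Δ := hΔ.card_pos
  have hd : 0 < (F.dShell Δ : ℝ) := by exact_mod_cast hd1
  have hlip : LipschitzWith 1 fun c : F.ShellSphere Δ =>
      ‖quarticCoords b (F.shellState Δ c)‖ := by
    refine LipschitzWith.of_dist_le_mul fun c c' => ?_
    rw [NNReal.coe_one, one_mul, ← norm_shellState_sub]
    exact abs_norm_quarticCoords_sub_le b _ _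
  set r : ℝ := √(√(1 / (F.dShell Δ : ℝ)))
  have hr2 : r ^ 2 = √(1 / (F.dShell Δ : ℝ)) := Real.sq_sqrt (Real.sqrt_nonneg _)
  have hr4 : r ^ 4 = 1 / (F.dShell Δ : ℝ) := by
    rw [show r ^ 4 = (r ^ 2) ^ 2 by ring, hr2, Real.sq_sqrt (by positivity)]
  have hr : 0 < r := Real.sqrt_pos.2 (Real.sqrt_pos.2 (by positivity))
  have hq4 : (√(√2)) ^ 4 = 2 := by
    rw [show √(√2) ^ 4 = (√(√2) ^ 2) ^ 2 by ring, Real.sq_sqrt (Real.sqrt_nonneg _),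
      Real.sq_sqrt zero_le_two]
  have hs4 : √2 ^ 4 = 4 := by
    rw [show √2 ^ 4 = (√2 ^ 2) ^ 2 by ring, Real.sq_sqrt zero_le_two]
    norm_num
  have hlt : √(√2) < √2 := by
    refine (pow_lt_pow_iff_left₀ (Real.sqrt_nonneg _) (Real.sqrt_nonneg _) four_ne_zero).1 ?_
    rw [hq4, hs4]
    norm_num
  have hcont := (continuous_norm_quarticCoords b).comp (continuous_shellState F Δ)
  have hmean : ∫ c, ‖quarticCoords b (F.shellState Δ c)‖ ∂(F.uniform Δ) ≤ √(√2) * r := by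
    have h1 := integral_pow_four_le
      (μ := uniformSphere (EuclideanSpace ℂ {n // n ∈ F.shell Δ}))
      (integrable_uniformSphere hcont) (integrable_uniformSphere (hcont.pow 4))
    have h2 := h1.trans (integral_norm_quarticCoords_pow_le F Δ b hΔ)
    refine (pow_le_pow_iff_left₀ (integral_nonneg fun _ => norm_nonneg _) (by positivity)
      four_ne_zero).1 (h2.trans (le_of_eq ?_))
    rw [mul_pow, hq4, hr4]
    ring
  have hdev := uniformSphere_deviation_le (by rw [finrank_shell]; omega) hlip
    (ε := (√2 - √(√2)) * r) (mul_pos (sub_pos.2 hlt) hr)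
  refine (measureReal_mono ?_ (measure_ne_top (uniformSphere _) _)).trans (hdev.trans ?_)
  · intro c hc
    have hpos : 0 < ‖quarticCoords b (F.shellState Δ c)‖ := by
      refine norm_quarticCoords_pos b fun h => ?_
      have := norm_shellState F Δ c
      rw [h, norm_zero] at this
      exact zero_ne_one this
    have h1 : 1 / ‖quarticCoords b (F.shellState Δ c)‖ ^ 4 < (F.dShell Δ : ℝ) / 4 := by
      rw [← dEff_dephased_eq]
      exact hc
    have h2 : √2 * r ≤ ‖quarticCoords b (F.shellState Δ c)‖ := by
      refine (pow_le_pow_iff_left₀ (by positivity) hpos.le four_ne_zero).1 ?_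
      rw [mul_pow, hs4, hr4]
      rw [div_lt_div_iff₀ (by positivity) (by norm_num)] at h1
      rw [mul_one_div, div_le_iff₀ hd]
      linarith
    change ∫ c, ‖quarticCoords b (F.shellState Δ c)‖ ∂(F.uniform Δ) + _ ≤ _
    linarith
  · refine mul_le_mul_of_nonneg_left (Real.exp_le_exp.2 ?_) zero_le_two
    rw [neg_mul, neg_le_neg_iff, finrank_shell, mul_pow, hr2]
    have hsd : √(1 / (F.dShell Δ : ℝ)) * F.dShell Δ = √(F.dShell Δ) := by
      rw [Real.sqrt_div zero_le_one, Real.sqrt_one]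
      nth_rewrite 2 [← Real.mul_self_sqrt hd.le]
      field_simp
    push_cast
    have h3 : (√2 - √√2) ^ 2 * √(1 / (F.dShell Δ : ℝ)) * (2 * F.dShell Δ) / (9 * Real.pi ^ 3) =
        16 * (√2 - √√2) ^ 2 / (72 * Real.pi ^ 3) * √(F.dShell Δ) := by
      rw [← hsd]
      field_simp
      ring
    rw [h3]
    have := sq_log_two_div_le
    gcongr
    linarith

end TypicalDimension

/-! ### Independence of equilibrium from the initial state -/

section Universality

variable {N : ℕ} (F : FreeTheory N) (S : Finset (Fin N)) (Δ Λ : ℝ) {κ : Type*}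
  (b : HilbertBasis κ ℂ (Fock N))

theorem norm_ketbra_basis (k : κ) : ‖ketbra (b k) (b k)‖ = 1 := by
  rw [norm_ketbra, b.orthonormal.1 k, one_mul]

theorem hasSum_population_smul_ketbra (ψ : Fock N) : HasSum
    (fun k => ((‖inner ℂ (b k) ψ‖ ^ 2 : ℝ) : ℂ) • ketbra (b k) (b k)) (dephased b ψ) := by
  simpa only [ketbra_component] using hasSum_dephased b ψ

theorem hasSum_dephased_sub (ψ φ : Fock N) : HasSum
    (fun k => ((‖inner ℂ (b k) ψ‖ ^ 2 - ‖inner ℂ (b k) φ‖ ^ 2 : ℝ) : ℂ) • ketbra (b k) (b k))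
    (dephased b ψ - dephased b φ) := by
  have h := (hasSum_population_smul_ketbra b ψ).sub (hasSum_population_smul_ketbra b φ)
  simpa only [← sub_smul, ← Complex.ofReal_sub] using h

/-- Factor the difference of squares and use Cauchy–Schwarz twice. This ℓ¹ bound controls both
operator and trace norm differences of dephased states. -/
theorem summable_abs_populations_sub (ψ φ : Fock N) :
    (Summable fun k => |‖inner ℂ (b k) ψ‖ ^ 2 - ‖inner ℂ (b k) φ‖ ^ 2|) ∧
      ∑' k, |‖inner ℂ (b k) ψ‖ ^ 2 - ‖inner ℂ (b k) φ‖ ^ 2| ≤ (‖ψ‖ + ‖φ‖) * ‖ψ - φ‖ := by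
  have hc : ∀ x : Fock N, HasSum (fun k => ‖inner ℂ (b k) x‖ ^ 2) (‖x‖ ^ 2) := fun x => by
    simpa only [norm_component] using hasSum_norm_component_sq b x
  obtain ⟨s1, l1⟩ := summable_mul_of_hasSum_sq (fun _ => norm_nonneg _) (fun _ => norm_nonneg _)
    (norm_nonneg _) (norm_nonneg _) (hc ψ) (hc (ψ - φ))
  obtain ⟨s2, l2⟩ := summable_mul_of_hasSum_sq (fun _ => norm_nonneg _) (fun _ => norm_nonneg _)
    (norm_nonneg _) (norm_nonneg _) (hc φ) (hc (ψ - φ))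
  have hle : ∀ k, |‖inner ℂ (b k) ψ‖ ^ 2 - ‖inner ℂ (b k) φ‖ ^ 2| ≤
      ‖inner ℂ (b k) ψ‖ * ‖inner ℂ (b k) (ψ - φ)‖ +
        ‖inner ℂ (b k) φ‖ * ‖inner ℂ (b k) (ψ - φ)‖ := fun k => by
    have h1 : |‖inner ℂ (b k) ψ‖ - ‖inner ℂ (b k) φ‖| ≤ ‖inner ℂ (b k) (ψ - φ)‖ := by
      rw [inner_sub_right]
      exact abs_norm_sub_norm_le _ _
    rw [sq_sub_sq, abs_mul, abs_of_nonneg (by positivity), ← add_mul]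
    gcongr
  have hs := (s1.add s2).of_nonneg_of_le (fun _ => abs_nonneg _) hle
  refine ⟨hs, (hs.tsum_le_tsum hle (s1.add s2)).trans ?_⟩
  rw [s1.tsum_add s2, add_mul]
  exact add_le_add l1 l2

theorem norm_dephased_sub_le (ψ φ : Fock N) :
    ‖dephased b ψ - dephased b φ‖ ≤ (‖ψ‖ + ‖φ‖) * ‖ψ - φ‖ := by
  obtain ⟨hs, hle⟩ := summable_abs_populations_sub b ψ φ
  rw [← (hasSum_dephased_sub b ψ φ).tsum_eq]
  refine (tsum_of_norm_bounded hs.hasSum fun k => ?_).trans hle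
  rw [norm_smul, norm_ketbra_basis, mul_one, Complex.norm_real, Real.norm_eq_abs]

theorem traceNorm_truncReducedCLM_smul_ketbra_le (a : ℝ) (k : κ) :
    traceNorm (truncReducedCLM F S Λ ((a : ℂ) • ketbra (b k) (b k))) ≤ ENNReal.ofReal |a| := by
  rw [← ketbra_smul_left, ← truncReduced_eq, truncReduced_ketbra]
  refine (traceNorm_partialTrace_ketbra_le S _ _).trans (ENNReal.ofReal_le_ofReal ?_)
  have h1 : ‖F.cutoffProj Λ (b k)‖ ≤ 1 := (norm_proj_apply_le _ _).trans (b.orthonormal.1 k).le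
  have h2 : ‖F.cutoffProj Λ ((a : ℂ) • b k)‖ ≤ |a| := by
    refine (norm_proj_apply_le _ _).trans ?_
    rw [norm_smul, b.orthonormal.1 k, mul_one, Complex.norm_real, Real.norm_eq_abs]
  exact (mul_le_mul h2 h1 (norm_nonneg _) (abs_nonneg a)).trans (mul_one _).le

theorem traceNorm_truncReducedCLM_dephased_sub_le (ψ φ : Fock N) :
    traceNorm (truncReducedCLM F S Λ (dephased b ψ - dephased b φ)) ≤
      ENNReal.ofReal ((‖ψ‖ + ‖φ‖) * ‖ψ - φ‖) := by
  obtain ⟨hs, hle⟩ := summable_abs_populations_sub b ψ φ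
  refine (traceNorm_le_tsum_of_hasSum
    ((hasSum_dephased_sub b ψ φ).mapL (truncReducedCLM F S Λ))).trans ?_
  refine (ENNReal.tsum_le_tsum fun k =>
    traceNorm_truncReducedCLM_smul_ketbra_le F S Λ b _ k).trans ?_
  rw [← ENNReal.ofReal_tsum_of_nonneg (fun _ => abs_nonneg _) hs]
  exact ENNReal.ofReal_le_ofReal hle

theorem continuous_dephased_shellState :
    Continuous fun c : F.ShellSphere Δ => dephased b (F.shellState Δ c) := by
  refine continuous_iff_continuousAt.2 fun y => tendsto_iff_norm_sub_tendsto_zero.2 ?_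
  have hc : Continuous fun x : F.ShellSphere Δ => 2 * dist x y := by fun_prop
  refine squeeze_zero (fun _ => norm_nonneg _) (fun x => ?_) (by simpa using hc.tendsto y)
  refine (norm_dephased_sub_le b _ _).trans (le_of_eq ?_)
  rw [norm_shellState, norm_shellState, norm_shellState_sub]
  norm_num

/-- The average of the dephased state over the energy shell. -/
noncomputable def meanDephased : Fock N →L[ℂ] Fock N :=
  ∫ c, dephased b (F.shellState Δ c) ∂(F.uniform Δ)

/-- Each population is at most ‖v_k‖², with v_k the shell part of b k, so the tail bound is uniform
over the sphere and survives averaging. -/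
theorem norm_dephased_sub_sum_le (c : F.ShellSphere Δ) (s : Finset κ) :
    ‖dephased b (F.shellState Δ c) - ∑ k ∈ s,
      ((‖inner ℂ (b k) (F.shellState Δ c)‖ ^ 2 : ℝ) : ℂ) • ketbra (b k) (b k)‖ ≤
      F.dShell Δ - ∑ k ∈ s, ‖shellCoords F Δ (b k)‖ ^ 2 := by
  have h1 := (Finset.hasSum_compl_iff (a := dephased b (F.shellState Δ c) - ∑ k ∈ s,
    ((‖inner ℂ (b k) (F.shellState Δ c)‖ ^ 2 : ℝ) : ℂ) • ketbra (b k) (b k))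
    (f := fun k => ((‖inner ℂ (b k) (F.shellState Δ c)‖ ^ 2 : ℝ) : ℂ) • ketbra (b k) (b k)) s).2
    (by rw [sub_add_cancel]; exact hasSum_population_smul_ketbra b (F.shellState Δ c))
  have h2 := (Finset.hasSum_compl_iff (f := fun k => ‖shellCoords F Δ (b k)‖ ^ 2)
    (a := (F.dShell Δ : ℝ) - ∑ k ∈ s, ‖shellCoords F Δ (b k)‖ ^ 2) s).2
    (by rw [sub_add_cancel]; exact hasSum_norm_sq_shellCoords F Δ b)
  rw [← h1.tsum_eq]
  refine tsum_of_norm_bounded h2 fun k => ?_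
  rw [norm_smul, norm_ketbra_basis, mul_one, Complex.norm_real, Real.norm_of_nonneg (by positivity)]
  exact norm_sq_inner_shellState_le F Δ c (b k)

theorem continuous_population (k : κ) :
    Continuous fun c : F.ShellSphere Δ => ‖inner ℂ (b k) (F.shellState Δ c)‖ ^ 2 :=
  ((continuous_const.inner (continuous_shellState F Δ)).norm).pow 2

theorem integral_population (hΔ : (F.shell Δ).Nonempty) (k : κ) :
    ∫ c, ‖inner ℂ (b k) (F.shellState Δ c)‖ ^ 2 ∂(F.uniform Δ) =
      ‖shellCoords F Δ (b k)‖ ^ 2 / F.dShell Δ := by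
  have := nontrivial_shell F Δ hΔ
  have : Nonempty {n // n ∈ F.shell Δ} := hΔ.to_subtype
  simp only [shellState_eq, inner_shellVec, uniform_eq]
  rw [integral_sphere_inner_sq, Fintype.card_coe, FreeTheory.dShell]

theorem norm_meanDephased_sub_sum_le (hΔ : (F.shell Δ).Nonempty) (s : Finset κ) :
    ‖meanDephased F Δ b - ∑ k ∈ s,
      ((‖shellCoords F Δ (b k)‖ ^ 2 / F.dShell Δ : ℝ) : ℂ) • ketbra (b k) (b k)‖ ≤
      F.dShell Δ - ∑ k ∈ s, ‖shellCoords F Δ (b k)‖ ^ 2 := by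
  have := nontrivial_shell F Δ hΔ
  have hcont : ∀ k, Continuous fun c : F.ShellSphere Δ =>
      ((‖inner ℂ (b k) (F.shellState Δ c)‖ ^ 2 : ℝ) : ℂ) • ketbra (b k) (b k) := fun k =>
    (Complex.continuous_ofReal.comp (continuous_population F Δ b k)).smul continuous_const
  have h1 : ∑ k ∈ s, ((‖shellCoords F Δ (b k)‖ ^ 2 / F.dShell Δ : ℝ) : ℂ) • ketbra (b k) (b k) =
      ∫ c, ∑ k ∈ s, ((‖inner ℂ (b k) (F.shellState Δ c)‖ ^ 2 : ℝ) : ℂ) • ketbra (b k) (b k)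
        ∂(F.uniform Δ) := by
    rw [uniform_eq, integral_finsetSum _ fun k _ => integrable_uniformSphere (hcont k)]
    refine Finset.sum_congr rfl fun k _ => ?_
    rw [integral_smul_const, integral_complex_ofReal, ← uniform_eq, integral_population F Δ b hΔ]
  rw [h1, meanDephased, uniform_eq, ← integral_sub
    (integrable_uniformSphere (continuous_dephased_shellState F Δ b))
    (integrable_uniformSphere (continuous_finsetSum _ fun k _ => hcont k))]
  have h2 := norm_integral_le_of_norm_le_const (μ := uniformSphere _)
    (ae_of_all _ fun c : F.ShellSphere Δ => norm_dephased_sub_sum_le F Δ b c s)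
  rwa [probReal_univ, mul_one] at h2

theorem meanEquilibrium_eq (hΔ : (F.shell Δ).Nonempty) {E : κ → ℝ} (hE : Function.Injective E) :
    meanEquilibrium F b E S Δ Λ = truncReducedCLM F S Λ (meanDephased F Δ b) := by
  have := nontrivial_shell F Δ hΔ
  simp only [meanEquilibrium, truncReduced_eq, equilibrium_eq_dephased b _ hE]
  exact (truncReducedCLM F S Λ).integral_comp_comm
    (integrable_uniformSphere (continuous_dephased_shellState F Δ b))

theorem summable_and_purity_eq :
    Summable (fun k => ‖shellCoords F Δ (b k)‖ ^ 2 *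
      ‖reducedMatrix F S Λ (ketbra (b k) (b k))‖ ^ 2) ∧
    purity F b S Δ Λ = (∑' k, ‖shellCoords F Δ (b k)‖ ^ 2 *
      ‖reducedMatrix F S Λ (ketbra (b k) (b k))‖ ^ 2) / F.dShell Δ := by
  constructor
  · refine ((hasSum_norm_sq_shellCoords F Δ b).summable.mul_right
      (‖reducedMatrix F S Λ‖ ^ 2)).of_nonneg_of_le (fun _ => by positivity) fun k => ?_
    have h := (reducedMatrix F S Λ).le_opNorm (ketbra (b k) (b k))
    rw [norm_ketbra_basis, mul_one] at h
    gcongr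
  · rw [purity, ← tsum_div_const]
    refine tsum_congr fun k => ?_
    rw [truncReduced_eq, re_trace_truncReducedCLM_comp_self, norm_sq_shellCoords]
    ring

/-- The deviation is a sum of centred populations times fixed matrices. The sphere variance bound
gives ∑ ‖v_k‖² ‖m_k‖² / d², which is δ^Λ / d since δ^Λ already carries one factor 1/d; the tail of
the sum costs ε. -/
theorem integral_norm_reducedMatrix_le (hΔ : (F.shell Δ).Nonempty) :
    ∫ c, ‖reducedMatrix F S Λ (dephased b (F.shellState Δ c) - meanDephased F Δ b)‖
      ∂(F.uniform Δ) ≤ √(purity F b S Δ Λ / F.dShell Δ) := by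
  have := nontrivial_shell F Δ hΔ
  have : Nonempty {n // n ∈ F.shell Δ} := hΔ.to_subtype
  obtain ⟨hsum, hpur⟩ := summable_and_purity_eq F S Δ Λ b
  set M := ‖reducedMatrix F S Λ‖ + 1
  have hM : 0 < M := by positivity
  refine le_of_forall_pos_le_add fun ε hε => ?_
  obtain ⟨s, hs⟩ := (eventually_tail_shellCoords_le F Δ b (ε := ε / (2 * M)) (by positivity)).exists
  set v := fun k => shellCoords F Δ (b k)
  set m := fun k => reducedMatrix F S Λ (ketbra (b k) (b k))
  have hcard : (Fintype.card {n // n ∈ F.shell Δ} : ℝ) = F.dShell Δ := by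
    rw [Fintype.card_coe, FreeTheory.dShell]
  let f : F.ShellSphere Δ → EuclideanSpace ℂ (innerModes F S Λ × innerModes F S Λ) := fun c =>
    ∑ k ∈ s, (‖inner ℂ (v k) c.1‖ ^ 2 - ‖v k‖ ^ 2 / Fintype.card {n // n ∈ F.shell Δ}) • m k
  have hf : Continuous f := by
    have hfk : ∀ k, Continuous fun c : F.ShellSphere Δ =>
        ‖inner ℂ (v k) c.1‖ ^ 2 - ‖v k‖ ^ 2 / Fintype.card {n // n ∈ F.shell Δ} := fun k => by
      fun_prop
    exact continuous_finsetSum _ fun k _ => (hfk k).smul continuous_const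
  have hpt : ∀ c : F.ShellSphere Δ,
      ‖reducedMatrix F S Λ (dephased b (F.shellState Δ c) - meanDephased F Δ b)‖ ≤
        ‖f c‖ + ε := by
    intro c
    have h1 := (norm_dephased_sub_sum_le F Δ b c s).trans hs
    have h2 := (norm_meanDephased_sub_sum_le F Δ b hΔ s).trans hs
    set A := ∑ k ∈ s, ((‖inner ℂ (b k) (F.shellState Δ c)‖ ^ 2 : ℝ) : ℂ) • ketbra (b k) (b k)
      with hA
    set B := ∑ k ∈ s, ((‖shellCoords F Δ (b k)‖ ^ 2 / F.dShell Δ : ℝ) : ℂ) • ketbra (b k) (b k)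
      with hB
    have h3 : reducedMatrix F S Λ (A - B) = f c := by
      rw [hA, hB, ← Finset.sum_sub_distrib, map_sum]
      refine Finset.sum_congr rfl fun k _ => ?_
      rw [← sub_smul, ← Complex.ofReal_sub, map_smul, Complex.coe_smul, hcard, shellState_eq,
        inner_shellVec]
    have h4 : ‖reducedMatrix F S Λ ((dephased b (F.shellState Δ c) - A) -
        (meanDephased F Δ b - B))‖ ≤ ε := by
      refine (ContinuousLinearMap.le_opNorm _ _).trans ?_
      calc _ ≤ M * (ε / (2 * M) + ε / (2 * M)) :=
            mul_le_mul (by simp [M]) ((norm_sub_le _ _).trans (add_le_add h1 h2))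
              (norm_nonneg _) hM.le
        _ = ε := by field_simp; ring
    have h5 : dephased b (F.shellState Δ c) - meanDephased F Δ b =
        (A - B) + ((dephased b (F.shellState Δ c) - A) - (meanDephased F Δ b - B)) := by abel
    rw [h5, map_add, h3]
    exact (norm_add_le _ _).trans (add_le_add_right h4 _)
  have hcont : Continuous fun c : F.ShellSphere Δ =>
      ‖reducedMatrix F S Λ (dephased b (F.shellState Δ c) - meanDephased F Δ b)‖ :=
    ((reducedMatrix F S Λ).continuous.comp
      ((continuous_dephased_shellState F Δ b).sub continuous_const)).norm
  have hi := integrable_uniformSphere hf.norm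
  rw [uniform_eq]
  refine (integral_mono (integrable_uniformSphere hcont) (hi.add (integrable_const ε)) hpt).trans ?_
  rw [integral_add' hi (integrable_const ε), integral_const, probReal_univ, one_smul]
  refine add_le_add_left (Real.le_sqrt_of_sq_le ?_) ε
  refine (integral_sq_le hi (integrable_uniformSphere (hf.norm.pow 2))).trans ?_
  refine (integral_sphere_norm_sum_sq_le s v m
    (sum_norm_sq_inner_shellCoords_le F Δ b s)).trans ?_
  rw [hpur, hcard, div_div, ← sq]
  gcongr
  exact hsum.sum_le_tsum s fun _ _ => by positivity

theorem uniform_traceNorm_lt_le (hΔ : (F.shell Δ).Nonempty) {E : κ → ℝ}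
    (hE : Function.Injective E) {ε : ℝ} (hε : 0 < ε) :
    (F.uniform Δ).real {c | ENNReal.ofReal
        (1 / 2 * √(F.dSub S Λ * purity F b S Δ Λ / F.dShell Δ) + ε) <
      1 / 2 * traceNorm (F.truncReduced S Λ (dephased b (F.shellState Δ c)) -
        meanEquilibrium F b E S Δ Λ)} ≤
      2 * Real.exp (-(2 / (9 * Real.pi ^ 3)) * ε ^ 2 * F.dShell Δ) := by
  have := nontrivial_shell F Δ hΔ
  have hd1 : 0 < F.dShell Δ := hΔ.card_pos
  simp only [meanEquilibrium_eq F S Δ Λ b hΔ hE, truncReduced_eq, ← map_sub]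
  have hfin := traceNorm_truncReducedCLM_ne_top F S Λ
  set g : F.ShellSphere Δ → ℝ := fun c => 1 / 2 * (traceNorm (truncReducedCLM F S Λ
    (dephased b (F.shellState Δ c) - meanDephased F Δ b))).toReal with hg
  -- On unit vectors the trace norm is 2-Lipschitz, and the factor 1/2 makes g 1-Lipschitz.
  have hlip : LipschitzWith 1 g := by
    refine LipschitzWith.of_dist_le_mul fun c c' => ?_
    have h := abs_toReal_traceNorm_sub_le (C := 2 * dist c c') (hfin _) (hfin _) ?_
      (by positivity) (X := truncReducedCLM F S Λ
        (dephased b (F.shellState Δ c) - meanDephased F Δ b)) (Y := truncReducedCLM F S Λ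
        (dephased b (F.shellState Δ c') - meanDephased F Δ b))
    · rw [NNReal.coe_one, one_mul, Real.dist_eq, hg, ← mul_sub, abs_mul,
        abs_of_pos (by norm_num : (0 : ℝ) < 1 / 2)]
      linarith
    · rw [← map_sub, sub_sub_sub_cancel_right]
      refine (traceNorm_truncReducedCLM_dephased_sub_le F S Λ b _ _).trans (le_of_eq ?_)
      rw [norm_shellState, norm_shellState, norm_shellState_sub]
      norm_num
  have hcont : Continuous fun c : F.ShellSphere Δ =>
      ‖reducedMatrix F S Λ (dephased b (F.shellState Δ c) - meanDephased F Δ b)‖ :=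
    ((reducedMatrix F S Λ).continuous.comp
      ((continuous_dephased_shellState F Δ b).sub continuous_const)).norm
  have hmean : ∫ c, g c ∂(uniformSphere (EuclideanSpace ℂ {n // n ∈ F.shell Δ})) ≤
      1 / 2 * √(F.dSub S Λ * purity F b S Δ Λ / F.dShell Δ) := by
    have h1 : ∀ c, g c ≤ 1 / 2 * √(F.dSub S Λ) *
        ‖reducedMatrix F S Λ (dephased b (F.shellState Δ c) - meanDephased F Δ b)‖ := fun c => by
      rw [hg, mul_assoc]
      refine mul_le_mul_of_nonneg_left ?_ (by norm_num)
      exact ENNReal.toReal_le_of_le_ofReal (by positivity) (traceNorm_truncReducedCLM_le F S Λ _)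
    refine (integral_mono (g := fun c => 1 / 2 * √(F.dSub S Λ) *
        ‖reducedMatrix F S Λ (dephased b (F.shellState Δ c) - meanDephased F Δ b)‖)
      (integrable_uniformSphere hlip.continuous)
      (integrable_uniformSphere (continuous_const.mul hcont)) h1).trans ?_
    rw [integral_const_mul, mul_assoc, mul_div_assoc, Real.sqrt_mul (by positivity)]
    exact mul_le_mul_of_nonneg_left (mul_le_mul_of_nonneg_left
      (integral_norm_reducedMatrix_le F S Δ Λ b hΔ) (Real.sqrt_nonneg _)) (by norm_num)
  have hdev := uniformSphere_deviation_le (by rw [finrank_shell]; omega) hlip hε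
  refine (measureReal_mono ?_ (measure_ne_top (uniformSphere _) _)).trans (hdev.trans (le_of_eq ?_))
  · intro c hc
    have h1 : 1 / 2 * traceNorm (truncReducedCLM F S Λ
        (dephased b (F.shellState Δ c) - meanDephased F Δ b)) = ENNReal.ofReal (g c) := by
      rw [hg, ENNReal.ofReal_mul (by norm_num), ENNReal.ofReal_toReal (hfin _)]
      congr 1
      rw [ENNReal.ofReal_div_of_pos (by norm_num)]
      simp
    rw [Set.mem_ofPred_eq, h1] at hc
    have h2 := lt_of_not_ge fun h => not_le.2 hc (ENNReal.ofReal_le_ofReal h)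
    change _ + ε ≤ g c
    linarith
  · rw [finrank_shell]
    congr 2
    push_cast
    ring

end Universality

end Equilibration

open Equilibration in
theorem theorem4 {N : ℕ} (F : FreeTheory N) (Δ : ℝ) (hΔ : (F.shell Δ).Nonempty)
    {κ : Type*} (H : Fock N →ₗ.[ℂ] Fock N) (hH : IsSelfAdjoint H)
    (b : HilbertBasis κ ℂ (Fock N)) (E : κ → ℝ) (hb : IsEigenbasis H b E)
    (hE : NondegenerateGaps E)
    (S : Finset (Fin N)) (Λ : ℝ) (hΛ : 0 < Λ) :
    (∀ c : F.ShellSphere Δ,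
      HasTimeAverage (state b E (F.shellState Δ c)) (equilibrium b E (F.shellState Δ c))) ∧
    (∀ c : F.ShellSphere Δ, ∃ m : ℝ≥0∞,
      HasTimeMean (fun t => traceNorm
        (F.truncReduced S Λ (state b E (F.shellState Δ c) t) -
          F.truncReduced S Λ (equilibrium b E (F.shellState Δ c)))) m ∧
      m ≤ ENNReal.ofReal
        (Real.sqrt ((F.dSub S Λ : ℝ) ^ 2 / dEff (equilibrium b E (F.shellState Δ c))))) ∧
    (∀ c : F.ShellSphere Δ, ∃ m : ℝ≥0∞,
      HasTimeMean (fun t => traceNorm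
        ((partialTrace S (state b E (F.shellState Δ c) t) -
            partialTrace S (equilibrium b E (F.shellState Δ c))) -
          (F.truncReduced S Λ (state b E (F.shellState Δ c) t) -
            F.truncReduced S Λ (equilibrium b E (F.shellState Δ c))))) m ∧
      m ≤ 6 * (F.meanEnergy (equilibrium b E (F.shellState Δ c)) / ENNReal.ofReal Λ) ^
        (1 / 2 : ℝ)) ∧
    (F.uniform Δ).real
        {c | dEff (equilibrium b E (F.shellState Δ c)) < (F.dShell Δ : ℝ) / 4} ≤
      2 * Real.exp (-((Real.log 2) ^ 2 / (72 * Real.pi ^ 3)) * Real.sqrt (F.dShell Δ)) ∧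
    (∀ ε : ℝ, 0 < ε →
      (F.uniform Δ).real
          {c | ENNReal.ofReal
              (1 / 2 * Real.sqrt (F.dSub S Λ * purity F b S Δ Λ / F.dShell Δ) + ε) <
            1 / 2 * traceNorm (F.truncReduced S Λ (equilibrium b E (F.shellState Δ c)) -
              meanEquilibrium F b E S Δ Λ)} ≤
        2 * Real.exp (-(2 / (9 * Real.pi ^ 3)) * ε ^ 2 * F.dShell Δ)) := by
  have hinj := NondegenerateGaps.injective hE
  simp only [equilibrium_eq_dephased b _ hinj]
  refine ⟨fun c => hasTimeAverage_state b _ hinj, fun c => ?_, fun c => ?_, ?_, fun ε hε => ?_⟩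
  · exact exists_hasTimeMean_traceNorm_truncReduced F S Λ b _ hE
  · obtain ⟨m, hm, hle⟩ := exists_hasTimeMean_traceNorm_truncError F S Λ b (F.shellState Δ c) hinj
      (norm_shellState F Δ c) hΛ
    refine ⟨m, ?_, hle⟩
    -- The truncation error of the difference is the difference of the truncation errors.
    simp only [truncError, sub_sub_sub_comm] at hm ⊢
    exact hm
  · exact uniform_dEff_lt_le F Δ b hΔ
  · exact uniform_traceNorm_lt_le F S Δ Λ b hΔ hinj hε
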